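/- **Conventions.** A PPT algorithm is a classical (uniform) probabilistic polynomial-time algorithm; a QPT algorithm is a quantum polynomial-time algorithm, i.e. a polynomial-time uniform family of quantum circuits over a fixed universal gate set followed by measurement and polynomial-time classical post-processing. For an algorithm $\mathcal{A}$ with input $1^\lambda$ and classical output, $\mathcal{A}(1^\lambda)$ also denotes its output distribution on bit strings. $\mathsf{SD}(P,Q)=\frac12\sum_x|P(x)-Q(x)|$ is the statistical distance. All polynomials are positive on $\mathbb{N}$. Let $\Sigma\subseteq\mathbb{N}$. *Quantum advantage samplers.* A QPT algorithm $\mathcal{A}$ that takes $1^\lambda$ as input and outputs a classical bit string is a quantum advantage sampler (QAS) on $\Sigma$ if there is a polynomial $p$ such that for every PPT algorithm $\mathcal{B}$ there is $\lambda^*\in\mathbb{N}$ with $$\mathsf{SD}(\mathcal{A}(1^\lambda),\mathcal{B}(1^\lambda))>\frac1{p(\lambda)}\qquad\text{for all }\lambda\ge\lambda^*\text{ in }\Sigma .$$ *Non-interactive IV-PoQ.* A non-interactive inefficient-verifier proof of quantumness (IV-PoQ) on $\Sigma$ is a pair $(\mathcal{P},\mathcal{V})$, where the prover $\mathcal{P}$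 is a QPT algorithm that on input $1^\lambda$ outputs a bit string $\tau$, and the verifier $\mathcal{V}$ is an algorithm without time bound (always halting, possibly randomized) that on input $1^\lambda$ and $\tau$ outputs $\top$ or $\bot$, such that for some functions $c,s:\mathbb{N}\to\mathbb{R}$ and some polynomial $q$ with $c(\lambda)-s(\lambda)\ge 1/q(\lambda)$ for all $\lambda$: - (completeness) there is $\lambda^*$ such that $\Pr[\top\gets\mathcal{V}(1^\lambda,\tau):\tau\gets\mathcal{P}(1^\lambda)]\ge c(\lambda)$ for all $\lambda\ge\lambda^*$; - (soundness on $\Sigma$) for every PPT algorithm $\mathcal{P}^*$ there is $\lambda^{**}$ such that $\Pr[\top\gets\mathcal{V}(1^\lambda,\tau):\tau\gets\mathcal{P}^*(1^\lambda)]\le s(\lambda)$ for all $\lambda\ge\lambda^{**}$ in $\Sigma$. For $\Sigma=\mathbb{N}$ one omits "on $\Sigma$". **Theorem.** Quantum advantage samplers exist if and only if non-interactive IV-PoQ exist. More generally, for every infinite set $\Sigma\subseteq\mathbb{N}$, quantum advantage samplers on $\Sigma$ exist if and only if non-interactive IV-PoQ on $\Sigma$ exist. -/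

import Mathlib

namespace QAdv

/-! ### Classical computation with a step count

A multi-tape Turing machine whose tapes are stacks of bits, written as a structured program.
A program mentions finitely many stacks, each elementary step inspects or changes only the top
of one stack, and each elementary step costs one unit of time. -/

/-- Programs acting on bit stacks indexed by natural numbers. -/
inductive Prog : Type
  /-- do nothing -/
  | skip : Prog
  /-- push the bit `b` on stack `i` -/
  | push (i : ℕ) (b : Bool) : Prog
  /-- remove the top bit of stack `i` (no effect if it is empty) -/
  | pop (i : ℕ) : Prog
  /-- run `p`, then `q` -/
  | seq (p q : Prog) : Prog
  /-- run `p` if stack `i` is nonempty with top bit `b`, otherwise run `q` -/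
  | ifTop (i : ℕ) (b : Bool) (p q : Prog) : Prog
  /-- run `p` as long as stack `i` is nonempty -/
  | loop (i : ℕ) (p : Prog) : Prog

/-- The contents of all stacks; the top of a stack is the head of its list. -/
abbrev Store : Type := ℕ → List Bool

/-- `Exec p s s' t`: program `p`, started on the stacks `s`, halts after exactly `t` steps with
the stacks `s'`. -/
inductive Exec : Prog → Store → Store → ℕ → Prop
  | skip (s : Store) : Exec .skip s s 1
  | push (i : ℕ) (b : Bool) (s : Store) :
      Exec (.push i b) s (Function.update s i (b :: s i)) 1
  | pop (i : ℕ) (s : Store) :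
      Exec (.pop i) s (Function.update s i (s i).tail) 1
  | seq {p q : Prog} {s s' s'' : Store} {t t' : ℕ} :
      Exec p s s' t → Exec q s' s'' t' → Exec (.seq p q) s s'' (t + t')
  | ifTop_pos {i : ℕ} {b : Bool} {p q : Prog} {s s' : Store} {t : ℕ} :
      (s i).head? = some b → Exec p s s' t → Exec (.ifTop i b p q) s s' (t + 1)
  | ifTop_neg {i : ℕ} {b : Bool} {p q : Prog} {s s' : Store} {t : ℕ} :
      (s i).head? ≠ some b → Exec q s s' t → Exec (.ifTop i b p q) s s' (t + 1)
  | loop_done {i : ℕ} {p : Prog} {s : Store} :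
      s i = [] → Exec (.loop i p) s s 1
  | loop_step {i : ℕ} {p : Prog} {s s' s'' : Store} {t t' : ℕ} :
      s i ≠ [] → Exec p s s' t → Exec (.loop i p) s' s'' t' →
        Exec (.loop i p) s s'' (t + t' + 1)

/-- The initial stacks: the `i`-th argument is on stack `i`, all other stacks are empty. -/
def inputStore (args : List (List Bool)) : Store := fun i => args.getD i []

/-- Program `p` on the arguments `args` halts within `t` steps, with output `out` on stack `0`. -/
def OutputsInTime (p : Prog) (args : List (List Bool)) (out : List Bool) (t : ℕ) : Prop :=
  ∃ (s : Store) (t' : ℕ), t' ≤ t ∧ Exec p (inputStore args) s t' ∧ s 0 = out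

/-- The string `1^lam`. -/
def unary (lam : ℕ) : List Bool := List.replicate lam true

/-- `m` independent fair coins, as a bit string of length `m`. -/
noncomputable def coinFlips (m : ℕ) : PMF (List Bool) :=
  (PMF.uniformOfFintype (Fin m → Bool)).map List.ofFn

/-- A PPT algorithm that takes `1^lam` as input and outputs a bit string: a program that on
`1^lam` and a random seed of polynomial length halts in polynomial time. -/
structure PPTSampler where
  /-- the program -/
  prog : Prog
  /-- the number of random bits -/
  coins : Polynomial ℕ
  /-- the running time -/
  time : Polynomial ℕ
  /-- the output on `1^lam` and a seed -/
  out : ℕ → List Bool → List Bool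
  /-- the program computes the output in polynomial time -/
  computes : ∀ (lam : ℕ) (r : List Bool), r.length = coins.eval lam →
    OutputsInTime prog [unary lam, r] (out lam r) (time.eval lam)

/-- The output distribution of a PPT algorithm on input `1^lam`. -/
noncomputable def PPTSampler.dist (B : PPTSampler) (lam : ℕ) : PMF (List Bool) :=
  (coinFlips (B.coins.eval lam)).map (B.out lam)

/-! ### Quantum circuits

Circuits over the universal gate set consisting of the Hadamard gate, the phase gate
`diag(1, i)`, CNOT and the Toffoli gate. -/

/-- Gates on `n` qubits. -/
inductive Gate (n : ℕ) : Type
  /-- Hadamard gate on qubit `i` -/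
  | had (i : Fin n) : Gate n
  /-- phase gate `diag(1, i)` on qubit `i` -/
  | phase (i : Fin n) : Gate n
  /-- CNOT with control `c` and target `t` -/
  | cnot (c t : Fin n) (h : c ≠ t) : Gate n
  /-- Toffoli gate with controls `c`, `d` and target `t` -/
  | toffoli (c d t : Fin n) (hcd : c ≠ d) (hct : c ≠ t) (hdt : d ≠ t) : Gate n

/-- Vectors of amplitudes in the computational basis of `n` qubits. -/
abbrev QState (n : ℕ) : Type := (Fin n → Bool) → ℂ

/-- Flip bit `t`. -/
def flipBit {n : ℕ} (t : Fin n) (x : Fin n → Bool) : Fin n → Bool :=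
  Function.update x t (!x t)

/-- The unitary of a gate, acting on amplitude vectors. -/
noncomputable def Gate.apply {n : ℕ} : Gate n → QState n → QState n
  | .had i, ψ => fun x =>
      (ψ (Function.update x i false) + (if x i then -1 else 1) * ψ (Function.update x i true))
        / (Real.sqrt 2 : ℂ)
  | .phase i, ψ => fun x => if x i then Complex.I * ψ x else ψ x
  | .cnot c t _, ψ => fun x => ψ (if x c then flipBit t x else x)
  | .toffoli c d t _ _ _, ψ => fun x => ψ (if x c && x d then flipBit t x else x)

/-- The initial state `|0...0⟩`. -/
noncomputable def zeroState (n : ℕ) : QState n := fun x => if x = fun _ => false then 1 else 0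

/-- A quantum circuit: a number of qubits and a list of gates, the first one applied first. -/
structure QCircuit where
  /-- the number of qubits -/
  qubits : ℕ
  /-- the gates -/
  gates : List (Gate qubits)

/-- The state after running the circuit on `|0...0⟩`. -/
noncomputable def QCircuit.finalState (C : QCircuit) : QState C.qubits :=
  C.gates.foldl (fun ψ g => g.apply ψ) (zeroState C.qubits)

theorem flipBit_flipBit {n : ℕ} (t : Fin n) (x : Fin n → Bool) : flipBit t (flipBit t x) = x := by
  simp [flipBit]

theorem sum_controlled {n : ℕ} (t : Fin n) (b : (Fin n → Bool) → Bool)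
    (hb : ∀ x, b (flipBit t x) = b x) (f : (Fin n → Bool) → ℝ) :
    ∑ x, f (if b x then flipBit t x else x) = ∑ x, f x := by
  have hinv : Function.Involutive
      (fun x : Fin n → Bool => if b x then flipBit t x else x) := by
    intro x
    by_cases h : b x = true
    · simp [h, hb, flipBit_flipBit]
    · simp [h]
  exact Equiv.sum_comp hinv.toPerm f

theorem Gate.sum_normSq_apply {n : ℕ} (g : Gate n) (ψ : QState n) :
    ∑ x, Complex.normSq (g.apply ψ x) = ∑ x, Complex.normSq (ψ x) := by
  cases g with
  | phase i =>
    refine Finset.sum_congr rfl fun x _ => ?_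
    by_cases h : x i = true <;> simp [Gate.apply, h]
  | cnot c t h =>
    exact sum_controlled t (fun x => x c) (fun x => by simp [flipBit, h])
      (fun x => Complex.normSq (ψ x))
  | toffoli c d t hcd hct hdt =>
    exact sum_controlled t (fun x => x c && x d) (fun x => by simp [flipBit, hct, hdt])
      (fun x => Complex.normSq (ψ x))
  | had i =>
    have key : ∀ F : (Fin n → Bool) → ℝ,
        2 * ∑ x, F x = ∑ x, (F x + F (flipBit i x)) := by
      intro F
      have h := sum_controlled i (fun _ => true) (fun _ => rfl) F
      simp only [if_true] at h
      rw [Finset.sum_add_distrib, h]; ring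
    have h2 : (Real.sqrt 2 : ℝ) * Real.sqrt 2 = 2 := Real.mul_self_sqrt (by norm_num)
    have hs : ∀ z : ℂ, Complex.normSq (z / (Real.sqrt 2 : ℂ)) = Complex.normSq z / 2 := by
      intro z
      rw [Complex.normSq_div, Complex.normSq_ofReal, h2]
    have e : 2 * ∑ x, Complex.normSq ((Gate.had i).apply ψ x)
        = 2 * ∑ x, Complex.normSq (ψ x) := by
      rw [key, key]
      refine Finset.sum_congr rfl fun x => fun _ => ?_
      cases hx : x i
      · have e1 : Function.update x i false = x := by rw [← hx]; simp
        simp only [Gate.apply, flipBit, hx, hs, e1, Function.update_idem, Function.update_self,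
          Bool.not_false]
        simp only [Complex.normSq_apply]
        simp
        ring
      · have e1 : Function.update x i true = x := by rw [← hx]; simp
        simp only [Gate.apply, flipBit, hx, hs, e1, Function.update_idem, Function.update_self,
          Bool.not_true]
        simp only [Complex.normSq_apply]
        simp
        ring
    linarith

theorem QCircuit.sum_normSq_finalState (C : QCircuit) :
    ∑ x, Complex.normSq (C.finalState x) = 1 := by
  have h : ∀ (gs : List (Gate C.qubits)) (ψ : QState C.qubits),
      ∑ x, Complex.normSq (gs.foldl (fun ψ g => g.apply ψ) ψ x) = ∑ x, Complex.normSq (ψ x) := by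
    intro gs
    induction gs with
    | nil => intro ψ; rfl
    | cons g gs ih => intro ψ; rw [List.foldl_cons, ih, Gate.sum_normSq_apply]
  rw [QCircuit.finalState, h]
  simp [zeroState, apply_ite Complex.normSq]

/-- The distribution of the outcome when all qubits are measured in the computational basis
(Born rule). -/
noncomputable def QCircuit.measure (C : QCircuit) : PMF (Fin C.qubits → Bool) :=
  PMF.ofFintype (fun x => ENNReal.ofReal (Complex.normSq (C.finalState x))) (by
    rw [← ENNReal.ofReal_sum_of_nonneg fun x _ => Complex.normSq_nonneg _,
      C.sum_normSq_finalState, ENNReal.ofReal_one])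

/-- Self-delimiting unary code of a natural number: `1^k 0`. -/
def encodeIndex (k : ℕ) : List Bool := List.replicate k true ++ [false]

/-- The description of a gate: two bits for its kind, then the qubits it acts on. -/
def Gate.encode {n : ℕ} : Gate n → List Bool
  | .had i => [false, false] ++ encodeIndex i
  | .phase i => [false, true] ++ encodeIndex i
  | .cnot c t _ => [true, false] ++ encodeIndex c ++ encodeIndex t
  | .toffoli c d t _ _ _ =>
      [true, true] ++ encodeIndex c ++ encodeIndex d ++ encodeIndex t

/-- The description of a circuit: its number of qubits, followed by its gates. -/
def QCircuit.encode (C : QCircuit) : List Bool :=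
  encodeIndex C.qubits ++ C.gates.flatMap Gate.encode

/-- A QPT algorithm that takes `1^lam` as input and outputs a classical bit string: a
polynomial-time uniform family of quantum circuits on `|0...0⟩`, whose qubits are all measured at
the end, followed by deterministic polynomial-time classical post-processing of the outcome. -/
structure QPTSampler where
  /-- the circuit run on input `1^lam` -/
  circuit : ℕ → QCircuit
  /-- the program that writes down the circuit -/
  genProg : Prog
  /-- the running time of `genProg` -/
  genTime : Polynomial ℕ
  /-- the circuit family is polynomial-time uniform -/
  gen_computes : ∀ lam : ℕ,
    OutputsInTime genProg [unary lam] (circuit lam).encode (genTime.eval lam)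
  /-- the classical post-processing -/
  post : ℕ → List Bool → List Bool
  /-- the program for the post-processing -/
  postProg : Prog
  /-- the running time of `postProg` -/
  postTime : Polynomial ℕ
  /-- the post-processing is computed in polynomial time -/
  post_computes : ∀ (lam : ℕ) (w : List Bool), w.length = (circuit lam).qubits →
    OutputsInTime postProg [unary lam, w] (post lam w) (postTime.eval lam)

/-- The output distribution of a QPT algorithm on input `1^lam`. -/
noncomputable def QPTSampler.dist (A : QPTSampler) (lam : ℕ) : PMF (List Bool) :=
  (A.circuit lam).measure.map fun x => A.post lam (List.ofFn x)

/-! ### Quantum advantage samplers and non-interactive IV-PoQ -/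

/-- Statistical distance `1/2 ∑ |p a - q a|`. -/
noncomputable def statDist {α : Type*} (p q : PMF α) : ℝ :=
  (1 / 2) * ∑' a, |(p a).toReal - (q a).toReal|

/-- A polynomial that is positive on the natural numbers. -/
def IsPositive (p : Polynomial ℝ) : Prop := ∀ n : ℕ, 0 < p.eval (n : ℝ)

/-- `A` is a quantum advantage sampler on `S`. -/
def IsQASOn (S : Set ℕ) (A : QPTSampler) : Prop :=
  ∃ p : Polynomial ℝ, IsPositive p ∧
    ∀ B : PPTSampler, ∃ lam₀ : ℕ, ∀ lam ∈ S, lam₀ ≤ lam →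
      statDist (A.dist lam) (B.dist lam) > 1 / p.eval (lam : ℝ)

/-- `A` is a quantum advantage sampler. -/
def IsQAS (A : QPTSampler) : Prop := IsQASOn Set.univ A

/-- An unbounded verifier: a (possibly randomized) algorithm without any time bound that always
halts and, on input `1^lam` and a string `τ`, accepts or rejects. -/
structure UnboundedVerifier where
  /-- the number of random bits used on input `(1^lam, τ)` -/
  coins : ℕ → List Bool → ℕ
  /-- the verdict on `(1^lam, τ)` with a given random seed -/
  verdict : ℕ → List Bool → List Bool → Bool
  /-- the number of random bits is computable -/
  coins_computable : Computable₂ coins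
  /-- the verdict is computable -/
  verdict_computable :
    Computable fun x : ℕ × List Bool × List Bool => verdict x.1 x.2.1 x.2.2

/-- The distribution of the verdict on `(1^lam, τ)`. -/
noncomputable def UnboundedVerifier.run (V : UnboundedVerifier) (lam : ℕ) (τ : List Bool) :
    PMF Bool :=
  (coinFlips (V.coins lam τ)).map (V.verdict lam τ)

/-- The probability that `V` accepts a string `τ` sampled from `D`. -/
noncomputable def UnboundedVerifier.acceptProb (V : UnboundedVerifier) (lam : ℕ)
    (D : PMF (List Bool)) : ℝ :=
  ((D.bind (V.run lam)) true).toReal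

/-- `(P, V)` is a non-interactive inefficient-verifier proof of quantumness on `S`: the prover
sends a single string and the first verifier does nothing, so the transcript is that string. -/
def IsNonInteractiveIVPoQOn (S : Set ℕ) (P : QPTSampler) (V : UnboundedVerifier) : Prop :=
  ∃ (c s : ℕ → ℝ) (q : Polynomial ℝ), IsPositive q ∧
    (∀ lam : ℕ, c lam - s lam ≥ 1 / q.eval (lam : ℝ)) ∧
    (∃ lam₀ : ℕ, ∀ lam ≥ lam₀, V.acceptProb lam (P.dist lam) ≥ c lam) ∧
    (∀ P' : PPTSampler, ∃ lam₁ : ℕ, ∀ lam ∈ S, lam₁ ≤ lam →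
      V.acceptProb lam (P'.dist lam) ≤ s lam)

/-- `(P, V)` is a non-interactive inefficient-verifier proof of quantumness. -/
def IsNonInteractiveIVPoQ (P : QPTSampler) (V : UnboundedVerifier) : Prop :=
  IsNonInteractiveIVPoQOn Set.univ P V

end QAdv

/-! From a proof of quantumness to a sampler: the prover itself is the sampler. The verdict is a
randomized test, and a test cannot separate two distributions by more than their statistical
distance (`acceptProb_le_add_statDist`). Hence every classical algorithm stays at distance at least
`1/q`.

From a sampler `A` to a proof of quantumness: the prover sends the raw measurement outcomes of `m`
independent copies of the circuit of `A`, for a polynomial `m`. Let `Q` be the product distribution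
of these outcomes and `μ` the sum of the output distributions of the first `lam + 1` clocked
classical machines. The verifier accepts `τ` if `μ(τ) ≤ (lam + 1) * R * Q(τ)`. It can decide this
exactly: classical probabilities are counts of seeds over a power of two, and circuit probabilities
are squared path sums, again integers over a power of two (`measure_toReal`).

Completeness is Markov's inequality. On rejected strings `Q < μ / ((lam + 1) * R)`, and `μ` has
total mass at most `lam + 1`, so the honest prover is rejected with probability at most `1/R`
(`ratioVerifier_complete`).

For soundness, suppose a PPT algorithm `B` is accepted with probability above `1 - 2/R`. Once `lam`
exceeds the index of `B`, its distribution is at most `μ`, so its restriction `D` to accepted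
strings satisfies `D ≤ (lam + 1) * R * Q`. A law dominated by `C` times a product law has a randomly
chosen coordinate that is nearly distributed as a single factor: the weighted mean of any bounded
test over the blocks concentrates under `Q`, and passing from `Q` to `D` costs only `log C`, by the
convex duality behind relative entropy (`sum_weighted_mean_le`). Running `B`, selecting a random
block and applying the post-processing of `A` is therefore a classical algorithm close to `A`
(`statDist_blockSampler_le`), contradicting the quantum advantage. The number of copies depends on
`lam`, `R` and the desired error, not on `B`.

Algorithms have only fair coins, so the block number is the number of ones among `2k` coins. Its
binomial law is not uniform, but its largest weight is at most `(2k + 1)^(-1/2)`, which is flat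
enough (`choose_div_le`).

The rest is machine-level work: programs that write down the copied circuit (`exists_copiesGen`) and
that extract a block (`exists_blockSampler`) in polynomial time, and a primitive recursive
interpreter that makes the verifier computable. -/

namespace QAdv

/-! ### An interpreter for programs -/

/-- Code of a program as a natural number. -/
def Prog.code : Prog → ℕ
  | .skip => Nat.pair 0 0
  | .push i b => Nat.pair 1 (Nat.pair i b.toNat)
  | .pop i => Nat.pair 2 i
  | .seq p q => Nat.pair 3 (Nat.pair p.code q.code)
  | .ifTop i b p q => Nat.pair 4 (Nat.pair (Nat.pair i b.toNat) (Nat.pair p.code q.code))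
  | .loop i p => Nat.pair 5 (Nat.pair i p.code)

/-- Set entry `i` of a list of stacks, padding it with empty stacks if necessary. -/
def setPad (L : List (List Bool)) (i : ℕ) (v : List Bool) : List (List Bool) :=
  (L ++ (List.range (i + 1)).map fun _ => []).set i v

/-- Padding is invisible because `inputStore` reads a missing stack as empty; the interpreter can
thus keep the infinitely many stacks in a finite list. -/
theorem inputStore_setPad (L : List (List Bool)) (i : ℕ) (v : List Bool) :
    inputStore (setPad L i v) = Function.update (inputStore L) i v := by
  funext j
  rcases eq_or_ne j i with rfl | h
  · simp only [inputStore, setPad, List.getD_eq_getElem?_getD, Function.update_self]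
    rw [List.getElem?_set_self (by simp; omega)]
    rfl
  · rw [Function.update_of_ne h]
    simp only [inputStore, setPad, List.getD_eq_getElem?_getD, List.getElem?_set_ne h.symm]
    rcases lt_or_ge j L.length with hj | hj
    · rw [List.getElem?_append_left hj]
    · rw [List.getElem?_append_right hj, List.getElem?_eq_none hj]
      simp only [List.getElem?_map, Option.getD_none]
      cases (List.range (i + 1))[j - L.length]? <;> rfl

/-- One step of the interpreter: the first component of a configuration lists the codes of the
programs that are still to be run. -/
def interpStep (x : List ℕ × List (List Bool)) : List ℕ × List (List Bool) :=
  let c := x.1.headI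
  let k := x.1.tail
  let a := c.unpair.2
  if c.unpair.1 = 1 then
    (k, setPad x.2 a.unpair.1 ((a.unpair.2.bodd) :: x.2.getD a.unpair.1 []))
  else if c.unpair.1 = 2 then (k, setPad x.2 a (x.2.getD a []).tail)
  else if c.unpair.1 = 3 then (a.unpair.1 :: a.unpair.2 :: k, x.2)
  else if c.unpair.1 = 4 then
    if (x.2.getD a.unpair.1.unpair.1 []).head? = some a.unpair.1.unpair.2.bodd then
      (a.unpair.2.unpair.1 :: k, x.2)
    else (a.unpair.2.unpair.2 :: k, x.2)
  else if c.unpair.1 = 5 then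
    if x.2.getD a.unpair.1 [] = [] then (k, x.2) else (a.unpair.2 :: c :: k, x.2)
  else (k, x.2)

@[simp] theorem bodd_toNat (b : Bool) : b.toNat.bodd = b := by cases b <;> rfl

/-- A `seq` is free in `Exec` but costs the interpreter one step to unfold. The bound `n + 1 ≤ 2 *
t` leaves one spare step per subprogram, which pays for it. The pending programs `k` are arbitrary
so that the induction can push continuations. -/
theorem Exec.interp {p : Prog} {s s' : Store} {t : ℕ} (h : Exec p s s' t) :
    ∀ (k : List ℕ) (L : List (List Bool)), inputStore L = s →
      ∃ n L', n + 1 ≤ 2 * t ∧ inputStore L' = s' ∧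
        interpStep^[n] (p.code :: k, L) = (k, L') := by
  induction h with
  | skip s =>
    intro k L hL
    exact ⟨1, L, by simp, hL, by simp [interpStep, Prog.code]⟩
  | push i b s =>
    intro k L hL
    refine ⟨1, _, by simp, ?_, by simp [interpStep, Prog.code]; rfl⟩
    rw [inputStore_setPad, hL]; subst hL; rfl
  | pop i s =>
    intro k L hL
    refine ⟨1, _, by simp, ?_, by simp [interpStep, Prog.code]; rfl⟩
    rw [inputStore_setPad, hL]; subst hL; rfl
  | @seq p q s s' s'' t t' _ _ ih1 ih2 =>
    intro k L hL
    obtain ⟨n1, L1, h1, e1, i1⟩ := ih1 (q.code :: k) L hL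
    obtain ⟨n2, L2, h2, e2, i2⟩ := ih2 k L1 e1
    refine ⟨n2 + (n1 + 1), L2, by omega, e2, ?_⟩
    have : interpStep ((Prog.seq p q).code :: k, L) = (p.code :: q.code :: k, L) := by
      simp [interpStep, Prog.code]
    rw [Function.iterate_add_apply, Function.iterate_succ_apply, this, i1, i2]
  | @ifTop_pos i b p q s s' t hs _ ih =>
    intro k L hL
    obtain ⟨n1, L1, h1, e1, i1⟩ := ih k L hL
    refine ⟨n1 + 1, L1, by omega, e1, ?_⟩
    have : interpStep ((Prog.ifTop i b p q).code :: k, L) = (p.code :: k, L) := by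
      subst hL
      simp only [inputStore] at hs
      simp only [interpStep, Prog.code, List.headI_cons, Nat.unpair_pair, List.tail_cons,
        bodd_toNat, hs]
      simp
    rw [Function.iterate_succ_apply, this, i1]
  | @ifTop_neg i b p q s s' t hs _ ih =>
    intro k L hL
    obtain ⟨n1, L1, h1, e1, i1⟩ := ih k L hL
    refine ⟨n1 + 1, L1, by omega, e1, ?_⟩
    have : interpStep ((Prog.ifTop i b p q).code :: k, L) = (q.code :: k, L) := by
      subst hL
      simp only [inputStore] at hs
      simp only [interpStep, Prog.code, List.headI_cons, Nat.unpair_pair, List.tail_cons,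
        bodd_toNat, hs]
      simp
    rw [Function.iterate_succ_apply, this, i1]
  | @loop_done i p s hs =>
    intro k L hL
    refine ⟨1, L, by simp, hL, ?_⟩
    subst hL
    simp only [inputStore] at hs
    simp only [Function.iterate_one, interpStep, Prog.code, List.headI_cons, Nat.unpair_pair,
      List.tail_cons, hs]
    simp
  | @loop_step i p s s' s'' t t' hs _ _ ih1 ih2 =>
    intro k L hL
    obtain ⟨n1, L1, h1, e1, i1⟩ := ih1 ((Prog.loop i p).code :: k) L hL
    obtain ⟨n2, L2, h2, e2, i2⟩ := ih2 k L1 e1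
    refine ⟨n2 + (n1 + 1), L2, by omega, e2, ?_⟩
    have : interpStep ((Prog.loop i p).code :: k, L)
        = (p.code :: (Prog.loop i p).code :: k, L) := by
      subst hL
      simp only [inputStore] at hs
      simp only [interpStep, Prog.code, List.headI_cons, Nat.unpair_pair, List.tail_cons, hs]
      simp
    rw [Function.iterate_add_apply, Function.iterate_succ_apply, this, i1, i2]

/-- The default head of the empty list is `0`, which decodes to `skip`; a halted computation is
therefore unaffected by surplus fuel. -/
theorem interpStep_iterate_nil (n : ℕ) (L : List (List Bool)) :
    interpStep^[n] ([], L) = ([], L) := by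
  apply Function.iterate_fixed
  simp [interpStep]

/-- Run the program with code `c` for `fuel` interpreter steps and read off stack `0`. -/
def interp (c fuel : ℕ) (args : List (List Bool)) : List Bool :=
  (interpStep^[fuel] ([c], args)).2.getD 0 []

theorem OutputsInTime.interp_eq {p : Prog} {args : List (List Bool)} {out : List Bool} {t : ℕ}
    (h : OutputsInTime p args out t) {fuel : ℕ} (hf : 2 * t ≤ fuel) :
    interp p.code fuel args = out := by
  obtain ⟨s, t', ht, he, h0⟩ := h
  obtain ⟨n, L, hn, hL, hi⟩ := he.interp [] args rfl
  obtain ⟨d, rfl⟩ : ∃ d, fuel = d + n := ⟨fuel - n, by omega⟩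
  rw [interp, Function.iterate_add_apply, hi, interpStep_iterate_nil, ← h0, ← hL]
  rfl

/-! ### Primitive recursiveness of the interpreter -/

theorem primrec_setPad {α : Type*} [Primcodable α] {f : α → List (List Bool)} {g : α → ℕ}
    {h : α → List Bool} (hf : Primrec f) (hg : Primrec g) (hh : Primrec h) :
    Primrec fun a => setPad (f a) (g a) (h a) := by
  have e : Primrec fun a => f a ++ (List.range (g a + 1)).map fun _ => ([] : List Bool) :=
    Primrec.list_append.comp hf (Primrec.list_map (Primrec.list_range.comp (Primrec.succ.comp hg))
      (Primrec₂.const _))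
  exact Primrec.list_set.comp e (Primrec.pair hg hh)

theorem primrec_interpStep : Primrec interpStep := by
  have hc : Primrec fun x : List ℕ × List (List Bool) => x.1.headI :=
    Primrec.list_headI.comp Primrec.fst
  have hk : Primrec fun x : List ℕ × List (List Bool) => x.1.tail :=
    Primrec.list_tail.comp Primrec.fst
  have u1 : ∀ {f : List ℕ × List (List Bool) → ℕ}, Primrec f → Primrec fun x => (f x).unpair.1 :=
    fun hf => Primrec.fst.comp (Primrec.unpair.comp hf)
  have u2 : ∀ {f : List ℕ × List (List Bool) → ℕ}, Primrec f → Primrec fun x => (f x).unpair.2 :=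
    fun hf => Primrec.snd.comp (Primrec.unpair.comp hf)
  have ha := u2 hc
  have hget : ∀ {f : List ℕ × List (List Bool) → ℕ}, Primrec f →
      Primrec fun x : List ℕ × List (List Bool) => x.2.getD (f x) [] :=
    fun hf => (Primrec.list_getD []).comp Primrec.snd hf
  have hL : Primrec fun x : List ℕ × List (List Bool) => x.2 := Primrec.snd
  have tag : ∀ n : ℕ, PrimrecPred fun x : List ℕ × List (List Bool) =>
      x.1.headI.unpair.1 = n := fun n => Primrec.eq.comp (u1 hc) (Primrec.const n)
  have cons2 : ∀ {f g : List ℕ × List (List Bool) → ℕ}, Primrec f → Primrec g →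
      Primrec fun x => f x :: g x :: x.1.tail :=
    fun hf hg => Primrec.list_cons.comp hf (Primrec.list_cons.comp hg hk)
  have cons1 : ∀ {f : List ℕ × List (List Bool) → ℕ}, Primrec f →
      Primrec fun x => f x :: x.1.tail :=
    fun hf => Primrec.list_cons.comp hf hk
  refine Primrec.ite (tag 1) (Primrec.pair hk (primrec_setPad hL (u1 ha)
      (Primrec.list_cons.comp (Primrec.nat_bodd.comp (u2 ha)) (hget (u1 ha))))) ?_
  refine Primrec.ite (tag 2) (Primrec.pair hk (primrec_setPad hL ha
      (Primrec.list_tail.comp (hget ha)))) ?_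
  refine Primrec.ite (tag 3) (Primrec.pair (cons2 (u1 ha) (u2 ha)) hL) ?_
  refine Primrec.ite (tag 4) (Primrec.ite (Primrec.eq.comp
      (Primrec.list_head?.comp (hget (u1 (u1 ha))))
      (Primrec.option_some.comp (Primrec.nat_bodd.comp (u2 (u1 ha)))))
      (Primrec.pair (cons1 (u1 (u2 ha))) hL) (Primrec.pair (cons1 (u2 (u2 ha))) hL)) ?_
  exact Primrec.ite (tag 5) (Primrec.ite (Primrec.eq.comp (hget (u1 ha)) (Primrec.const []))
      (Primrec.pair hk hL) (Primrec.pair (cons2 (u2 ha) hc) hL)) (Primrec.pair hk hL)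

theorem primrec_interp {α : Type*} [Primcodable α] {c f : α → ℕ} {g : α → List (List Bool)}
    (hc : Primrec c) (hf : Primrec f) (hg : Primrec g) :
    Primrec fun a => interp (c a) (f a) (g a) := by
  have h0 : Primrec fun a => (([c a], g a) : List ℕ × List (List Bool)) :=
    Primrec.pair (Primrec.list_cons.comp hc (Primrec.const [])) hg
  exact (Primrec.list_getD []).comp (Primrec.snd.comp
    (Primrec.nat_iterate hf h0 (primrec_interpStep.comp Primrec.snd).to₂)) (Primrec.const 0)

/-! ### Polynomials as coefficient lists, and enumeration of bit strings -/

/-- The value at `n` of the polynomial with the given list of coefficients. -/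
def evalCoeffs (l : List ℕ) (n : ℕ) : ℕ := l.foldr (fun a b => a + n * b) 0

/-- A coefficient list is plain data, so the index of a machine can carry its clock and its number
of coins (see `machine`). -/
theorem exists_evalCoeffs (p : Polynomial ℕ) : ∃ l, ∀ n, evalCoeffs l n = p.eval n := by
  induction p using Polynomial.recOnHorner with
  | M0 => exact ⟨[], fun n => by simp [evalCoeffs]⟩
  | MC p a h0 ha ih =>
    obtain ⟨l, hl⟩ := ih
    cases l with
    | nil => exact ⟨[a], fun n => by have := hl n; simp [evalCoeffs] at *; omega⟩
    | cons b l =>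
      refine ⟨(b + a) :: l, fun n => ?_⟩
      have := hl n
      simp [evalCoeffs] at *
      omega
  | MX p hp ih =>
    obtain ⟨l, hl⟩ := ih
    refine ⟨0 :: l, fun n => ?_⟩
    have := hl n
    simp only [evalCoeffs, List.foldr_cons, zero_add] at *
    simp [this, mul_comm]

theorem primrec_evalCoeffs {α : Type*} [Primcodable α] {f : α → List ℕ} {g : α → ℕ}
    (hf : Primrec f) (hg : Primrec g) : Primrec fun a => evalCoeffs (f a) (g a) :=
  Primrec.list_foldr hf (Primrec.const 0) (Primrec.nat_add.comp
    (Primrec.fst.comp Primrec.snd)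
    (Primrec.nat_mul.comp (hg.comp Primrec.fst) (Primrec.snd.comp Primrec.snd))).to₂

theorem primrec_eval (p : Polynomial ℕ) : Primrec fun n => p.eval n := by
  obtain ⟨l, hl⟩ := exists_evalCoeffs p
  exact (primrec_evalCoeffs (Primrec.const l) Primrec.id).of_eq hl

theorem primrec_pow {α : Type*} [Primcodable α] {f g : α → ℕ} (hf : Primrec f)
    (hg : Primrec g) : Primrec fun a => f a ^ g a :=
  (Primrec₂.unpaired'.1 Nat.Primrec.pow).comp hf hg

theorem unary_eq (n : ℕ) : unary n = (List.range n).map fun _ => true := by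
  simp [unary]

theorem primrec_unary : Primrec unary :=
  (Primrec.list_map Primrec.list_range (Primrec₂.const true)).of_eq fun n => (unary_eq n).symm

/-- All bit strings of length `n`. -/
def bitStrings : ℕ → List (List Bool)
  | 0 => [[]]
  | n + 1 => (bitStrings n).flatMap fun l => [false :: l, true :: l]

theorem primrec_bitStrings : Primrec bitStrings := by
  have h : Primrec₂ fun (_ : ℕ) (x : ℕ × List (List Bool)) =>
      x.2.flatMap fun l => [false :: l, true :: l] := by
    refine (Primrec.list_flatMap (Primrec.snd.comp Primrec.snd) ?_ :
      Primrec fun y : ℕ × ℕ × List (List Bool) => y.2.2.flatMap fun l => [false :: l, true :: l])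
    exact (Primrec.list_cons.comp (Primrec.list_cons.comp (Primrec.const false) Primrec.snd)
      (Primrec.list_cons.comp (Primrec.list_cons.comp (Primrec.const true) Primrec.snd)
        (Primrec.const []))).to₂
  refine (Primrec.nat_rec' Primrec.id (Primrec.const [[]]) h).of_eq fun n => ?_
  induction n with
  | zero => rfl
  | succ n ih => simp only [id_eq] at ih ⊢; rw [bitStrings, ← ih]

end QAdv


namespace QAdv

/-! ### Computing outcome probabilities of circuits by summing over paths -/

theorem primrec_listSum {α β : Type*} [Primcodable α] [Primcodable β] {f : α → List β}
    {g : α → β → ℕ} (hf : Primrec f) (hg : Primrec₂ g) :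
    Primrec fun a => ((f a).map (g a)).sum := by
  refine (Primrec.list_foldr (h := fun a (x : β × ℕ) => g a x.1 + x.2) hf (Primrec.const 0)
    (Primrec.nat_add.comp (hg.comp Primrec.fst (Primrec.fst.comp Primrec.snd))
      (Primrec.snd.comp Primrec.snd)).to₂).of_eq fun a => ?_
  induction f a with
  | nil => rfl
  | cons b l ih => simp [ih]

/-- The leading number in unary of a bit string. -/
def readNat (l : List Bool) : ℕ := (l.takeWhile id).length

/-- What follows the leading number. -/
def readRest (l : List Bool) : List Bool := (l.dropWhile id).tail

@[simp] theorem readNat_encodeIndex (k : ℕ) (l : List Bool) :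
    readNat (encodeIndex k ++ l) = k := by
  induction k with
  | zero => simp [readNat, encodeIndex]
  | succ k ih => simp [readNat, encodeIndex, List.replicate_succ]

@[simp] theorem readRest_encodeIndex (k : ℕ) (l : List Bool) :
    readRest (encodeIndex k ++ l) = l := by
  induction k with
  | zero => simp [readRest, encodeIndex]
  | succ k ih => simp [readRest, encodeIndex, List.replicate_succ]

theorem primrec_readNat : Primrec readNat :=
  Primrec.list_length.comp (Primrec.list_takeWhile Primrec.id)

theorem primrec_readRest : Primrec readRest :=
  Primrec.list_tail.comp (Primrec.list_dropWhile Primrec.id)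

/-- The basis states that a gate leads to from a basis state, with the increments of the exponent
of the imaginary unit. -/
def Gate.branch {n : ℕ} : Gate n → (Fin n → Bool) × ℕ → List ((Fin n → Bool) × ℕ)
  | .had i, y => [(Function.update y.1 i false, y.2),
      (Function.update y.1 i true, y.2 + 2 * (y.1 i).toNat)]
  | .phase i, y => [(y.1, y.2 + (y.1 i).toNat)]
  | .cnot c t _, y => [(if y.1 c then flipBit t y.1 else y.1, y.2)]
  | .toffoli c d t _ _ _, y => [(if y.1 c && y.1 d then flipBit t y.1 else y.1, y.2)]

/-- The number of Hadamard gates, for a single gate. -/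
def Gate.hadCount {n : ℕ} : Gate n → ℕ
  | .had _ => 1
  | _ => 0

/-- The sum of the phases of the paths that end in `x`. -/
noncomputable def pathSum {n : ℕ} (L : List ((Fin n → Bool) × ℕ)) : QState n :=
  fun x => (L.map fun y => if y.1 = x then Complex.I ^ y.2 else 0).sum

theorem pathSum_flatMap {n : ℕ} (L : List ((Fin n → Bool) × ℕ))
    (f : (Fin n → Bool) × ℕ → List ((Fin n → Bool) × ℕ)) (x : Fin n → Bool) :
    pathSum (L.flatMap f) x = (L.map fun y => pathSum (f y) x).sum := by
  induction L with
  | nil => rfl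
  | cons y L ih =>
    simp only [pathSum, List.flatMap_cons, List.map_append, List.sum_append, List.map_cons,
      List.sum_cons] at *
    rw [ih]

theorem controlled_eq_iff {n : ℕ} (t : Fin n) (b : (Fin n → Bool) → Bool)
    (hb : ∀ x, b (flipBit t x) = b x) (x y : Fin n → Bool) :
    (if b y then flipBit t y else y) = x ↔ y = if b x then flipBit t x else x := by
  constructor
  · rintro rfl
    by_cases h : b y = true <;> simp [h, hb, flipBit_flipBit]
  · rintro rfl
    by_cases h : b x = true <;> simp [h, hb, flipBit_flipBit]

theorem update_false_eq_iff {n : ℕ} (i : Fin n) (b : Bool) (x y : Fin n → Bool) :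
    Function.update y i b = x ↔
      x i = b ∧ (y = Function.update x i false ∨ y = Function.update x i true) := by
  constructor
  · rintro rfl
    refine ⟨by simp, ?_⟩
    cases h : y i
    · left; simp [← h]
    · right; simp [← h]
  · rintro ⟨rfl, rfl | rfl⟩ <;> simp

theorem update_false_ne_true {n : ℕ} (i : Fin n) (x : Fin n → Bool) :
    Function.update x i false ≠ Function.update x i true := by
  intro h
  have := congrFun h i
  simp at this

/-- Every gate sends a basis state to basis states with coefficients that are powers of `i`, except
for the factor `1/√2` of a Hadamard gate, which is cleared here. Its sign `-1` appears as `i ^ 2`,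
whence the increment by `2` in `Gate.branch`. -/
theorem pathSum_branch {n : ℕ} (g : Gate n) (L : List ((Fin n → Bool) × ℕ)) (x : Fin n → Bool) :
    pathSum (L.flatMap g.branch) x
      = (Real.sqrt 2 : ℂ) ^ g.hadCount * g.apply (pathSum L) x := by
  rw [pathSum_flatMap]
  cases g with
  | had i =>
    have h2 : (Real.sqrt 2 : ℂ) ≠ 0 := by
      simp
    simp only [Gate.hadCount, pow_one, Gate.apply]
    rw [mul_div_cancel₀ _ h2]
    simp only [pathSum]
    rw [← List.sum_map_mul_left, ← List.sum_map_add]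
    congr 1
    refine List.map_congr_left fun y _ => ?_
    simp only [Gate.branch, List.map_cons, List.map_nil, List.sum_cons, List.sum_nil, add_zero,
      update_false_eq_iff]
    have hne := update_false_ne_true i x
    by_cases h0 : y.1 = Function.update x i false
    · have h1 : y.1 i = false := by rw [h0]; simp
      cases hx : x i <;> simp [h0, hne]
    · by_cases h1 : y.1 = Function.update x i true
      · cases hx : x i <;> simp [h1, hne.symm, pow_add]
      · cases hx : x i <;> simp [h0, h1]
  | phase i =>
    simp only [Gate.hadCount, pow_zero, one_mul, Gate.apply, pathSum]
    by_cases hx : x i = true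
    · rw [if_pos hx, ← List.sum_map_mul_left]
      congr 1
      refine List.map_congr_left fun y _ => ?_
      by_cases h : y.1 = x
      · simp [Gate.branch, h, hx, pow_succ']
      · simp [Gate.branch, h]
    · rw [if_neg hx]
      congr 1
      refine List.map_congr_left fun y _ => ?_
      by_cases h : y.1 = x
      · simp [Gate.branch, h, hx]
      · simp [Gate.branch, h]
  | cnot c t hct =>
    simp only [Gate.hadCount, pow_zero, one_mul, Gate.apply, pathSum]
    congr 1
    refine List.map_congr_left fun y _ => ?_
    simp only [Gate.branch, List.map_cons, List.map_nil, List.sum_cons, List.sum_nil, add_zero,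
      controlled_eq_iff t (fun x => x c) (fun x => by simp [flipBit, hct])]
  | toffoli c d t hcd hct hdt =>
    simp only [Gate.hadCount, pow_zero, one_mul, Gate.apply, pathSum]
    congr 1
    refine List.map_congr_left fun y _ => ?_
    simp only [Gate.branch, List.map_cons, List.map_nil, List.sum_cons, List.sum_nil, add_zero,
      controlled_eq_iff t (fun x => x c && x d) (fun x => by simp [flipBit, hct, hdt])]

theorem Gate.apply_smul {n : ℕ} (g : Gate n) (a : ℂ) (ψ : QState n) :
    g.apply (fun x => a * ψ x) = fun x => a * g.apply ψ x := by
  funext x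
  cases g with
  | had i => simp only [Gate.apply]; ring
  | phase i => simp only [Gate.apply]; split_ifs <;> ring
  | cnot c t h => rfl
  | toffoli c d t hcd hct hdt => rfl

/-- All paths through a list of gates. -/
def allPaths {n : ℕ} (gs : List (Gate n)) (L : List ((Fin n → Bool) × ℕ)) :
    List ((Fin n → Bool) × ℕ) :=
  gs.foldl (fun L g => L.flatMap g.branch) L

theorem pathSum_allPaths {n : ℕ} (gs : List (Gate n)) (L : List ((Fin n → Bool) × ℕ)) :
    pathSum (allPaths gs L) = fun x => (Real.sqrt 2 : ℂ) ^ (gs.map Gate.hadCount).sum *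
      gs.foldl (fun ψ g => g.apply ψ) (pathSum L) x := by
  induction gs generalizing L with
  | nil => simp [allPaths]
  | cons g gs ih =>
    have e : pathSum (L.flatMap g.branch)
        = fun x => (Real.sqrt 2 : ℂ) ^ g.hadCount * g.apply (pathSum L) x :=
      funext fun x => pathSum_branch g L x
    have h : ∀ (gs : List (Gate n)) (a : ℂ) (ψ : QState n),
        gs.foldl (fun ψ g => g.apply ψ) (fun x => a * ψ x)
          = fun x => a * gs.foldl (fun ψ g => g.apply ψ) ψ x := by
      intro gs
      induction gs with
      | nil => intro a ψ; rfl
      | cons g gs ih => intro a ψ; rw [List.foldl_cons, Gate.apply_smul, ih]; rfl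
    have := ih (L.flatMap g.branch)
    simp only [allPaths, List.foldl_cons] at this ⊢
    rw [this, e, h]
    funext x
    simp only [List.map_cons, List.sum_cons, pow_add]
    ring

/-! ### Path enumeration on encoded circuits -/

/-- The state of the path enumeration: the unread part of the description of the circuit, the
number of Hadamard gates read, and the paths. -/
abbrev PathConfig : Type := List Bool × ℕ × List (List Bool × ℕ)

/-- Flip bit `t` of `x` if `b` holds. -/
def flipIf (b : Bool) (t : ℕ) (x : List Bool) : List Bool :=
  if b then x.set t (!x.getD t false) else x

/-- Read one gate and extend all paths by it. -/
def pathStep (c : PathConfig) : PathConfig :=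
  let r := c.1.tail.tail
  let i := readNat r
  let r1 := readRest r
  let j := readNat r1
  let r2 := readRest r1
  let k := readNat r2
  if c.1 = [] then c
  else if c.1.headI = false then
    if c.1.tail.headI = false then
      (r1, c.2.1 + 1, c.2.2.flatMap fun y =>
        [(y.1.set i false, y.2), (y.1.set i true, y.2 + 2 * (y.1.getD i false).toNat)])
    else (r1, c.2.1, c.2.2.map fun y => (y.1, y.2 + (y.1.getD i false).toNat))
  else if c.1.tail.headI = false then
    (r2, c.2.1, c.2.2.map fun y => (flipIf (y.1.getD i false) j y.1, y.2))
  else (readRest r2, c.2.1, c.2.2.map fun y =>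
    (flipIf (y.1.getD i false && y.1.getD j false) k y.1, y.2))

/-- Basis states as bit strings. -/
def pathList {n : ℕ} (L : List ((Fin n → Bool) × ℕ)) : List (List Bool × ℕ) :=
  L.map fun y => (List.ofFn y.1, y.2)

@[simp] theorem ofFn_set {n : ℕ} (x : Fin n → Bool) (i : Fin n) (b : Bool) :
    (List.ofFn x).set i b = List.ofFn (Function.update x i b) := by
  refine List.ext_getElem (by simp) fun k h1 h2 => ?_
  simp only [List.getElem_set, List.getElem_ofFn, Function.update_apply]
  simp only [Fin.ext_iff, eq_comm]

@[simp] theorem flipIf_ofFn {n : ℕ} (b : Bool) (t : Fin n) (x : Fin n → Bool) :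
    flipIf b t (List.ofFn x) = List.ofFn (if b then flipBit t x else x) := by
  cases b <;> simp [flipIf, flipBit]

theorem pathStep_encode {n : ℕ} (g : Gate n) (l : List Bool) (h : ℕ)
    (L : List ((Fin n → Bool) × ℕ)) :
    pathStep (g.encode ++ l, h, pathList L)
      = (l, h + g.hadCount, pathList (L.flatMap g.branch)) := by
  cases g with
  | had i =>
    simp [pathStep, Gate.encode, Gate.hadCount, pathList, Gate.branch, List.map_flatMap,
      List.flatMap_map]
  | phase i =>
    simp [pathStep, Gate.encode, Gate.hadCount, pathList, Gate.branch,
      List.map_eq_flatMap, List.flatMap_assoc]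
  | cnot c t hct =>
    simp [pathStep, Gate.encode, Gate.hadCount, pathList, Gate.branch,
      List.map_eq_flatMap, List.flatMap_assoc]
  | toffoli c d t hcd hct hdt =>
    simp [pathStep, Gate.encode, Gate.hadCount, pathList, Gate.branch,
      List.map_eq_flatMap, List.flatMap_assoc]

theorem pathStep_nil (h : ℕ) (L : List (List Bool × ℕ)) : pathStep ([], h, L) = ([], h, L) := by
  simp [pathStep]

theorem pathStep_iterate {n : ℕ} (gs : List (Gate n)) (h : ℕ) (L : List ((Fin n → Bool) × ℕ)) :
    pathStep^[gs.length] (gs.flatMap Gate.encode, h, pathList L)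
      = ([], h + (gs.map Gate.hadCount).sum, pathList (allPaths gs L)) := by
  induction gs generalizing h L with
  | nil => rfl
  | cons g gs ih =>
    rw [List.length_cons, Function.iterate_succ_apply, List.flatMap_cons, pathStep_encode, ih]
    simp [allPaths, add_assoc]

/-- Enumerate the paths through the circuit with the given description. -/
def pathRun (E : List Bool) : PathConfig :=
  pathStep^[E.length] (readRest E, 0, [((List.range (readNat E)).map fun _ => false, 0)])

/-- The number of paths that end in `w` with phase exponent `j` modulo `4`. -/
def phaseCount (L : List (List Bool × ℕ)) (w : List Bool) (j : ℕ) : ℕ :=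
  (L.map fun y => if y.1 = w ∧ y.2 % 4 = j then 1 else 0).sum

/-- The square of the difference. -/
def sqDiff (a b : ℕ) : ℕ := (a - b) * (a - b) + (b - a) * (b - a)

/-- One of the two truncated differences in `sqDiff` vanishes. -/
theorem cast_sqDiff (a b : ℕ) : (sqDiff a b : ℝ) = ((a : ℝ) - b) ^ 2 := by
  rcases le_total a b with h | h
  · simp [sqDiff, Nat.sub_eq_zero_of_le h, Nat.cast_sub h]; ring
  · simp [sqDiff, Nat.sub_eq_zero_of_le h, Nat.cast_sub h]; ring

/-- The numerator of the probability of the outcome `w` of the circuit with description `E`. -/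
def outcomeNum (E w : List Bool) : ℕ :=
  sqDiff (phaseCount (pathRun E).2.2 w 0) (phaseCount (pathRun E).2.2 w 2) +
    sqDiff (phaseCount (pathRun E).2.2 w 1) (phaseCount (pathRun E).2.2 w 3)

/-- Phases depend on the exponent modulo `4`: exponents `0` and `2` give `1` and `-1`, exponents `1`
and `3` give `i` and `-i`. The path sum is thus a Gaussian integer whose parts are differences of
counts. -/
theorem pathSum_eq {n : ℕ} (L : List ((Fin n → Bool) × ℕ)) (x : Fin n → Bool) :
    pathSum L x = ⟨(phaseCount (pathList L) (List.ofFn x) 0 : ℝ)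
      - phaseCount (pathList L) (List.ofFn x) 2, (phaseCount (pathList L) (List.ofFn x) 1 : ℝ)
      - phaseCount (pathList L) (List.ofFn x) 3⟩ := by
  induction L with
  | nil => simp [pathSum, phaseCount, pathList]; rfl
  | cons y L ih =>
    have e : pathSum (y :: L) x = (if y.1 = x then Complex.I ^ y.2 else 0) + pathSum L x := by
      simp [pathSum]
    have e' : ∀ j, phaseCount (pathList (y :: L)) (List.ofFn x) j
        = (if y.1 = x ∧ y.2 % 4 = j then 1 else 0) + phaseCount (pathList L) (List.ofFn x) j := by
      intro j
      simp [phaseCount, pathList]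
    rw [e, ih]
    simp only [e']
    by_cases h : y.1 = x
    · rw [if_pos h, Complex.I_pow_eq_pow_mod]
      have h4 : y.2 % 4 < 4 := Nat.mod_lt _ (by norm_num)
      simp only [h, true_and]
      generalize y.2 % 4 = k at *
      interval_cases k <;> apply Complex.ext <;> simp <;> ring
    · simp [h]

/-- No gate has an empty code, so the length of the description is enough fuel for `pathRun`; the
same bound later makes the number of gates polynomial. -/
theorem length_le_flatMap_encode {n : ℕ} (gs : List (Gate n)) :
    gs.length ≤ (gs.flatMap Gate.encode).length := by
  induction gs with
  | nil => simp
  | cons g gs ih =>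
    have : 1 ≤ g.encode.length := by cases g <;> simp [Gate.encode]
    simp only [List.length_cons, List.flatMap_cons, List.length_append]
    omega

theorem pathRun_encode (C : QCircuit) : pathRun C.encode
    = ([], (C.gates.map Gate.hadCount).sum, pathList (allPaths C.gates [(fun _ => false, 0)])) := by
  have hl : C.gates.length ≤ C.encode.length := by
    have := length_le_flatMap_encode C.gates
    simp only [QCircuit.encode, List.length_append]
    omega
  obtain ⟨d, hd⟩ : ∃ d, C.encode.length = d + C.gates.length :=
    ⟨C.encode.length - C.gates.length, by omega⟩
  have h0 : [((List.range C.qubits).map fun _ => false, 0)]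
      = pathList [((fun _ => false : Fin C.qubits → Bool), 0)] := by
    simp [pathList, List.ofFn_const]
  rw [pathRun, hd, Function.iterate_add_apply]
  simp only [QCircuit.encode, readNat_encodeIndex, readRest_encodeIndex]
  rw [h0, pathStep_iterate, zero_add]
  exact Function.iterate_fixed (pathStep_nil _ _) d

/-- Squaring turns the factor `√2` per Hadamard gate into a factor `2`, so the Born probability is
an integer over an explicit power of two and comparisons with it are decidable exactly. -/
theorem measure_toReal (C : QCircuit) (x : Fin C.qubits → Bool) :
    (C.measure x).toReal
      = outcomeNum C.encode (List.ofFn x) / 2 ^ (pathRun C.encode).2.1 := by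
  have hz : pathSum [((fun _ => false : Fin C.qubits → Bool), 0)] = zeroState C.qubits := by
    funext x
    simp [pathSum, zeroState, eq_comm]
  have h := congrFun (pathSum_allPaths C.gates [((fun _ => false : Fin C.qubits → Bool), 0)]) x
  rw [hz] at h
  change _ = _ * C.finalState x at h
  have h' := congrArg Complex.normSq h
  rw [Complex.normSq_mul, map_pow, Complex.normSq_ofReal, Real.mul_self_sqrt (by norm_num),
    pathSum_eq, Complex.normSq_mk] at h'
  have hm : (C.measure x).toReal = Complex.normSq (C.finalState x) := by
    rw [QCircuit.measure, PMF.ofFintype_apply, ENNReal.toReal_ofReal (Complex.normSq_nonneg _)]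
  rw [hm, outcomeNum, pathRun_encode, eq_div_iff (by positivity), mul_comm, ← h']
  push_cast
  rw [cast_sqDiff, cast_sqDiff]
  ring

/-- Paths end only in strings whose length is the number of qubits. The likelihood test may receive
other strings and must see probability zero for them. -/
theorem outcomeNum_eq_zero (C : QCircuit) (w : List Bool)
    (h : ∀ x : Fin C.qubits → Bool, w ≠ List.ofFn x) : outcomeNum C.encode w = 0 := by
  have : ∀ j, phaseCount (pathRun C.encode).2.2 w j = 0 := by
    intro j
    rw [pathRun_encode]
    simp only [phaseCount, pathList, List.map_map, List.sum_eq_zero_iff, List.mem_map]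
    rintro k ⟨y, -, rfl⟩
    simp [(h y.1).symm]
  simp [outcomeNum, this, sqDiff]

/-! ### Primitive recursiveness of the outcome probabilities -/

section

variable {α : Type*} [Primcodable α]

theorem primrec_toNat {f : α → Bool} (hf : Primrec f) : Primrec fun a => (f a).toNat :=
  (Primrec.dom_bool Bool.toNat).comp hf

theorem primrec_set {f : α → List Bool} {g : α → ℕ} {h : α → Bool} (hf : Primrec f)
    (hg : Primrec g) (hh : Primrec h) : Primrec fun a => (f a).set (g a) (h a) :=
  Primrec.list_set.comp hf (Primrec.pair hg hh)

theorem primrec_getD {f : α → List Bool} {g : α → ℕ} (hf : Primrec f)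
    (hg : Primrec g) : Primrec fun a => (f a).getD (g a) false :=
  (Primrec.list_getD false).comp hf hg

theorem primrec_flipIf {b : α → Bool} {t : α → ℕ} {f : α → List Bool} (hb : Primrec b)
    (ht : Primrec t) (hf : Primrec f) : Primrec fun a => flipIf (b a) (t a) (f a) :=
  Primrec.ite (Primrec.eq.comp hb (Primrec.const true))
    (primrec_set hf ht (Primrec.not.comp (primrec_getD hf ht))) hf

end

theorem primrec_pathStep : Primrec pathStep := by
  have hr : Primrec fun c : PathConfig => c.1.tail.tail :=
    Primrec.list_tail.comp (Primrec.list_tail.comp Primrec.fst)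
  have hi := primrec_readNat.comp hr
  have hr1 := primrec_readRest.comp hr
  have hj := primrec_readNat.comp hr1
  have hr2 := primrec_readRest.comp hr1
  have hk := primrec_readNat.comp hr2
  have hr3 := primrec_readRest.comp hr2
  have hh : Primrec fun c : PathConfig => c.2.1 := Primrec.fst.comp Primrec.snd
  have hL : Primrec fun c : PathConfig => c.2.2 := Primrec.snd.comp Primrec.snd
  have hy1 : Primrec fun z : PathConfig × List Bool × ℕ => z.2.1 := Primrec.fst.comp Primrec.snd
  have hy2 : Primrec fun z : PathConfig × List Bool × ℕ => z.2.2 := Primrec.snd.comp Primrec.snd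
  have hi' := hi.comp (Primrec.fst : Primrec (Prod.fst : PathConfig × List Bool × ℕ → _))
  have hj' := hj.comp (Primrec.fst : Primrec (Prod.fst : PathConfig × List Bool × ℕ → _))
  have hk' := hk.comp (Primrec.fst : Primrec (Prod.fst : PathConfig × List Bool × ℕ → _))
  have hgi := primrec_getD hy1 hi'
  have hgj := primrec_getD hy1 hj'
  have b1 : PrimrecPred fun c : PathConfig => c.1.headI = false :=
    Primrec.eq.comp (Primrec.list_headI.comp Primrec.fst) (Primrec.const false)
  have b2 : PrimrecPred fun c : PathConfig => c.1.tail.headI = false :=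
    Primrec.eq.comp (Primrec.list_headI.comp (Primrec.list_tail.comp Primrec.fst))
      (Primrec.const false)
  refine Primrec.ite (Primrec.eq.comp Primrec.fst (Primrec.const [])) Primrec.id ?_
  refine Primrec.ite b1 (Primrec.ite b2 ?_ ?_) (Primrec.ite b2 ?_ ?_)
  · refine Primrec.pair hr1 (Primrec.pair (Primrec.succ.comp hh) (Primrec.list_flatMap hL ?_))
    exact (Primrec.list_cons.comp
      (Primrec.pair (primrec_set hy1 hi' (Primrec.const false)) hy2)
      (Primrec.list_cons.comp (Primrec.pair (primrec_set hy1 hi' (Primrec.const true))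
        (Primrec.nat_add.comp hy2 (Primrec.nat_mul.comp (Primrec.const 2) (primrec_toNat hgi))))
        (Primrec.const []))).to₂
  · refine Primrec.pair hr1 (Primrec.pair hh (Primrec.list_map hL ?_))
    exact (Primrec.pair hy1 (Primrec.nat_add.comp hy2 (primrec_toNat hgi))).to₂
  · refine Primrec.pair hr2 (Primrec.pair hh (Primrec.list_map hL ?_))
    exact (Primrec.pair (primrec_flipIf hgi hj' hy1) hy2).to₂
  · refine Primrec.pair hr3 (Primrec.pair hh (Primrec.list_map hL ?_))
    exact (Primrec.pair (primrec_flipIf (Primrec.and.comp hgi hgj) hk' hy1) hy2).to₂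

theorem primrec_pathRun : Primrec pathRun := by
  have h0 : Primrec fun E : List Bool =>
      ((readRest E, 0, [((List.range (readNat E)).map fun _ => false, 0)]) : PathConfig) :=
    Primrec.pair primrec_readRest (Primrec.pair (Primrec.const 0) (Primrec.list_cons.comp
      (Primrec.pair (Primrec.list_map (Primrec.list_range.comp primrec_readNat)
        (Primrec₂.const false)) (Primrec.const 0)) (Primrec.const [])))
  exact Primrec.nat_iterate Primrec.list_length h0 (primrec_pathStep.comp Primrec.snd).to₂

theorem primrec_sqDiff {α : Type*} [Primcodable α] {f g : α → ℕ} (hf : Primrec f)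
    (hg : Primrec g) : Primrec fun a => sqDiff (f a) (g a) :=
  Primrec.nat_add.comp
    (Primrec.nat_mul.comp (Primrec.nat_sub.comp hf hg) (Primrec.nat_sub.comp hf hg))
    (Primrec.nat_mul.comp (Primrec.nat_sub.comp hg hf) (Primrec.nat_sub.comp hg hf))

theorem primrec_outcomeNum : Primrec₂ outcomeNum := by
  have hc : ∀ j : ℕ, Primrec fun z : List Bool × List Bool =>
      phaseCount (pathRun z.1).2.2 z.2 j := by
    intro j
    refine primrec_listSum (Primrec.snd.comp (Primrec.snd.comp
      (primrec_pathRun.comp Primrec.fst))) ?_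
    refine (Primrec.ite (PrimrecPred.and (Primrec.eq.comp (Primrec.fst.comp Primrec.snd)
      (Primrec.snd.comp Primrec.fst)) (Primrec.eq.comp (Primrec.nat_mod.comp
        (Primrec.snd.comp Primrec.snd) (Primrec.const 4)) (Primrec.const j)))
      (Primrec.const 1) (Primrec.const 0) : Primrec fun
        z : (List Bool × List Bool) × List Bool × ℕ =>
          if z.2.1 = z.1.2 ∧ z.2.2 % 4 = j then 1 else 0)
  exact (Primrec.nat_add.comp (primrec_sqDiff (hc 0) (hc 2)) (primrec_sqDiff (hc 1) (hc 3))).to₂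

end QAdv


namespace QAdv

/-! ### Probabilities and the statistical distance -/

/-- The probability of an event, as a real number. -/
noncomputable def prob {α : Type*} (p : PMF α) (S : Set α) : ℝ := (p.toOuterMeasure S).toReal

section

variable {α β : Type*}

theorem summable_pmf (p : PMF α) : Summable fun a => (p a).toReal :=
  ENNReal.summable_toReal p.tsum_coe_ne_top

theorem tsum_pmf (p : PMF α) : ∑' a, (p a).toReal = 1 := by
  rw [← ENNReal.tsum_toReal_eq fun a => p.apply_ne_top a, p.tsum_coe, ENNReal.toReal_one]

theorem prob_eq_tsum (p : PMF α) (S : Set α) :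
    prob p S = ∑' a, S.indicator (fun a => (p a).toReal) a := by
  rw [prob, PMF.toOuterMeasure_apply, ENNReal.tsum_toReal_eq]
  · refine tsum_congr fun a => ?_
    by_cases h : a ∈ S <;> simp [h]
  · intro a
    by_cases h : a ∈ S <;> simp [h, p.apply_ne_top]

theorem prob_compl (p : PMF α) (S : Set α) : prob p Sᶜ = 1 - prob p S := by
  rw [eq_sub_iff_add_eq, prob_eq_tsum, prob_eq_tsum, ← Summable.tsum_add
    ((summable_pmf p).indicator _) ((summable_pmf p).indicator _), ← tsum_pmf p]
  exact tsum_congr fun a => congrFun (Set.indicator_compl_add_self S _) a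

theorem prob_map [Fintype α] (p : PMF α) (f : α → β) (S : Set β) [DecidablePred (· ∈ S)] :
    prob (p.map f) S = ∑ a, if f a ∈ S then (p a).toReal else 0 := by
  rw [prob, PMF.toOuterMeasure_map_apply, PMF.toOuterMeasure_apply_fintype,
    ENNReal.toReal_sum]
  · refine Finset.sum_congr rfl fun a _ => ?_
    by_cases h : f a ∈ S <;> simp [h]
  · intro a _
    by_cases h : a ∈ f ⁻¹' S <;> simp [h, p.apply_ne_top]

theorem two_mul_prob_sub (p q : PMF α) (S : Set α) :
    2 * (prob p S - prob q S) = ∑' a, (S.indicator (fun a => (p a).toReal - (q a).toReal) a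
      + Sᶜ.indicator (fun a => (q a).toReal - (p a).toReal) a) := by
  have hp := summable_pmf p
  have hq := summable_pmf q
  rw [Summable.tsum_add ((hp.sub hq).indicator _) ((hq.sub hp).indicator _)]
  have e : ∀ (p q : PMF α) (S : Set α),
      ∑' a, S.indicator (fun a => (p a).toReal - (q a).toReal) a = prob p S - prob q S := by
    intro p q S
    rw [prob_eq_tsum, prob_eq_tsum, ← Summable.tsum_sub ((summable_pmf p).indicator _)
      ((summable_pmf q).indicator _)]
    exact tsum_congr fun a => congrFun (Set.indicator_sub S _ _) a
  rw [e, e, prob_compl, prob_compl]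
  ring

theorem prob_sub_le_statDist (p q : PMF α) (S : Set α) :
    prob p S - prob q S ≤ statDist p q := by
  have h := two_mul_prob_sub p q S
  have hp := summable_pmf p
  have hq := summable_pmf q
  have : ∑' a, (S.indicator (fun a => (p a).toReal - (q a).toReal) a
      + Sᶜ.indicator (fun a => (q a).toReal - (p a).toReal) a)
      ≤ ∑' a, |(p a).toReal - (q a).toReal| := by
    refine Summable.tsum_le_tsum (fun a => ?_)
      (((hp.sub hq).indicator _).add ((hq.sub hp).indicator _)) (hp.sub hq).abs
    by_cases ha : a ∈ S
    · simp [ha, le_abs_self]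
    · simp only [ha, not_false_eq_true, Set.indicator_of_notMem, Set.mem_compl_iff,
        Set.indicator_of_mem, zero_add]
      rw [abs_sub_comm]
      exact le_abs_self _
  rw [statDist]
  linarith

theorem exists_statDist_eq (p q : PMF α) : ∃ S, statDist p q = prob p S - prob q S := by
  -- On this set and its complement, every term of `two_mul_prob_sub` equals the absolute value.
  refine ⟨{a | (q a).toReal ≤ (p a).toReal}, ?_⟩
  have h := two_mul_prob_sub p q {a | (q a).toReal ≤ (p a).toReal}
  have : ∑' a, |(p a).toReal - (q a).toReal| = ∑' a, ({a | (q a).toReal ≤ (p a).toReal}.indicator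
      (fun a => (p a).toReal - (q a).toReal) a
      + {a | (q a).toReal ≤ (p a).toReal}ᶜ.indicator
        (fun a => (q a).toReal - (p a).toReal) a) := by
    refine tsum_congr fun a => ?_
    by_cases ha : (q a).toReal ≤ (p a).toReal
    · simp [ha, abs_of_nonneg]
    · simp only [Set.mem_ofPred_eq, ha, not_false_eq_true, Set.indicator_of_notMem,
        Set.mem_compl_iff, Set.indicator_of_mem, zero_add]
      rw [abs_of_neg (by linarith)]
      ring
  rw [statDist, this, ← h]
  ring

theorem statDist_comm (p q : PMF α) : statDist p q = statDist q p := by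
  simp only [statDist, abs_sub_comm]

end

/-! ### From proofs of quantumness to quantum advantage samplers -/

/-- A randomized verifier is a test with values `r τ` in `[0, 1]`. Replacing it by the indicator of
the set where `D` has at least the mass of `E` can only increase the difference of expectations, and
for sets the bound is `prob_sub_le_statDist`. -/
theorem acceptProb_le_add_statDist (V : UnboundedVerifier) (lam : ℕ) (D E : PMF (List Bool)) :
    V.acceptProb lam D - V.acceptProb lam E ≤ statDist D E := by
  have key : ∀ D : PMF (List Bool), V.acceptProb lam D
      = ∑' τ, (D τ).toReal * (V.run lam τ true).toReal := by
    intro D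
    rw [UnboundedVerifier.acceptProb, PMF.bind_apply, ENNReal.tsum_toReal_eq]
    · simp
    · exact fun a => ENNReal.mul_ne_top (D.apply_ne_top a) (PMF.apply_ne_top _ _)
  set r : List Bool → ℝ := fun τ => (V.run lam τ true).toReal with hr
  have r0 : ∀ τ, 0 ≤ r τ := fun τ => ENNReal.toReal_nonneg
  have r1 : ∀ τ, r τ ≤ 1 := fun τ =>
    ENNReal.toReal_le_of_le_ofReal zero_le_one (by simpa using PMF.coe_le_one _ _)
  have hs : ∀ D : PMF (List Bool), Summable fun τ => (D τ).toReal * r τ := fun D =>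
    Summable.of_nonneg_of_le (fun τ => mul_nonneg ENNReal.toReal_nonneg (r0 τ))
      (fun τ => mul_le_of_le_one_right ENNReal.toReal_nonneg (r1 τ)) (summable_pmf D)
  obtain ⟨S, hS⟩ : ∃ S : Set (List Bool), ∀ τ, ((D τ).toReal - (E τ).toReal) * r τ
      ≤ S.indicator (fun τ => (D τ).toReal) τ - S.indicator (fun τ => (E τ).toReal) τ := by
    refine ⟨{a | (E a).toReal ≤ (D a).toReal}, fun τ => ?_⟩
    by_cases h : (E τ).toReal ≤ (D τ).toReal
    · simp only [Set.mem_ofPred_eq, h, Set.indicator_of_mem]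
      exact mul_le_of_le_one_right (by linarith) (r1 τ)
    · simp only [Set.mem_ofPred_eq, h, not_false_eq_true, Set.indicator_of_notMem, sub_zero]
      exact mul_nonpos_of_nonpos_of_nonneg (by linarith) (r0 τ)
  refine le_trans ?_ (prob_sub_le_statDist D E S)
  rw [key, key, prob_eq_tsum, prob_eq_tsum, ← Summable.tsum_sub (hs D) (hs E),
    ← Summable.tsum_sub ((summable_pmf D).indicator _) ((summable_pmf E).indicator _)]
  refine Summable.tsum_le_tsum (fun τ => ?_) ((hs D).sub (hs E))
    (((summable_pmf D).indicator _).sub ((summable_pmf E).indicator _))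
  have := hS τ
  simp only [hr] at this ⊢
  linarith

theorem IsNonInteractiveIVPoQOn.isQASOn {S : Set ℕ} {P : QPTSampler} {V : UnboundedVerifier}
    (h : IsNonInteractiveIVPoQOn S P V) : IsQASOn S P := by
  obtain ⟨c, s, q, hq, hcs, ⟨l0, h0⟩, hs⟩ := h
  -- The factor `2` produces the strict inequality demanded of a sampler from the weak inequality `c
  -- - s ≥ 1 / q`.
  refine ⟨2 * q, fun n => by have := hq n; simp; linarith, fun B => ?_⟩
  obtain ⟨l1, h1⟩ := hs B
  refine ⟨max l0 l1, fun lam hlam hle => ?_⟩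
  have e0 := h0 lam ((le_max_left _ _).trans hle)
  have e1 := h1 lam hlam ((le_max_right _ _).trans hle)
  have e2 := hcs lam
  have e3 := acceptProb_le_add_statDist V lam (P.dist lam) (B.dist lam)
  have hp := hq lam
  have : 1 / (2 * q : Polynomial ℝ).eval (lam : ℝ) < 1 / q.eval (lam : ℝ) := by
    apply one_div_lt_one_div_of_lt hp
    simp
    linarith
  linarith

/-! ### The likelihood ratio verifier -/

/-- The `i`-th clocked classical algorithm: the code of a program and the coefficients of the
polynomials that bound its random bits and its running time. -/
def machine (i : ℕ) : ℕ × List ℕ × List ℕ :=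
  ((Encodable.decode i : Option (ℕ × List ℕ × List ℕ))).getD (0, [], [])

theorem machine_encode (x : ℕ × List ℕ × List ℕ) : machine (Encodable.encode x) = x := by
  rw [machine, Encodable.encodek, Option.getD_some]

/-- The number of random bits of the `i`-th algorithm. -/
def machineCoins (i lam : ℕ) : ℕ := evalCoeffs (machine i).2.1 lam

/-- The output of the `i`-th algorithm. -/
def machineOut (i lam : ℕ) (r : List Bool) : List Bool :=
  interp (machine i).1 (evalCoeffs (machine i).2.2 lam) [unary lam, r]

/-- The number of seeds for which the `i`-th algorithm outputs `τ`. -/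
def seedCount (i lam : ℕ) (τ : List Bool) : ℕ :=
  ((bitStrings (machineCoins i lam)).map fun r => if machineOut i lam r = τ then 1 else 0).sum

/-- An exponent for a common denominator of the first `lam + 1` algorithms. -/
def mixExp (lam : ℕ) : ℕ := ((List.range (lam + 1)).map fun i => machineCoins i lam).sum

/-- The numerator of the sum of the probabilities of `τ` under the first `lam + 1` algorithms. -/
def mixNum (lam : ℕ) (τ : List Bool) : ℕ :=
  ((List.range (lam + 1)).map fun i =>
    seedCount i lam τ * 2 ^ (mixExp lam - machineCoins i lam)).sum

/-- Accept `τ` if the mixture of the first classical algorithms does not give it more than `R`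
times its probability under the circuit with description `E`. -/
def ratioTest (E : List Bool) (lam R : ℕ) (τ : List Bool) : Bool :=
  decide (mixNum lam τ * 2 ^ (pathRun E).2.1 ≤ (lam + 1) * R * outcomeNum E τ * 2 ^ mixExp lam)

/-! ### Computability of the likelihood test -/

theorem primrec_machine : Primrec machine :=
  Primrec.option_getD.comp Primrec.decode (Primrec.const _)

theorem primrec_machineCoins : Primrec₂ machineCoins :=
  (primrec_evalCoeffs (Primrec.fst.comp (Primrec.snd.comp (primrec_machine.comp Primrec.fst)))
    Primrec.snd : Primrec fun z : ℕ × ℕ => evalCoeffs (machine z.1).2.1 z.2)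

theorem primrec_machineOut : Primrec fun z : (ℕ × ℕ) × List Bool =>
    machineOut z.1.1 z.1.2 z.2 := by
  have hm : Primrec fun z : (ℕ × ℕ) × List Bool => machine z.1.1 :=
    primrec_machine.comp (Primrec.fst.comp Primrec.fst)
  have hl : Primrec fun z : (ℕ × ℕ) × List Bool => z.1.2 := Primrec.snd.comp Primrec.fst
  exact primrec_interp (Primrec.fst.comp hm)
    (primrec_evalCoeffs (Primrec.snd.comp (Primrec.snd.comp hm)) hl)
    (Primrec.list_cons.comp (primrec_unary.comp hl)
      (Primrec.list_cons.comp Primrec.snd (Primrec.const [])))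

theorem primrec_seedCount : Primrec fun z : (ℕ × ℕ) × List Bool =>
    seedCount z.1.1 z.1.2 z.2 := by
  have hz : Primrec fun z : ((ℕ × ℕ) × List Bool) × List Bool => (z.1.1, z.2) :=
    Primrec.pair (Primrec.fst.comp Primrec.fst) Primrec.snd
  have ho : Primrec fun z : ((ℕ × ℕ) × List Bool) × List Bool =>
      machineOut z.1.1.1 z.1.1.2 z.2 :=
    (primrec_machineOut.comp hz :)
  have hc : Primrec fun z : (ℕ × ℕ) × List Bool => bitStrings (machineCoins z.1.1 z.1.2) :=
    primrec_bitStrings.comp (primrec_machineCoins.comp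
      (Primrec.fst.comp Primrec.fst) (Primrec.snd.comp Primrec.fst))
  have hi : Primrec₂ fun (z : (ℕ × ℕ) × List Bool) (r : List Bool) =>
      if machineOut z.1.1 z.1.2 r = z.2 then 1 else 0 :=
    Primrec.ite (Primrec.eq.comp ho (Primrec.snd.comp Primrec.fst))
      (Primrec.const 1) (Primrec.const 0)
  exact primrec_listSum hc hi

theorem primrec_mixExp : Primrec mixExp :=
  primrec_listSum (f := fun lam => List.range (lam + 1)) (g := fun lam i => machineCoins i lam)
    (Primrec.list_range.comp Primrec.succ)
    (primrec_machineCoins.comp Primrec.snd Primrec.fst :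
      Primrec fun z : ℕ × ℕ => machineCoins z.2 z.1)

theorem primrec_mixNum : Primrec₂ mixNum := by
  have hl : Primrec fun z : (ℕ × List Bool) × ℕ => z.1.1 := Primrec.fst.comp Primrec.fst
  have hp : Primrec fun z : (ℕ × List Bool) × ℕ =>
      2 ^ (mixExp z.1.1 - machineCoins z.2 z.1.1) :=
    primrec_pow (Primrec.const 2) (Primrec.nat_sub.comp (primrec_mixExp.comp hl)
      (primrec_machineCoins.comp Primrec.snd hl))
  have hs : Primrec fun z : (ℕ × List Bool) × ℕ => seedCount z.2 z.1.1 z.1.2 :=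
    (primrec_seedCount.comp (Primrec.pair (Primrec.pair Primrec.snd hl)
      (Primrec.snd.comp Primrec.fst)) :)
  have hm : Primrec₂ fun (z : ℕ × List Bool) (i : ℕ) =>
      seedCount i z.1 z.2 * 2 ^ (mixExp z.1 - machineCoins i z.1) := Primrec.nat_mul.comp hs hp
  have hr : Primrec fun z : ℕ × List Bool => List.range (z.1 + 1) :=
    Primrec.list_range.comp (Primrec.succ.comp Primrec.fst)
  exact primrec_listSum hr hm

theorem primrec_ratioTest {E : ℕ → List Bool} {R : ℕ → ℕ} (hE : Primrec E) (hR : Primrec R) :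
    Primrec fun z : ℕ × List Bool => ratioTest (E z.1) z.1 (R z.1) z.2 := by
  have hE' : Primrec fun z : ℕ × List Bool => E z.1 := hE.comp Primrec.fst
  have h : PrimrecPred fun z : ℕ × List Bool => mixNum z.1 z.2 * 2 ^ (pathRun (E z.1)).2.1
      ≤ (z.1 + 1) * R z.1 * outcomeNum (E z.1) z.2 * 2 ^ mixExp z.1 := by
    refine Primrec.nat_le.comp (Primrec.nat_mul.comp primrec_mixNum
      (primrec_pow (Primrec.const 2) (Primrec.fst.comp (Primrec.snd.comp
        (primrec_pathRun.comp hE'))))) (Primrec.nat_mul.comp (Primrec.nat_mul.comp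
      (Primrec.nat_mul.comp (Primrec.succ.comp Primrec.fst) (hR.comp Primrec.fst))
      (primrec_outcomeNum.comp hE' Primrec.snd))
      (primrec_pow (Primrec.const 2) (primrec_mixExp.comp Primrec.fst)))
  obtain ⟨_, h⟩ := h
  exact h.of_eq fun z => by simp [ratioTest]

theorem primrec_encode_circuit (P : QPTSampler) :
    Primrec fun lam => (P.circuit lam).encode := by
  refine (primrec_interp (Primrec.const P.genProg.code) (Primrec.nat_mul.comp (Primrec.const 2)
    (primrec_eval P.genTime)) (Primrec.list_cons.comp primrec_unary (Primrec.const []))).of_eq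
    fun lam => (P.gen_computes lam).interp_eq le_rfl

/-- The deterministic verifier that compares the likelihoods. -/
def ratioVerifier (P : QPTSampler) (R : Polynomial ℕ) : UnboundedVerifier where
  coins _ _ := 0
  verdict lam τ _ := ratioTest (P.circuit lam).encode lam (R.eval lam) τ
  coins_computable := Computable.const 0
  verdict_computable := ((primrec_ratioTest (primrec_encode_circuit P) (primrec_eval R)).comp
    (Primrec.pair Primrec.fst (Primrec.fst.comp Primrec.snd))).to_comp

theorem acceptProb_ratioVerifier (P : QPTSampler) (R : Polynomial ℕ) (lam : ℕ)
    (D : PMF (List Bool)) : (ratioVerifier P R).acceptProb lam D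
      = prob D {τ | ratioTest (P.circuit lam).encode lam (R.eval lam) τ = true} := by
  rw [UnboundedVerifier.acceptProb, prob, PMF.bind_apply, PMF.toOuterMeasure_apply]
  congr 2
  funext τ
  have : (ratioVerifier P R).run lam τ
      = PMF.pure (ratioTest (P.circuit lam).encode lam (R.eval lam) τ) :=
    PMF.map_const _ _
  rw [this, PMF.pure_apply]
  by_cases h : ratioTest (P.circuit lam).encode lam (R.eval lam) τ = true
  · simp [h]
  · simp [h]

/-! ### Counting seeds, domination by the mixture, and completeness -/

theorem sum_map_bitStrings (n : ℕ) (f : List Bool → ℕ) :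
    ((bitStrings n).map f).sum = ∑ x : Fin n → Bool, f (List.ofFn x) := by
  induction n generalizing f with
  | zero => simp [bitStrings]
  | succ n ih =>
    have e : ((bitStrings (n + 1)).map f).sum
        = ((bitStrings n).map fun l => f (false :: l) + f (true :: l)).sum := by
      rw [bitStrings]
      induction bitStrings n with
      | nil => rfl
      | cons a l ih =>
        simp only [List.flatMap_cons, List.map_append, List.sum_append, List.map_cons,
          List.sum_cons, ih, List.map_nil, List.sum_nil]
        ring
    rw [e, ih, ← (Fin.consEquiv fun _ => Bool).sum_comp, Fintype.sum_prod_type, Fintype.sum_bool,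
      add_comm, ← Finset.sum_add_distrib]
    simp [Fin.consEquiv, List.ofFn_succ]

theorem seedCount_eq (i lam : ℕ) (τ : List Bool) : seedCount i lam τ
    = ∑ x : Fin (machineCoins i lam) → Bool,
        if machineOut i lam (List.ofFn x) = τ then 1 else 0 := by
  rw [seedCount, sum_map_bitStrings]

/-- Each seed yields exactly one string. This applies to every index: even a meaningless code, or a
program cut off by its clock, has some output. -/
theorem sum_seedCount_le (i lam : ℕ) (F : Finset (List Bool)) :
    ∑ τ ∈ F, seedCount i lam τ ≤ 2 ^ machineCoins i lam := by
  simp only [seedCount_eq]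
  rw [Finset.sum_comm]
  calc _ ≤ ∑ x : Fin (machineCoins i lam) → Bool, 1 := by
        refine Finset.sum_le_sum fun x _ => ?_
        rw [Finset.sum_ite_eq]
        split_ifs <;> simp
    _ = _ := by simp

theorem machineCoins_le_mixExp {i lam : ℕ} (h : i ≤ lam) : machineCoins i lam ≤ mixExp lam :=
  List.single_le_sum (by simp) _ (List.mem_map.2 ⟨i, by simp; omega, rfl⟩)

theorem mixNum_eq (lam : ℕ) (τ : List Bool) : mixNum lam τ
    = ∑ i ∈ Finset.range (lam + 1), seedCount i lam τ * 2 ^ (mixExp lam - machineCoins i lam) :=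
  rfl

theorem sum_mixNum_le (lam : ℕ) (F : Finset (List Bool)) :
    ∑ τ ∈ F, mixNum lam τ ≤ (lam + 1) * 2 ^ mixExp lam := by
  simp only [mixNum_eq]
  rw [Finset.sum_comm]
  calc _ ≤ ∑ i ∈ Finset.range (lam + 1), 2 ^ mixExp lam := by
        refine Finset.sum_le_sum fun i hi => ?_
        rw [← Finset.sum_mul]
        have hi' : i ≤ lam := by simpa [Nat.lt_succ_iff] using hi
        refine (Nat.mul_le_mul_right _ (sum_seedCount_le i lam F)).trans ?_
        rw [← pow_add, Nat.add_sub_cancel' (machineCoins_le_mixExp hi')]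
    _ = _ := by simp

theorem coinFlips_apply (m : ℕ) (f : List Bool → List Bool) (S : Set (List Bool))
    [DecidablePred (· ∈ S)] : prob ((coinFlips m).map f) S
      = (∑ x : Fin m → Bool, if f (List.ofFn x) ∈ S then (1 : ℝ) else 0) / 2 ^ m := by
  rw [coinFlips, PMF.map_comp, prob_map, Finset.sum_div]
  refine Finset.sum_congr rfl fun x _ => ?_
  simp only [Function.comp_apply, PMF.uniformOfFintype_apply]
  split_ifs <;> simp

theorem prob_singleton {α : Type*} (p : PMF α) (a : α) : prob p {a} = (p a).toReal := by
  rw [prob, PMF.toOuterMeasure_apply_singleton]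

theorem PPTSampler.exists_seedCount (B : PPTSampler) : ∃ i, ∀ lam τ,
    (B.dist lam τ).toReal = seedCount i lam τ / 2 ^ machineCoins i lam := by
  obtain ⟨c, hc⟩ := exists_evalCoeffs B.coins
  -- The interpreter may need twice the running time.
  obtain ⟨t, ht⟩ := exists_evalCoeffs (2 * B.time)
  refine ⟨Encodable.encode (B.prog.code, c, t), fun lam τ => ?_⟩
  rw [← prob_singleton, PPTSampler.dist, coinFlips_apply, seedCount_eq]
  have hm : machineCoins (Encodable.encode (B.prog.code, c, t)) lam = B.coins.eval lam := by
    rw [machineCoins, machine_encode, hc]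
  rw [hm]
  push_cast
  refine congrArg (· / _) (Finset.sum_congr rfl fun x _ => ?_)
  have : machineOut (Encodable.encode (B.prog.code, c, t)) lam (List.ofFn x)
      = B.out lam (List.ofFn x) := by
    rw [machineOut, machine_encode]
    refine (B.computes lam _ (by simp)).interp_eq ?_
    rw [ht]
    simp
  simp only [Set.mem_singleton_iff, this]

/-- `B` occurs among the enumerated machines at some index `i`, and the sum over indices up to `lam`
contains its term as soon as `lam ≥ i`. -/
theorem PPTSampler.exists_le_mixNum (B : PPTSampler) : ∃ i, ∀ lam ≥ i, ∀ τ,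
    (B.dist lam τ).toReal ≤ mixNum lam τ / 2 ^ mixExp lam := by
  obtain ⟨i, hi⟩ := B.exists_seedCount
  refine ⟨i, fun lam hle τ => ?_⟩
  have h1 : seedCount i lam τ * 2 ^ (mixExp lam - machineCoins i lam) ≤ mixNum lam τ :=
    Finset.single_le_sum (f := fun i => seedCount i lam τ * 2 ^ (mixExp lam - machineCoins i lam))
      (fun _ _ => Nat.zero_le _) (Finset.mem_range.2 (Nat.lt_succ_of_le hle))
  rw [hi, div_le_div_iff₀ (by positivity) (by positivity)]
  have h2 := Nat.mul_le_mul_right (2 ^ machineCoins i lam) h1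
  rw [mul_assoc, ← pow_add, Nat.sub_add_cancel (machineCoins_le_mixExp hle)] at h2
  exact_mod_cast h2

theorem ratioTest_iff (C : QCircuit) (lam R : ℕ) (x : Fin C.qubits → Bool) :
    ratioTest C.encode lam R (List.ofFn x) = true ↔
      (mixNum lam (List.ofFn x) : ℝ) / 2 ^ mixExp lam
        ≤ (lam + 1) * R * (C.measure x).toReal := by
  rw [ratioTest, decide_eq_true_iff, measure_toReal, ← mul_div_assoc,
    div_le_div_iff₀ (by positivity) (by positivity)]
  exact_mod_cast Iff.rfl

/-- A string accepted by the verifier that is not an outcome of the circuit is not an output of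
the classical algorithms. -/
theorem mixNum_eq_zero_of_ratioTest (C : QCircuit) (lam R : ℕ) (w : List Bool)
    (h : ∀ x : Fin C.qubits → Bool, w ≠ List.ofFn x) (hw : ratioTest C.encode lam R w = true) :
    mixNum lam w = 0 := by
  rw [ratioTest, decide_eq_true_iff, outcomeNum_eq_zero C w h] at hw
  simpa using hw

theorem sum_measure (C : QCircuit) : ∑ x, (C.measure x).toReal = 1 := by
  have := tsum_pmf C.measure
  rwa [tsum_fintype] at this

/-- Markov's inequality for the likelihood ratio: on a rejected string the circuit probability is
less than the sum of classical probabilities divided by `(lam + 1) * R`, and those sums add up to at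
most `lam + 1`. The trivial post-processing makes the sent string the measured one. -/
theorem ratioVerifier_complete (P : QPTSampler) (hP : ∀ lam w, P.post lam w = w)
    (R : Polynomial ℕ) (lam : ℕ) (hR : 0 < R.eval lam) :
    (ratioVerifier P R).acceptProb lam (P.dist lam) ≥ 1 - 1 / ((R.eval lam : ℕ) : ℝ) := by
  classical
  rw [acceptProb_ratioVerifier]
  suffices h : prob (P.dist lam)
      {τ | ratioTest (P.circuit lam).encode lam (R.eval lam) τ = true}ᶜ ≤ 1 / ((R.eval lam : ℕ) : ℝ) by
    rw [prob_compl] at h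
    linarith
  have hR' : (0 : ℝ) < R.eval lam := by exact_mod_cast hR
  rw [QPTSampler.dist, prob_map]
  simp only [hP]
  calc _ ≤ ∑ x : Fin (P.circuit lam).qubits → Bool,
        (mixNum lam (List.ofFn x) : ℝ) / ((lam + 1) * 2 ^ mixExp lam * ((R.eval lam : ℕ) : ℝ)) := by
        refine Finset.sum_le_sum fun x _ => ?_
        split_ifs with h
        · simp only [Set.mem_compl_iff, Set.mem_ofPred_eq, ratioTest_iff, not_le] at h
          rw [le_div_iff₀ (by positivity)]
          rw [lt_div_iff₀ (by positivity)] at h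
          linarith
        · positivity
    _ ≤ ((lam + 1) * 2 ^ mixExp lam : ℝ) / ((lam + 1) * 2 ^ mixExp lam * ((R.eval lam : ℕ) : ℝ)) := by
        rw [← Finset.sum_div]
        refine div_le_div_of_nonneg_right ?_ (by positivity)
        have h := sum_mixNum_le lam ((Finset.univ : Finset (Fin (P.circuit lam).qubits → Bool)).image
          List.ofFn)
        rw [Finset.sum_image (fun x _ y _ h => List.ofFn_injective h)] at h
        exact_mod_cast h
    _ = _ := by
        rw [div_mul_cancel_left₀ (by positivity), one_div]

end QAdv


namespace QAdv

/-! ### Independent copies of a circuit -/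

section

variable {m n : ℕ}

/-- The gate `g` acting on the `j`-th of `m` blocks of `n` qubits. -/
def Gate.block (j : Fin m) : Gate n → Gate (m * n)
  | .had i => .had (finProdFinEquiv (j, i))
  | .phase i => .phase (finProdFinEquiv (j, i))
  | .cnot c t h => .cnot (finProdFinEquiv (j, c)) (finProdFinEquiv (j, t)) (by simpa using h)
  | .toffoli c d t hcd hct hdt => .toffoli (finProdFinEquiv (j, c)) (finProdFinEquiv (j, d))
      (finProdFinEquiv (j, t)) (by simpa using hcd) (by simpa using hct) (by simpa using hdt)

/-- The `j`-th block of a basis state. -/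
def blockOf (x : Fin (m * n) → Bool) (j : Fin m) : Fin n → Bool :=
  fun i => x (finProdFinEquiv (j, i))

/-- The product of states of the blocks. -/
noncomputable def prodState (ψ : Fin m → QState n) : QState (m * n) :=
  fun x => ∏ j, ψ j (blockOf x j)

theorem blockOf_update_self (x : Fin (m * n) → Bool) (j : Fin m) (i : Fin n) (b : Bool) :
    blockOf (Function.update x (finProdFinEquiv (j, i)) b) j
      = Function.update (blockOf x j) i b := by
  funext k
  simp [blockOf, Function.update_apply]

theorem blockOf_update_of_ne (x : Fin (m * n) → Bool) {j k : Fin m} (h : k ≠ j) (i : Fin n)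
    (b : Bool) : blockOf (Function.update x (finProdFinEquiv (j, i)) b) k = blockOf x k := by
  funext l
  simp [blockOf, h]

theorem prodState_update (ψ : Fin m → QState n) (j : Fin m) (φ : QState n)
    (x : Fin (m * n) → Bool) : prodState (Function.update ψ j φ) x
      = φ (blockOf x j) * ∏ k ∈ Finset.univ.erase j, ψ k (blockOf x k) := by
  rw [prodState, ← Finset.mul_prod_erase _ _ (Finset.mem_univ j), Function.update_self]
  congr 1
  refine Finset.prod_congr rfl fun k hk => ?_
  rw [Function.update_of_ne (Finset.ne_of_mem_erase hk)]

theorem prodState_eq (ψ : Fin m → QState n) (j : Fin m) (x : Fin (m * n) → Bool) :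
    prodState ψ x = ψ j (blockOf x j) * ∏ k ∈ Finset.univ.erase j, ψ k (blockOf x k) := by
  rw [← prodState_update, Function.update_eq_self]

theorem prod_blockOf_update (ψ : Fin m → QState n) (j : Fin m) (x : Fin (m * n) → Bool)
    (i : Fin n) (b : Bool) :
    ∏ k ∈ Finset.univ.erase j, ψ k (blockOf (Function.update x (finProdFinEquiv (j, i)) b) k)
      = ∏ k ∈ Finset.univ.erase j, ψ k (blockOf x k) :=
  Finset.prod_congr rfl fun k hk => by rw [blockOf_update_of_ne x (Finset.ne_of_mem_erase hk)]

/-- A gate of block `j` reads and changes bits of that block only, so the factors of the other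
blocks come out unchanged. -/
theorem Gate.block_apply (j : Fin m) (g : Gate n) (ψ : Fin m → QState n) :
    (g.block j).apply (prodState ψ) = prodState (Function.update ψ j (g.apply (ψ j))) := by
  funext x
  rw [prodState_update]
  have hb : ∀ i : Fin n, x (finProdFinEquiv (j, i)) = blockOf x j i := fun i => rfl
  cases g with
  | had i =>
    simp only [Gate.block, Gate.apply, prodState_eq ψ j, prod_blockOf_update,
      blockOf_update_self, hb]
    ring
  | phase i =>
    simp only [Gate.block, Gate.apply, prodState_eq ψ j, hb]
    split_ifs <;> ring
  | cnot c t h =>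
    simp only [Gate.block, Gate.apply, hb]
    split_ifs
    · simp only [prodState_eq ψ j, flipBit, prod_blockOf_update, blockOf_update_self, hb]
    · exact prodState_eq ψ j x
  | toffoli c d t hcd hct hdt =>
    simp only [Gate.block, Gate.apply, hb]
    split_ifs
    · simp only [prodState_eq ψ j, flipBit, prod_blockOf_update, blockOf_update_self, hb]
    · exact prodState_eq ψ j x

theorem foldl_block (j : Fin m) (gs : List (Gate n)) (ψ : Fin m → QState n) :
    (gs.map (Gate.block j)).foldl (fun ψ g => g.apply ψ) (prodState ψ)
      = prodState (Function.update ψ j (gs.foldl (fun ψ g => g.apply ψ) (ψ j))) := by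
  induction gs generalizing ψ with
  | nil => simp
  | cons g gs ih =>
    rw [List.map_cons, List.foldl_cons, Gate.block_apply, ih]
    simp

theorem foldl_blocks (gs : List (Gate n)) (l : List (Fin m)) (hl : l.Nodup)
    (ψ : Fin m → QState n) :
    (l.flatMap fun j => gs.map (Gate.block j)).foldl (fun ψ g => g.apply ψ) (prodState ψ)
      = prodState fun j => if j ∈ l then gs.foldl (fun ψ g => g.apply ψ) (ψ j) else ψ j := by
  induction l generalizing ψ with
  | nil => simp
  | cons j l ih =>
    rw [List.nodup_cons] at hl
    rw [List.flatMap_cons, List.foldl_append, foldl_block, ih hl.2]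
    congr 1
    funext k
    by_cases hk : k = j
    · subst hk
      simp [hl.1]
    · simp [hk]

theorem prodState_zeroState : prodState (fun _ : Fin m => zeroState n) = zeroState (m * n) := by
  funext x
  simp only [prodState, zeroState]
  by_cases h : x = fun _ => false
  · subst h
    have : ∀ j : Fin m, blockOf (fun _ : Fin (m * n) => false) j = fun _ => false := fun j => rfl
    simp [this]
  · rw [if_neg h]
    obtain ⟨k, hk⟩ : ∃ k, x k ≠ false := Function.ne_iff.1 h
    refine Finset.prod_eq_zero (Finset.mem_univ (finProdFinEquiv.symm k).1) (if_neg fun h' => ?_)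
    have := congrFun h' (finProdFinEquiv.symm k).2
    simp only [blockOf, Prod.mk.eta, Equiv.apply_symm_apply] at this
    exact hk this

/-- `m` independent copies of a circuit. -/
def QCircuit.copies (m : ℕ) (C : QCircuit) : QCircuit :=
  ⟨m * C.qubits, (List.finRange m).flatMap fun j => C.gates.map (Gate.block j)⟩

theorem QCircuit.finalState_copies (m : ℕ) (C : QCircuit) :
    (C.copies m).finalState = prodState (fun _ : Fin m => C.finalState) := by
  have h := foldl_blocks C.gates (List.finRange m) (List.nodup_finRange m) fun _ => zeroState _
  rw [prodState_zeroState] at h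
  refine Eq.trans h ?_
  simp only [List.mem_finRange, if_true]
  rfl

/-- The final state is a product state, and the squared modulus is multiplicative: the blocks are
measured independently. -/
theorem QCircuit.measure_copies (m : ℕ) (C : QCircuit) (x : Fin (m * C.qubits) → Bool) :
    ((C.copies m).measure x).toReal = ∏ j, (C.measure (blockOf x j)).toReal := by
  have hm : ∀ (C : QCircuit) (x : Fin C.qubits → Bool),
      (C.measure x).toReal = Complex.normSq (C.finalState x) := fun C x => by
    rw [QCircuit.measure, PMF.ofFintype_apply, ENNReal.toReal_ofReal (Complex.normSq_nonneg _)]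
  rw [hm (C.copies m) x, QCircuit.finalState_copies]
  simp only [hm, prodState, map_prod]

theorem take_drop_ofFn (x : Fin (m * n) → Bool) (j : Fin m) :
    ((List.ofFn x).drop (j * n)).take n = List.ofFn (blockOf x j) := by
  have hj : (j : ℕ) * n + n ≤ m * n := by
    have := Nat.mul_le_mul_right n j.isLt
    rwa [Nat.succ_mul] at this
  refine List.ext_getElem (by simp; omega) fun k h1 h2 => ?_
  simp only [List.getElem_take, List.getElem_drop, List.getElem_ofFn, blockOf]
  congr 1
  ext
  simp [finProdFinEquiv, mul_comm, add_comm]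

/-- Splitting basis states into blocks. -/
def blocksEquiv : (Fin (m * n) → Bool) ≃ (Fin m → Fin n → Bool) :=
  (Equiv.arrowCongr finProdFinEquiv.symm (Equiv.refl Bool)).trans (Equiv.curry _ _ _)

theorem blocksEquiv_apply (x : Fin (m * n) → Bool) : blocksEquiv x = blockOf x := by
  funext j i
  rfl

end

end QAdv


namespace QAdv

/-! ### Averages of independent variables under dominated weights -/

theorem exp_le_one_add_add_sq {u : ℝ} (h : |u| ≤ 1) : Real.exp u ≤ 1 + u + u ^ 2 := by
  have := Real.abs_exp_sub_one_sub_id_le h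
  have := (abs_le.1 this).2
  linarith

/-- Exponential moment bound for a centred variable with values in `[-1, 1]`: in `exp v ≤ 1 + v + v
^ 2` the linear term averages to zero and the quadratic one is at most `u ^ 2`. -/
theorem sum_mul_exp_le {β : Type*} [Fintype β] (p f : β → ℝ) (hp : ∀ b, 0 ≤ p b)
    (hp1 : ∑ b, p b = 1) (hf0 : ∀ b, 0 ≤ f b) (hf1 : ∀ b, f b ≤ 1) {u : ℝ} (hu0 : 0 ≤ u)
    (hu : u ≤ 1) :
    ∑ b, p b * Real.exp (u * (f b - ∑ b, p b * f b)) ≤ Real.exp (u ^ 2) := by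
  set μ := ∑ b, p b * f b with hμ
  have hμ0 : 0 ≤ μ := Finset.sum_nonneg fun b _ => mul_nonneg (hp b) (hf0 b)
  have hμ1 : μ ≤ 1 := by
    rw [← hp1]
    exact Finset.sum_le_sum fun b _ => mul_le_of_le_one_right (hp b) (hf1 b)
  have key : ∀ b, p b * Real.exp (u * (f b - μ)) ≤ p b * (1 + u ^ 2) + u * (p b * f b)
      - u * μ * p b := by
    intro b
    have habs : |f b - μ| ≤ 1 := abs_le.2 ⟨by linarith [hf0 b], by linarith [hf1 b]⟩
    have h1 : |u * (f b - μ)| ≤ 1 := by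
      rw [abs_mul, abs_of_nonneg hu0]
      exact mul_le_one₀ hu (abs_nonneg _) habs
    have h2 : (f b - μ) ^ 2 ≤ 1 := (sq_le_one_iff_abs_le_one _).2 habs
    have h3 := exp_le_one_add_add_sq h1
    have h4 : Real.exp (u * (f b - μ)) ≤ 1 + u * (f b - μ) + u ^ 2 := by
      nlinarith [sq_nonneg u]
    have := mul_le_mul_of_nonneg_left h4 (hp b)
    linarith
  calc _ ≤ ∑ b, (p b * (1 + u ^ 2) + u * (p b * f b) - u * μ * p b) :=
        Finset.sum_le_sum fun b _ => key b
    _ = 1 + u ^ 2 := by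
        rw [Finset.sum_sub_distrib, Finset.sum_add_distrib, ← Finset.sum_mul, ← Finset.mul_sum,
          ← Finset.mul_sum, hp1, ← hμ]
        ring
    _ ≤ _ := by
        have := Real.add_one_le_exp (u ^ 2)
        linarith

/-- If the weights `D` are dominated by `C` times a product measure, then the `D`-average of a
weighted mean of the coordinates of a test is not much larger than the mean of the test. -/
theorem sum_weighted_mean_le {ι β : Type*} [Fintype ι] [Fintype β] [DecidableEq ι]
    (p f : β → ℝ) (hp : ∀ b, 0 ≤ p b) (hp1 : ∑ b, p b = 1) (hf0 : ∀ b, 0 ≤ f b)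
    (hf1 : ∀ b, f b ≤ 1) (q : ι → ℝ) (hq : ∀ j, 0 ≤ q j) (hq1 : ∑ j, q j = 1) {t δ C : ℝ}
    (ht : 1 ≤ t) (hqδ : ∀ j, q j ≤ δ) (hδ : t ^ 2 * δ ≤ 1) (hC : 1 ≤ C)
    (D : (ι → β) → ℝ) (hD0 : ∀ x, 0 ≤ D x) (hD1 : ∑ x, D x ≤ 1)
    (hD : ∀ x, D x ≤ C * ∏ j, p (x j)) :
    ∑ x, D x * (∑ j, q j * f (x j)) ≤ ∑ b, p b * f b + (2 + C) / t := by
  set μ := ∑ b, p b * f b with hμ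
  have hμ0 : 0 ≤ μ := Finset.sum_nonneg fun b _ => mul_nonneg (hp b) (hf0 b)
  have ht0 : 0 < t := by linarith
  -- Chosen so that `C * exp 1 * exp (-a) = 1`, where `C * exp 1` bounds the exponential moment of
  -- `S` under `D`.
  set a := Real.log C + 1 with ha
  have hlog : 0 ≤ Real.log C := Real.log_nonneg hC
  set S : (ι → β) → ℝ := fun x => ∑ j, t * q j * (f (x j) - μ) with hS
  have hSe : ∀ x, t * (∑ j, q j * f (x j)) = S x + t * μ := by
    intro x
    simp only [hS, mul_sub, Finset.sum_sub_distrib, ← Finset.sum_mul, ← Finset.mul_sum, hq1,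
      mul_assoc]
    ring
  -- Domination replaces `D` by the product measure, under which the exponential of the sum
  -- factorizes. The exponents add up to `∑ (t * q j) ^ 2 ≤ t ^ 2 * δ ≤ 1`.
  have hexp : ∑ x, D x * Real.exp (S x) ≤ C * Real.exp 1 := by
    calc _ ≤ ∑ x : ι → β, C * ((∏ j, p (x j)) * Real.exp (S x)) := by
          refine Finset.sum_le_sum fun x _ => ?_
          rw [← mul_assoc]
          exact mul_le_mul_of_nonneg_right (hD x) (Real.exp_nonneg _)
      _ = C * ∏ j, ∑ b, p b * Real.exp (t * q j * (f b - μ)) := by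
          rw [← Finset.mul_sum, Finset.prod_univ_sum, Fintype.piFinset_univ]
          congr 1
          refine Finset.sum_congr rfl fun x _ => ?_
          rw [hS, Real.exp_sum, Finset.prod_mul_distrib]
      _ ≤ C * ∏ j, Real.exp ((t * q j) ^ 2) := by
          refine mul_le_mul_of_nonneg_left ?_ (by linarith)
          refine Finset.prod_le_prod (fun j _ => Finset.sum_nonneg fun b _ =>
            mul_nonneg (hp b) (Real.exp_nonneg _)) fun j _ => ?_
          have h1 : t * q j ≤ 1 := by
            have : t * q j ≤ t * δ := mul_le_mul_of_nonneg_left (hqδ j) ht0.le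
            have h0 : 0 ≤ t * δ := (mul_nonneg ht0.le (hq j)).trans this
            nlinarith
          exact sum_mul_exp_le p f hp hp1 hf0 hf1 (mul_nonneg ht0.le (hq j)) h1
      _ ≤ C * Real.exp 1 := by
          refine mul_le_mul_of_nonneg_left ?_ (by linarith)
          rw [← Real.exp_sum]
          refine Real.exp_le_exp.2 ?_
          calc _ ≤ ∑ j, t ^ 2 * δ * q j := by
                refine Finset.sum_le_sum fun j _ => ?_
                have := mul_le_mul_of_nonneg_right (hqδ j) (hq j)
                nlinarith [sq_nonneg t]
            _ = t ^ 2 * δ := by rw [← Finset.mul_sum, hq1, mul_one]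
            _ ≤ 1 := hδ
  have hmain : ∑ x, D x * S x ≤ 2 + C := by
    -- The tangent inequality `y + 1 ≤ exp y` at `y = S x - a`. Averaged over `D`, it bounds the
    -- mean of `S` by `1 + log C`; domination thus costs only a logarithm, afterwards relaxed to `2
    -- + C`.
    have hpt : ∀ x, D x * S x ≤ D x * Real.exp (S x) * Real.exp (-a) + D x * Real.log C := by
      intro x
      have h := Real.add_one_le_exp (S x - a)
      rw [sub_eq_add_neg, Real.exp_add] at h
      have := mul_le_mul_of_nonneg_left h (hD0 x)
      have e : D x * (S x + -a + 1) = D x * S x - D x * Real.log C := by rw [ha]; ring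
      rw [e] at this
      linarith
    have hea : C * Real.exp 1 * Real.exp (-a) = 1 := by
      rw [mul_assoc, ← Real.exp_add, ha]
      have : (1 : ℝ) + -(Real.log C + 1) = -Real.log C := by ring
      rw [this, Real.exp_neg, Real.exp_log (by linarith)]
      exact mul_inv_cancel₀ (by linarith)
    calc _ ≤ ∑ x, (D x * Real.exp (S x) * Real.exp (-a) + D x * Real.log C) :=
          Finset.sum_le_sum fun x _ => hpt x
      _ = (∑ x, D x * Real.exp (S x)) * Real.exp (-a) + (∑ x, D x) * Real.log C := by
          rw [Finset.sum_add_distrib, Finset.sum_mul, Finset.sum_mul]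
      _ ≤ C * Real.exp 1 * Real.exp (-a) + 1 * Real.log C :=
          add_le_add (mul_le_mul_of_nonneg_right hexp (Real.exp_nonneg _))
            (mul_le_mul_of_nonneg_right hD1 hlog)
      _ ≤ 2 + C := by
          rw [hea]
          have := Real.log_le_sub_one_of_pos (show 0 < C by linarith)
          linarith
  have hfin : t * ∑ x, D x * (∑ j, q j * f (x j)) ≤ t * μ + (2 + C) := by
    have e : t * ∑ x, D x * (∑ j, q j * f (x j)) = ∑ x, D x * S x + (∑ x, D x) * (t * μ) := by
      rw [Finset.mul_sum, Finset.sum_mul, ← Finset.sum_add_distrib]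
      refine Finset.sum_congr rfl fun x _ => ?_
      rw [← mul_add, ← hSe]
      ring
    rw [e]
    have : (∑ x, D x) * (t * μ) ≤ 1 * (t * μ) :=
      mul_le_mul_of_nonneg_right hD1 (mul_nonneg ht0.le hμ0)
    linarith
  have h : μ + (2 + C) / t = (t * μ + (2 + C)) / t := by field_simp
  rw [h, le_div_iff₀ ht0, mul_comm]
  exact hfin

/-! ### Flatness of the binomial distribution -/

/-- The recursion for central binomial coefficients reduces the induction step to `(2 * k + 1) * (2
* k + 3) ≤ (2 * k + 2) ^ 2`. -/
theorem centralBinom_sq_le (k : ℕ) : k.centralBinom ^ 2 * (2 * k + 1) ≤ 16 ^ k := by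
  induction k with
  | zero => simp
  | succ k ih =>
    have h := Nat.succ_mul_centralBinom_succ k
    have h2 : (k + 1) ^ 2 * ((k + 1).centralBinom ^ 2 * (2 * (k + 1) + 1))
        = (4 * (2 * k + 1) * (2 * k + 3)) * (k.centralBinom ^ 2 * (2 * k + 1)) := by
      calc _ = ((k + 1) * (k + 1).centralBinom) ^ 2 * (2 * (k + 1) + 1) := by ring
        _ = _ := by rw [h]; ring
    have h3 : 4 * (2 * k + 1) * (2 * k + 3) ≤ 16 * (k + 1) ^ 2 := by ring_nf; omega
    refine Nat.le_of_mul_le_mul_left ?_ (show 0 < (k + 1) ^ 2 by positivity)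
    rw [h2]
    calc _ ≤ 16 * (k + 1) ^ 2 * 16 ^ k := Nat.mul_le_mul h3 ih
      _ = _ := by ring

/-- The number of bit strings of length `n` with `j` ones. -/
theorem card_count_true (n j : ℕ) :
    (∑ r : Fin n → Bool, if (List.ofFn r).count true = j then 1 else 0) = n.choose j := by
  induction n generalizing j with
  | zero => cases j <;> simp
  | succ n ih =>
    rw [← (Fin.consEquiv fun _ => Bool).sum_comp, Fintype.sum_prod_type, Fintype.sum_bool]
    cases j with
    | zero =>
      have := ih 0
      simpa [Fin.consEquiv, List.ofFn_succ] using this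
    | succ j =>
      have h1 := ih j
      have h2 := ih (j + 1)
      rw [Nat.choose_succ_succ, ← h1, ← h2]
      simp [Fin.consEquiv, List.ofFn_succ]

/-- This supplies the bound `δ = 1 / t ^ 2` on the weights in `sum_weighted_mean_le`, when the block
number is the number of ones among `2 * k` fair coins. -/
theorem choose_div_le {k j t : ℕ} (h : t ^ 4 ≤ 2 * k + 1) (ht : 0 < t) :
    ((2 * k).choose j : ℝ) / 2 ^ (2 * k) ≤ 1 / t ^ 2 := by
  have h1 : (2 * k).choose j ≤ k.centralBinom := Nat.choose_le_centralBinom j k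
  have h2 := centralBinom_sq_le k
  have h3 : ((2 * k).choose j * t ^ 2) ^ 2 ≤ (2 ^ (2 * k)) ^ 2 := by
    calc _ = ((2 * k).choose j) ^ 2 * t ^ 4 := by ring
      _ ≤ k.centralBinom ^ 2 * (2 * k + 1) := Nat.mul_le_mul (Nat.pow_le_pow_left h1 2) h
      _ ≤ 16 ^ k := h2
      _ = _ := by rw [← pow_mul, show (16 : ℕ) = 2 ^ 4 by norm_num, ← pow_mul]; ring_nf
  have h4 := (Nat.pow_le_pow_iff_left two_ne_zero).1 h3
  have ht' : (0 : ℝ) < t := by exact_mod_cast ht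
  rw [div_le_div_iff₀ (by positivity) (by positivity), one_mul]
  exact_mod_cast h4

end QAdv


namespace QAdv

/-! ### Running programs within time bounds -/

/-- Program `p` leads from `s` to `s'` within `T` steps. -/
def Runs (p : Prog) (s s' : Store) (T : ℕ) : Prop := ∃ t ≤ T, Exec p s s' t

theorem Runs.mono {p : Prog} {s s' : Store} {T T' : ℕ} (h : Runs p s s' T) (hT : T ≤ T') :
    Runs p s s' T' :=
  let ⟨t, ht, he⟩ := h
  ⟨t, ht.trans hT, he⟩

theorem Runs.congr {p : Prog} {s s' s'' : Store} {T T' : ℕ} (h : Runs p s s' T)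
    (hs : s' = s'') (hT : T ≤ T') : Runs p s s'' T' :=
  hs ▸ h.mono hT

theorem Runs.seq {p q : Prog} {s s' s'' : Store} {T T' : ℕ} (h : Runs p s s' T)
    (h' : Runs q s' s'' T') : Runs (.seq p q) s s'' (T + T') :=
  let ⟨_, ht, he⟩ := h
  let ⟨_, ht', he'⟩ := h'
  ⟨_, Nat.add_le_add ht ht', .seq he he'⟩

theorem Runs.ifTop_pos {i : ℕ} {b : Bool} {p q : Prog} {s s' : Store} {T : ℕ}
    (hs : (s i).head? = some b) (h : Runs p s s' T) : Runs (.ifTop i b p q) s s' (T + 1) :=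
  let ⟨_, ht, he⟩ := h
  ⟨_, Nat.add_le_add_right ht 1, .ifTop_pos hs he⟩

theorem Runs.ifTop_neg {i : ℕ} {b : Bool} {p q : Prog} {s s' : Store} {T : ℕ}
    (hs : (s i).head? ≠ some b) (h : Runs q s s' T) : Runs (.ifTop i b p q) s s' (T + 1) :=
  let ⟨_, ht, he⟩ := h
  ⟨_, Nat.add_le_add_right ht 1, .ifTop_neg hs he⟩

theorem Runs.loop_done {i : ℕ} {p : Prog} {s : Store} (hs : s i = []) :
    Runs (.loop i p) s s 1 := ⟨1, le_rfl, .loop_done hs⟩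

theorem Runs.loop_step {i : ℕ} {p : Prog} {s s' s'' : Store} {T T' : ℕ} (hs : s i ≠ [])
    (h : Runs p s s' T) (h' : Runs (.loop i p) s' s'' T') :
    Runs (.loop i p) s s'' (T + T' + 1) :=
  let ⟨_, ht, he⟩ := h
  let ⟨_, ht', he'⟩ := h'
  ⟨_, Nat.add_le_add_right (Nat.add_le_add ht ht') 1, .loop_step hs he he'⟩

theorem Runs.loop {i : ℕ} {p : Prog} {T : ℕ} (σ : ℕ → Store) (n : ℕ)
    (hne : ∀ k < n, σ k i ≠ []) (hn : σ n i = [])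
    (h : ∀ k < n, Runs p (σ k) (σ (k + 1)) T) :
    Runs (.loop i p) (σ 0) (σ n) (n * (T + 1) + 1) := by
  induction n generalizing σ with
  | zero => simpa using Runs.loop_done hn
  | succ n ih =>
    have h1 := ih (fun k => σ (k + 1)) (fun k hk => hne _ (by omega)) hn
      (fun k hk => h _ (by omega))
    exact (Runs.loop_step (hne 0 (by omega)) (h 0 (by omega)) h1).mono (by ring_nf; omega)

/-- Replace entry `j` of a list of stacks, extending the list by empty stacks if necessary. -/
def setL : List (List Bool) → ℕ → List Bool → List (List Bool)
  | [], 0, v => [v]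
  | [], j + 1, v => [] :: setL [] j v
  | _ :: L, 0, v => v :: L
  | x :: L, j + 1, v => x :: setL L j v

theorem inputStore_cons_succ (x : List Bool) (L : List (List Bool)) (i : ℕ) :
    inputStore (x :: L) (i + 1) = inputStore L i := rfl

theorem update_inputStore (L : List (List Bool)) (j : ℕ) (v : List Bool) :
    Function.update (inputStore L) j v = inputStore (setL L j v) := by
  funext i
  induction L generalizing i j with
  | nil =>
    induction j generalizing i with
    | zero => cases i <;> simp [setL, inputStore]
    | succ j ih =>
      cases i with
      | zero => simp [setL, inputStore]
      | succ i =>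
        have := ih i
        rw [setL, inputStore_cons_succ, ← this]
        simp [Function.update_apply, inputStore]
  | cons x L ih =>
    cases j with
    | zero => cases i <;> simp [setL, inputStore]
    | succ j =>
      cases i with
      | zero => simp [setL, inputStore]
      | succ i =>
        rw [setL, inputStore_cons_succ, ← ih]
        simp [Function.update_apply, inputStore]

theorem inputStore_pad (L : List (List Bool)) (n : ℕ) :
    inputStore (L ++ List.replicate n []) = inputStore L := by
  funext i
  simp only [inputStore, List.getD_eq_getElem?_getD]
  rcases lt_or_ge i L.length with h | h
  · rw [List.getElem?_append_left h]
  · rw [List.getElem?_append_right h, List.getElem?_eq_none h, List.getElem?_replicate]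
    split_ifs <;> rfl

theorem Runs.skip (s : Store) : Runs .skip s s 1 := ⟨1, le_rfl, .skip s⟩

theorem Runs.push (L : List (List Bool)) (j : ℕ) (b : Bool) :
    Runs (.push j b) (inputStore L) (inputStore (setL L j (b :: L.getD j []))) 1 :=
  ⟨1, le_rfl, update_inputStore L j _ ▸ .push j b _⟩

theorem Runs.pop (L : List (List Bool)) (j : ℕ) :
    Runs (.pop j) (inputStore L) (inputStore (setL L j (L.getD j []).tail)) 1 :=
  ⟨1, le_rfl, update_inputStore L j _ ▸ .pop j _⟩

/-! ### Elementary subroutines -/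

/-- Move stack `a` onto stack `b`, which reverses the order. -/
def moveProg (a b : ℕ) : Prog :=
  .loop a (.seq (.ifTop a true (.push b true) (.push b false)) (.pop a))

theorem exec_moveStep {a b : ℕ} (hab : a ≠ b) (s : Store) (x : Bool) (l : List Bool)
    (hs : s a = x :: l) :
    Runs (.seq (.ifTop a true (.push b true) (.push b false)) (.pop a)) s
      (Function.update (Function.update s b (x :: s b)) a l) 3 := by
  have h1 : Runs (.ifTop a true (.push b true) (.push b false)) s
      (Function.update s b (x :: s b)) (1 + 1) := by
    cases x
    · exact Runs.ifTop_neg (by simp [hs]) ⟨1, le_rfl, .push b false s⟩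
    · exact Runs.ifTop_pos (by simp [hs]) ⟨1, le_rfl, .push b true s⟩
  have h2 := Exec.pop a (Function.update s b (x :: s b))
  rw [Function.update_of_ne hab, hs] at h2
  exact h1.seq ⟨1, le_rfl, h2⟩

theorem runs_moveProg' {a b : ℕ} (hab : a ≠ b) (l : List Bool) : ∀ s : Store, s a = l →
    Runs (moveProg a b) s (Function.update (Function.update s b (l.reverse ++ s b)) a [])
      (4 * l.length + 1) := by
  induction l with
  | nil =>
    intro s hs
    refine (Runs.loop_done hs).congr ?_ (by simp)
    funext i
    simp only [Function.update_apply]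
    split_ifs <;> simp_all
  | cons x l ih =>
    intro s hs
    have h1 := exec_moveStep hab s x l hs
    have h2 := ih _ (Function.update_self a l (Function.update s b (x :: s b)))
    refine (Runs.loop_step (by simp [hs]) h1 h2).congr ?_ (by simp; omega)
    funext i
    simp only [Function.update_apply]
    split_ifs <;> simp_all

theorem runs_moveProg {a b : ℕ} (hab : a ≠ b) (L : List (List Bool)) :
    Runs (moveProg a b) (inputStore L)
      (inputStore (setL (setL L b ((L.getD a []).reverse ++ L.getD b [])) a []))
      (4 * (L.getD a []).length + 1) := by
  have := runs_moveProg' hab _ (inputStore L) rfl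
  rwa [update_inputStore, update_inputStore] at this

/-- Move stack `c` onto both stacks `a` and `b`. -/
def dupProg (c a b : ℕ) : Prog :=
  .loop c (.seq (.ifTop c true (.seq (.push a true) (.push b true))
    (.seq (.push a false) (.push b false))) (.pop c))

theorem runs_dupProg' {c a b : ℕ} (hca : c ≠ a) (hcb : c ≠ b) (hab : a ≠ b) (l : List Bool) :
    ∀ s : Store, s c = l → Runs (dupProg c a b) s
      (Function.update (Function.update (Function.update s a (l.reverse ++ s a)) b
        (l.reverse ++ s b)) c []) (5 * l.length + 1) := by
  induction l with
  | nil =>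
    intro s hs
    refine (Runs.loop_done hs).congr ?_ (by simp)
    funext i
    simp only [Function.update_apply]
    split_ifs <;> simp_all
  | cons x l ih =>
    intro s hs
    have hp : ∀ y : Bool, Runs (.seq (.push a y) (.push b y)) s
        (Function.update (Function.update s a (y :: s a)) b (y :: s b)) (1 + 1) := by
      intro y
      have h := Exec.push b y (Function.update s a (y :: s a))
      rw [Function.update_of_ne hab.symm] at h
      exact Runs.seq ⟨1, le_rfl, .push a y s⟩ ⟨1, le_rfl, h⟩
    have h1 : Runs (.ifTop c true (.seq (.push a true) (.push b true))
        (.seq (.push a false) (.push b false))) s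
        (Function.update (Function.update s a (x :: s a)) b (x :: s b)) (2 + 1) := by
      cases x
      · exact Runs.ifTop_neg (by simp [hs]) (hp false)
      · exact Runs.ifTop_pos (by simp [hs]) (hp true)
    have h2 := Exec.pop c (Function.update (Function.update s a (x :: s a)) b (x :: s b))
    rw [Function.update_of_ne hcb, Function.update_of_ne hca, hs] at h2
    have h3 := ih _ (Function.update_self c l
      (Function.update (Function.update s a (x :: s a)) b (x :: s b)))
    refine (Runs.loop_step (by simp [hs]) (h1.seq ⟨1, le_rfl, h2⟩) h3).congr ?_ (by simp; omega)
    funext i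
    simp only [Function.update_apply]
    split_ifs <;> simp_all

/-- Copy stack `a` onto stack `b`, using the empty stack `c`. -/
def copyProg (a b c : ℕ) : Prog := .seq (moveProg a c) (dupProg c a b)

theorem runs_copyProg {a b c : ℕ} (hab : a ≠ b) (hac : a ≠ c) (hbc : b ≠ c)
    (L : List (List Bool)) (hc : L.getD c [] = []) :
    Runs (copyProg a b c) (inputStore L) (inputStore (setL L b (L.getD a [] ++ L.getD b [])))
      (9 * (L.getD a []).length + 2) := by
  have h1 := runs_moveProg' hac _ (inputStore L) rfl
  have h2 := runs_dupProg' hac.symm hbc.symm hab _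
    (Function.update (Function.update (inputStore L) c
      ((inputStore L a).reverse ++ inputStore L c)) a []) rfl
  refine (h1.seq h2).congr ?_ (by
    have : inputStore L c = [] := hc
    rw [Function.update_of_ne hac.symm, Function.update_self, this]
    simp only [List.append_nil, List.length_reverse]
    change 4 * (L.getD a []).length + 1 + (5 * (L.getD a []).length + 1) ≤ _
    omega)
  rw [← update_inputStore]
  have hc' : inputStore L c = [] := hc
  funext i
  simp only [Function.update_apply]
  change _ = if i = b then inputStore L a ++ inputStore L b else inputStore L i
  split_ifs <;> simp_all

/-- Empty stack `a`. -/
def clearProg (a : ℕ) : Prog := .loop a (.pop a)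

theorem runs_clearProg' (a : ℕ) (l : List Bool) : ∀ s : Store, s a = l →
    Runs (clearProg a) s (Function.update s a []) (2 * l.length + 1) := by
  induction l with
  | nil =>
    intro s hs
    refine (Runs.loop_done hs).congr ?_ (by simp)
    rw [← hs, Function.update_eq_self]
  | cons x l ih =>
    intro s hs
    have h1 := Exec.pop a s
    rw [hs] at h1
    have h2 := ih _ (Function.update_self a l s)
    rw [Function.update_idem] at h2
    exact (Runs.loop_step (by simp [hs]) ⟨1, le_rfl, h1⟩ h2).mono (by simp; omega)

theorem runs_clearProg (a : ℕ) (L : List (List Bool)) :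
    Runs (clearProg a) (inputStore L) (inputStore (setL L a []))
      (2 * (L.getD a []).length + 1) := by
  have := runs_clearProg' a _ (inputStore L) rfl
  rwa [update_inputStore] at this

/-- Read a number in unary from stack `a` and add it to the unary number on stack `b`, using the
empty stack `c`. -/
def readProg (a b c : ℕ) : Prog :=
  .seq (.push c true)
    (.loop c (.ifTop a true (.seq (.pop a) (.push b true)) (.seq (.pop a) (.pop c))))

/-- A loop tests only for emptiness, so stack `c` serves as a flag: it holds one bit until the
terminating `false` of the code is read, which pops it. -/
theorem runs_readLoop {a b c : ℕ} (hab : a ≠ b) (hac : a ≠ c) (hbc : b ≠ c) (k : ℕ)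
    (r : List Bool) : ∀ s : Store, s a = encodeIndex k ++ r → s c = [true] →
    Runs (.loop c (.ifTop a true (.seq (.pop a) (.push b true)) (.seq (.pop a) (.pop c)))) s
      (Function.update (Function.update (Function.update s b (unary k ++ s b)) a r) c [])
      (4 * k + 5) := by
  induction k with
  | zero =>
    intro s hs hc
    have h1 := Exec.pop a s
    have h2 := Exec.pop c (Function.update s a (s a).tail)
    rw [Function.update_of_ne hac.symm, hc, hs] at h2
    rw [hs] at h1
    have h3 : Runs (.ifTop a true (.seq (.pop a) (.push b true)) (.seq (.pop a) (.pop c))) s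
        _ (2 + 1) := Runs.ifTop_neg (by simp [hs, encodeIndex])
      (Runs.seq ⟨1, le_rfl, h1⟩ ⟨1, le_rfl, h2⟩)
    refine (Runs.loop_step (by simp [hc]) h3 (Runs.loop_done (by simp))).congr ?_ (by omega)
    funext i
    simp only [Function.update_apply]
    split_ifs <;> simp_all [encodeIndex, unary]
  | succ k ih =>
    intro s hs hc
    have h1 := Exec.pop a s
    have h2 := Exec.push b true (Function.update s a (s a).tail)
    rw [Function.update_of_ne hab.symm, hs] at h2
    rw [hs] at h1
    have h3 : Runs (.ifTop a true (.seq (.pop a) (.push b true)) (.seq (.pop a) (.pop c))) s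
        _ (2 + 1) := Runs.ifTop_pos (by simp [hs, encodeIndex, List.replicate_succ])
      (Runs.seq ⟨1, le_rfl, h1⟩ ⟨1, le_rfl, h2⟩)
    have h4 := ih (Function.update (Function.update s a (encodeIndex (k + 1) ++ r).tail) b
      (true :: s b)) (by
      rw [Function.update_of_ne hab, Function.update_self]
      simp [encodeIndex, List.replicate_succ]) (by
      rw [Function.update_of_ne hbc.symm, Function.update_of_ne hac.symm, hc])
    refine (Runs.loop_step (by simp [hc]) h3 h4).congr ?_ (by omega)
    funext i
    have e : unary (k + 1) = unary k ++ [true] := by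
      simp [unary, List.replicate_succ']
    simp only [Function.update_apply]
    split_ifs <;> simp_all

theorem runs_readProg {a b c : ℕ} (hab : a ≠ b) (hac : a ≠ c) (hbc : b ≠ c)
    (L : List (List Bool)) (k : ℕ) (r : List Bool) (ha : L.getD a [] = encodeIndex k ++ r)
    (hc : L.getD c [] = []) :
    Runs (readProg a b c) (inputStore L)
      (inputStore (setL (setL L b (unary k ++ L.getD b [])) a r)) (4 * k + 6) := by
  have h1 : Runs (.push c true) (inputStore L)
    (Function.update (inputStore L) c (true :: inputStore L c)) 1 := ⟨1, le_rfl, .push c true _⟩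
  have hc' : inputStore L c = [] := hc
  have ha' : inputStore L a = encodeIndex k ++ r := ha
  have h2 := runs_readLoop hab hac hbc k r
    (Function.update (inputStore L) c (true :: inputStore L c))
    (by rw [Function.update_of_ne hac, ha']) (by simp [hc'])
  refine (h1.seq h2).congr ?_ (by omega)
  rw [← update_inputStore, ← update_inputStore]
  change _ = Function.update (Function.update (inputStore L) b (unary k ++ inputStore L b)) a r
  funext i
  simp only [Function.update_apply]
  split_ifs <;> simp_all

/-! ### Renaming of stacks -/

/-- Add `k` to all stack numbers. -/
def Prog.shift (k : ℕ) : Prog → Prog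
  | .skip => .skip
  | .push i b => .push (k + i) b
  | .pop i => .pop (k + i)
  | .seq p q => .seq (p.shift k) (q.shift k)
  | .ifTop i b p q => .ifTop (k + i) b (p.shift k) (q.shift k)
  | .loop i p => .loop (k + i) (p.shift k)

/-- The stacks of `u` followed by those of `s`. -/
def joinStore (k : ℕ) (u s : Store) : Store := fun i => if i < k then u i else s (i - k)

theorem joinStore_add (k : ℕ) (u s : Store) (i : ℕ) : joinStore k u s (k + i) = s i := by
  simp [joinStore]

theorem joinStore_update (k : ℕ) (u s : Store) (i : ℕ) (v : List Bool) :
    joinStore k u (Function.update s i v) = Function.update (joinStore k u s) (k + i) v := by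
  funext j
  simp only [joinStore, Function.update_apply]
  by_cases h1 : j < k
  · have : j ≠ k + i := by omega
    simp [h1, this]
  · by_cases h2 : j = k + i
    · simp [h2]
    · have : j - k ≠ i := by omega
      simp [h1, h2, this]

/-- A shifted program leaves the first `k` stacks alone, so it can be called as a subroutine on
fresh stacks while other data are kept below. -/
theorem Exec.shift {p : Prog} {s s' : Store} {t : ℕ} (h : Exec p s s' t) (k : ℕ) (u : Store) :
    Exec (p.shift k) (joinStore k u s) (joinStore k u s') t := by
  induction h with
  | skip s => exact .skip _
  | push i b s =>
    rw [joinStore_update]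
    have := Exec.push (k + i) b (joinStore k u s)
    rwa [joinStore_add] at this
  | pop i s =>
    rw [joinStore_update]
    have := Exec.pop (k + i) (joinStore k u s)
    rwa [joinStore_add] at this
  | seq _ _ ih1 ih2 => exact .seq ih1 ih2
  | ifTop_pos hs _ ih => exact .ifTop_pos (by rwa [joinStore_add]) ih
  | ifTop_neg hs _ ih => exact .ifTop_neg (by rwa [joinStore_add]) ih
  | loop_done hs => exact .loop_done (by rwa [joinStore_add])
  | loop_step hs _ _ ih1 ih2 => exact .loop_step (by rwa [joinStore_add]) ih1 ih2

theorem joinStore_inputStore (L A : List (List Bool)) :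
    joinStore L.length (inputStore L) (inputStore A) = inputStore (L ++ A) := by
  funext i
  simp only [joinStore, inputStore, List.getD_eq_getElem?_getD]
  split_ifs with h
  · rw [List.getElem?_append_left h]
  · rw [List.getElem?_append_right (not_lt.1 h)]

theorem Runs.shift {p : Prog} {A B : List (List Bool)} {T : ℕ}
    (h : Runs p (inputStore A) (inputStore B) T) (L : List (List Bool)) :
    Runs (p.shift L.length) (inputStore (L ++ A)) (inputStore (L ++ B)) T := by
  obtain ⟨t, ht, he⟩ := h
  have := he.shift L.length (inputStore L)
  rw [joinStore_inputStore, joinStore_inputStore] at this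
  exact ⟨t, ht, this⟩

/-! ### Cleaning up after a program -/

/-- A strict bound for the numbers of the stacks that a program mentions. -/
def Prog.bound : Prog → ℕ
  | .skip => 0
  | .push i _ => i + 1
  | .pop i => i + 1
  | .seq p q => max p.bound q.bound
  | .ifTop _ _ p q => max p.bound q.bound
  | .loop _ p => p.bound

/-- Only pushing and popping change a stack, so `Prog.bound` may ignore stacks that are merely
tested. -/
theorem Exec.eq_of_bound_le {p : Prog} {s s' : Store} {t : ℕ} (h : Exec p s s' t) {i : ℕ}
    (hi : p.bound ≤ i) : s' i = s i := by
  induction h with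
  | skip s => rfl
  | push j b s => exact Function.update_of_ne (by simp only [Prog.bound] at hi; omega) _ _
  | pop j s => exact Function.update_of_ne (by simp only [Prog.bound] at hi; omega) _ _
  | seq _ _ ih1 ih2 =>
    simp only [Prog.bound] at hi
    rw [ih2 (by omega), ih1 (by omega)]
  | ifTop_pos _ _ ih => exact ih (by simp only [Prog.bound] at hi; omega)
  | ifTop_neg _ _ ih => exact ih (by simp only [Prog.bound] at hi; omega)
  | loop_done _ => rfl
  | loop_step _ _ _ ih1 ih2 => rw [ih2 hi, ih1 hi]

/-- A step pushes at most one bit. Hence what a polynomial-time program leaves behind can be erased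
in polynomial time, and its output has polynomial length. -/
theorem Exec.length_le {p : Prog} {s s' : Store} {t : ℕ} (h : Exec p s s' t) (i : ℕ) :
    (s' i).length ≤ (s i).length + t := by
  induction h with
  | skip s => omega
  | push j b s =>
    by_cases hi : i = j
    · subst hi; simp
    · simp [hi]
  | pop j s =>
    by_cases hi : i = j
    · subst hi; simp; omega
    · simp [hi]
  | seq _ _ ih1 ih2 => omega
  | ifTop_pos _ _ ih => omega
  | ifTop_neg _ _ ih => omega
  | loop_done _ => omega
  | loop_step _ _ _ ih1 ih2 => omega

/-- Empty the stacks `1, ..., n`. -/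
def clearUpTo : ℕ → Prog
  | 0 => .skip
  | n + 1 => .seq (clearUpTo n) (clearProg (n + 1))

theorem runs_clearUpTo (n T : ℕ) (s : Store) (hs : ∀ i, (s i).length ≤ T) :
    Runs (clearUpTo n) s (fun i => if 1 ≤ i ∧ i ≤ n then [] else s i)
      (n * (2 * T + 1) + 1) := by
  induction n with
  | zero =>
    have : (fun i => if 1 ≤ i ∧ i ≤ 0 then [] else s i) = s := by
      funext i
      rw [if_neg (by omega)]
    exact (Runs.skip s).congr this.symm (by simp)
  | succ n ih =>
    have h := runs_clearProg' (n + 1) _ (fun i => if 1 ≤ i ∧ i ≤ n then [] else s i) rfl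
    refine (ih.seq h).congr ?_ ?_
    rotate_left
    · have := hs (n + 1)
      simp only [show ¬ (1 ≤ n + 1 ∧ n + 1 ≤ n) by omega, if_false]
      rw [Nat.add_mul n 1]
      omega
    · funext i
      simp only [Function.update_apply]
      split_ifs <;> first | rfl | omega

/-- Run `p` and empty all stacks but the output. -/
def Prog.clean (p : Prog) (n : ℕ) : Prog := .seq p (clearUpTo (max p.bound n))

/-- `OutputsInTime` says nothing about the other stacks at the end; emptying them makes the program
composable. The number `n` covers argument stacks that the program may never touch. -/
theorem OutputsInTime.runs_clean {p : Prog} {args : List (List Bool)} {out : List Bool} {T M : ℕ}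
    (h : OutputsInTime p args out T) (hM : ∀ a ∈ args, a.length ≤ M) {n : ℕ}
    (hn : args.length ≤ n) : Runs (p.clean n) (inputStore args) (inputStore [out])
      (T + (max p.bound n * (2 * (M + T) + 1) + 1)) := by
  obtain ⟨s, t, ht, he, h0⟩ := h
  have hl : ∀ i, (s i).length ≤ M + T := by
    intro i
    refine (he.length_le i).trans (Nat.add_le_add ?_ ht)
    simp only [inputStore, List.getD_eq_getElem?_getD]
    rcases lt_or_ge i args.length with hi | hi
    · rw [List.getElem?_eq_getElem hi]
      exact hM _ (List.getElem_mem hi)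
    · simp [List.getElem?_eq_none hi]
  refine (Runs.seq ⟨t, ht, he⟩ (runs_clearUpTo (max p.bound n) _ _ hl)).congr ?_ le_rfl
  funext i
  cases i with
  | zero => simp [inputStore, h0]
  | succ i =>
    split_ifs with hi
    · rfl
    · have hb : p.bound ≤ i + 1 ∧ n ≤ i + 1 := by omega
      rw [he.eq_of_bound_le hb.1]
      simp [inputStore, List.getD_eq_getElem?_getD]
      rw [List.getElem?_eq_none (by omega)]
      rfl

theorem OutputsInTime.length_le {p : Prog} {args : List (List Bool)} {out : List Bool} {T : ℕ}
    (h : OutputsInTime p args out T) : out.length ≤ (args.getD 0 []).length + T := by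
  obtain ⟨s, t, ht, he, h0⟩ := h
  have := he.length_le 0
  rw [h0] at this
  exact this.trans (Nat.add_le_add_left ht _)

end QAdv


namespace QAdv

/-! ### Polynomial time -/

section

variable {ι κ : Type*} {sz : ι → ℕ}

/-- `f` is bounded by a polynomial in `sz`. -/
def PolyBdd (sz f : ι → ℕ) : Prop := ∃ P : Polynomial ℕ, ∀ i, f i ≤ P.eval (sz i)

theorem PolyBdd.eval (sz : ι → ℕ) (P : Polynomial ℕ) : PolyBdd sz fun i => P.eval (sz i) :=
  ⟨P, fun _ => le_rfl⟩

theorem PolyBdd.const (sz : ι → ℕ) (c : ℕ) : PolyBdd sz fun _ => c :=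
  ⟨Polynomial.C c, fun _ => by simp⟩

theorem PolyBdd.self (sz : ι → ℕ) : PolyBdd sz sz := ⟨Polynomial.X, fun _ => by simp⟩

theorem PolyBdd.mono {f g : ι → ℕ} (h : PolyBdd sz g) (hfg : ∀ i, f i ≤ g i) : PolyBdd sz f :=
  let ⟨P, hP⟩ := h
  ⟨P, fun i => (hfg i).trans (hP i)⟩

theorem PolyBdd.add {f g : ι → ℕ} (hf : PolyBdd sz f) (hg : PolyBdd sz g) :
    PolyBdd sz fun i => f i + g i :=
  let ⟨P, hP⟩ := hf
  let ⟨Q, hQ⟩ := hg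
  ⟨P + Q, fun i => by simpa using Nat.add_le_add (hP i) (hQ i)⟩

theorem PolyBdd.mul {f g : ι → ℕ} (hf : PolyBdd sz f) (hg : PolyBdd sz g) :
    PolyBdd sz fun i => f i * g i :=
  let ⟨P, hP⟩ := hf
  let ⟨Q, hQ⟩ := hg
  ⟨P * Q, fun i => by simpa using Nat.mul_le_mul (hP i) (hQ i)⟩

theorem PolyBdd.comp {f : ι → ℕ} (h : PolyBdd sz f) (e : κ → ι) :
    PolyBdd (fun k => sz (e k)) fun k => f (e k) :=
  let ⟨P, hP⟩ := h
  ⟨P, fun k => hP (e k)⟩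

/-- Program `p` leads from the stacks `A i` to the stacks `B i` in time polynomial in `sz i`. -/
def PolyRuns (sz : ι → ℕ) (p : Prog) (A B : ι → List (List Bool)) : Prop :=
  ∃ P : Polynomial ℕ, ∀ i, Runs p (inputStore (A i)) (inputStore (B i)) (P.eval (sz i))

theorem PolyRuns.of {p : Prog} {A B : ι → List (List Bool)} {T : ι → ℕ} (hT : PolyBdd sz T)
    (h : ∀ i, Runs p (inputStore (A i)) (inputStore (B i)) (T i)) : PolyRuns sz p A B :=
  let ⟨P, hP⟩ := hT
  ⟨P, fun i => (h i).mono (hP i)⟩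

theorem PolyRuns.congr {p : Prog} {A B A' B' : ι → List (List Bool)} (h : PolyRuns sz p A B)
    (hA : ∀ i, inputStore (A i) = inputStore (A' i))
    (hB : ∀ i, inputStore (B i) = inputStore (B' i)) : PolyRuns sz p A' B' :=
  let ⟨P, hP⟩ := h
  ⟨P, fun i => by rw [← hA, ← hB]; exact hP i⟩

theorem PolyRuns.comp {p : Prog} {A B : ι → List (List Bool)} (h : PolyRuns sz p A B)
    (e : κ → ι) : PolyRuns (fun k => sz (e k)) p (fun k => A (e k)) fun k => B (e k) :=
  let ⟨P, hP⟩ := h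
  ⟨P, fun k => hP (e k)⟩

theorem PolyRuns.seq {p q : Prog} {A B C : ι → List (List Bool)} (h : PolyRuns sz p A B)
    (h' : PolyRuns sz q B C) : PolyRuns sz (.seq p q) A C :=
  let ⟨P, hP⟩ := h
  let ⟨Q, hQ⟩ := h'
  ⟨P + Q, fun i => ((hP i).seq (hQ i)).mono (by simp)⟩

/-- The body is a family indexed by input and iteration, but its size is that of the input alone:
the time bound has to be uniform over the iterations. -/
theorem PolyRuns.loop {r : ℕ} {p : Prog} (n : ι → ℕ) (hn : PolyBdd sz n)
    (σ : ι → ℕ → List (List Bool)) (hne : ∀ i, ∀ k < n i, (σ i k).getD r [] ≠ [])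
    (h0 : ∀ i, (σ i (n i)).getD r [] = [])
    (h : PolyRuns (fun x : Σ i, Fin (n i) => sz x.1) p (fun x => σ x.1 x.2)
      fun x => σ x.1 (x.2 + 1)) :
    PolyRuns sz (.loop r p) (fun i => σ i 0) fun i => σ i (n i) := by
  obtain ⟨P, hP⟩ := h
  refine PolyRuns.of ((hn.mul ((PolyBdd.eval sz P).add (.const sz 1))).add (.const sz 1))
    fun i => ?_
  exact Runs.loop (fun k => inputStore (σ i k)) (n i) (hne i) (h0 i) fun k hk => hP ⟨i, k, hk⟩

theorem PolyRuns.skip (A : ι → List (List Bool)) : PolyRuns sz .skip A A :=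
  .of (.const sz 1) fun _ => .skip _

theorem PolyRuns.push (A : ι → List (List Bool)) (j : ℕ) (b : Bool) :
    PolyRuns sz (.push j b) A fun i => setL (A i) j (b :: (A i).getD j []) :=
  .of (.const sz 1) fun i => .push (A i) j b

theorem PolyRuns.pop (A : ι → List (List Bool)) (j : ℕ) :
    PolyRuns sz (.pop j) A fun i => setL (A i) j ((A i).getD j []).tail :=
  .of (.const sz 1) fun i => .pop (A i) j

theorem PolyRuns.move {a b : ℕ} (hab : a ≠ b) (A : ι → List (List Bool))
    (h : PolyBdd sz fun i => ((A i).getD a []).length) : PolyRuns sz (moveProg a b) A fun i =>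
      setL (setL (A i) b (((A i).getD a []).reverse ++ (A i).getD b [])) a [] :=
  .of (((PolyBdd.const sz 4).mul h).add (.const sz 1)) fun i => runs_moveProg hab (A i)

theorem PolyRuns.copy {a b c : ℕ} (hab : a ≠ b) (hac : a ≠ c) (hbc : b ≠ c)
    (A : ι → List (List Bool)) (hc : ∀ i, (A i).getD c [] = [])
    (h : PolyBdd sz fun i => ((A i).getD a []).length) :
    PolyRuns sz (copyProg a b c) A fun i => setL (A i) b ((A i).getD a [] ++ (A i).getD b []) :=
  .of (((PolyBdd.const sz 9).mul h).add (.const sz 2)) fun i =>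
    runs_copyProg hab hac hbc (A i) (hc i)

theorem PolyRuns.clear (a : ℕ) (A : ι → List (List Bool))
    (h : PolyBdd sz fun i => ((A i).getD a []).length) :
    PolyRuns sz (clearProg a) A fun i => setL (A i) a [] :=
  .of (((PolyBdd.const sz 2).mul h).add (.const sz 1)) fun i => runs_clearProg a (A i)

theorem PolyRuns.read {a b c : ℕ} (hab : a ≠ b) (hac : a ≠ c) (hbc : b ≠ c)
    (A : ι → List (List Bool)) (k : ι → ℕ) (r : ι → List Bool)
    (ha : ∀ i, (A i).getD a [] = encodeIndex (k i) ++ r i) (hc : ∀ i, (A i).getD c [] = [])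
    (h : PolyBdd sz k) : PolyRuns sz (readProg a b c) A fun i =>
      setL (setL (A i) b (unary (k i) ++ (A i).getD b [])) a (r i) :=
  .of (((PolyBdd.const sz 4).mul h).add (.const sz 6)) fun i =>
    runs_readProg hab hac hbc (A i) (k i) (r i) (ha i) (hc i)

theorem PolyRuns.shift {p : Prog} {A B : ι → List (List Bool)} (h : PolyRuns sz p A B) (k : ℕ)
    (L : ι → List (List Bool)) (hL : ∀ i, (L i).length = k) :
    PolyRuns sz (p.shift k) (fun i => L i ++ A i) fun i => L i ++ B i :=
  let ⟨P, hP⟩ := h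
  ⟨P, fun i => by rw [← hL i]; exact (hP i).shift (L i)⟩

theorem PolyRuns.clean {p : Prog} {args : ι → List (List Bool)} {out : ι → List Bool}
    {T : ι → ℕ} (hT : PolyBdd sz T) (h : ∀ i, OutputsInTime p (args i) (out i) (T i))
    {M : ι → ℕ} (hM : PolyBdd sz M) (ha : ∀ i, ∀ a ∈ args i, a.length ≤ M i) (n : ℕ)
    (hn : ∀ i, (args i).length ≤ n) : PolyRuns sz (p.clean n) args fun i => [out i] :=
  .of (hT.add (((PolyBdd.const sz _).mul (((PolyBdd.const sz 2).mul (hM.add hT)).add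
    (.const sz 1))).add (.const sz 1))) fun i => (h i).runs_clean (ha i) (hn i)

end

@[simp] theorem length_unary (n : ℕ) : (unary n).length = n := by simp [unary]

theorem unary_add (m n : ℕ) : unary m ++ unary n = unary (m + n) := by simp [unary]

theorem unary_ne_nil {n : ℕ} (h : 0 < n) : unary n ≠ [] := by
  simp [unary]
  omega

theorem tail_unary (n : ℕ) : (unary n).tail = unary (n - 1) := by simp [unary]

/-! ### Computing polynomials in unary -/

theorem exists_pushProg {f : ℕ → ℕ} (a : ℕ) : ∃ q, PolyRuns (fun lam => lam) q
    (fun lam => [unary lam, unary (f lam)]) fun lam => [unary lam, unary (f lam + a)] := by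
  induction a with
  | zero => exact ⟨.skip, .skip _⟩
  | succ a ih =>
    obtain ⟨q, hq⟩ := ih
    exact ⟨.seq q (.push 1 true), hq.seq (.push _ _ _)⟩

theorem exists_polyProg (p : Polynomial ℕ) : ∃ q, PolyRuns (fun lam => lam) q
    (fun lam => [unary lam]) fun lam => [unary lam, unary (p.eval lam)] := by
  induction p using Polynomial.recOnHorner with
  | M0 =>
    refine ⟨.skip, (PolyRuns.skip _).congr (fun _ => rfl) fun lam => ?_⟩
    simpa [unary] using (inputStore_pad [unary lam] 1).symm
  | MC p a h0 ha ih =>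
    obtain ⟨q, hq⟩ := ih
    obtain ⟨r, hr⟩ := exists_pushProg (f := fun lam => p.eval lam) a
    refine ⟨.seq q r, (hq.seq hr).congr (fun _ => rfl) fun lam => ?_⟩
    simp
  | MX p hp ih =>
    obtain ⟨q, hq⟩ := ih
    set sz : ℕ → ℕ := fun lam => lam
    have hpb : PolyBdd sz fun lam => p.eval lam := .eval sz p
    have h1 : PolyRuns sz (moveProg 1 2) (fun lam => [unary lam, unary (p.eval lam)])
        fun lam => [unary lam, [], (unary (p.eval lam)).reverse ++ []] :=
      .move (by decide) _ (hpb.mono fun lam => by simp)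
    -- Horner's scheme: multiplication by the variable adds `lam` once for each unit of the previous
    -- value, which serves as the loop counter on stack `2`.
    have h2 : PolyRuns sz (.loop 2 (.seq (.pop 2) (copyProg 0 1 3)))
        (fun lam => [unary lam, unary (0 * lam), unary (p.eval lam - 0)])
        fun lam => [unary lam, unary (p.eval lam * lam), unary (p.eval lam - p.eval lam)] := by
      refine .loop (fun lam => p.eval lam) hpb
        (fun lam k => [unary lam, unary (k * lam), unary (p.eval lam - k)])
        (fun lam k hk => unary_ne_nil (Nat.sub_pos_of_lt hk)) (fun lam => by simp [unary]) ?_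
      refine (PolyRuns.pop _ 2).seq ((PolyRuns.copy (by decide) (by decide) (by decide) _
        (fun _ => rfl) ?_).congr (fun _ => rfl) ?_)
      · exact ((PolyBdd.self sz).comp Sigma.fst).mono fun x => by simp [setL, sz]
      · rintro ⟨lam, k, hk⟩
        simp [setL, tail_unary, unary_add, Nat.sub_sub, Nat.succ_mul, add_comm lam]
    refine ⟨.seq q (.seq (moveProg 1 2) (.loop 2 (.seq (.pop 2) (copyProg 0 1 3)))),
      hq.seq ((h1.congr (fun _ => rfl) fun lam => ?_).seq (h2.congr (fun _ => rfl)
        fun lam => ?_))⟩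
    · simp [unary]
    · simpa [unary] using inputStore_pad [unary lam, unary (p.eval lam * lam)] 1

/-! ### Writing down several copies of a circuit -/

/-- The description of a gate all of whose qubits are shifted by `o`. -/
def Gate.shiftEncode {n : ℕ} (o : ℕ) : Gate n → List Bool
  | .had i => [false, false] ++ encodeIndex (o + i)
  | .phase i => [false, true] ++ encodeIndex (o + i)
  | .cnot c t _ => [true, false] ++ encodeIndex (o + c) ++ encodeIndex (o + t)
  | .toffoli c d t _ _ _ =>
      [true, true] ++ encodeIndex (o + c) ++ encodeIndex (o + d) ++ encodeIndex (o + t)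

theorem Gate.encode_block {m n : ℕ} (j : Fin m) (g : Gate n) :
    (g.block j).encode = g.shiftEncode (j * n) := by
  cases g <;> simp [Gate.block, Gate.encode, Gate.shiftEncode, finProdFinEquiv, mul_comm, add_comm]

theorem QCircuit.encode_copies (m : ℕ) (C : QCircuit) : (C.copies m).encode
    = encodeIndex (m * C.qubits) ++
      (List.range m).flatMap fun j => C.gates.flatMap (Gate.shiftEncode (j * C.qubits)) := by
  rw [QCircuit.encode, ← List.map_coe_finRange_eq_range, List.flatMap_map]
  simp only [QCircuit.copies, List.flatMap_assoc, List.flatMap_map, Gate.encode_block]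

theorem reverse_encodeIndex (k : ℕ) : (encodeIndex k).reverse = false :: unary k := by
  simp [encodeIndex, unary]

/-- Copy a number from stack `4` to stack `7`, adding the number on stack `6` to it. -/
def indexProg : Prog := .seq (copyProg 6 7 5) (.seq (readProg 4 7 5) (.push 7 false))

/-- Stack `7` collects the output in reverse, so ones followed by a pushed `false` are the reversed
code of the index. -/
theorem runs_indexProg (a b c d r O : List Bool) (o i : ℕ) :
    Runs indexProg (inputStore [a, b, c, d, encodeIndex i ++ r, [], unary o, O])
      (inputStore [a, b, c, d, r, [], unary o, (encodeIndex (o + i)).reverse ++ O])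
      (9 * o + 4 * i + 9) := by
  have h1 := runs_copyProg (a := 6) (b := 7) (c := 5) (by decide) (by decide) (by decide)
    [a, b, c, d, encodeIndex i ++ r, [], unary o, O] rfl
  have h2 := runs_readProg (a := 4) (b := 7) (c := 5) (by decide) (by decide) (by decide)
    [a, b, c, d, encodeIndex i ++ r, [], unary o, unary o ++ O] i r rfl rfl
  have h3 := Runs.push [a, b, c, d, r, [], unary o, unary i ++ (unary o ++ O)] 7 false
  refine (h1.seq (h2.seq h3)).congr ?_ (by simp; omega)
  rw [reverse_encodeIndex, ← unary_add, ← List.append_assoc, unary_add, add_comm, ← unary_add]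
  rfl

/-- Copy a bit from stack `4` to stack `7` if it is known. -/
def bitProg (b : Bool) : Prog := .seq (.pop 4) (.push 7 b)

theorem runs_bitProg (a b c d r o O : List Bool) (x : Bool) :
    Runs (bitProg x) (inputStore [a, b, c, d, x :: r, [], o, O])
      (inputStore [a, b, c, d, r, [], o, x :: O]) 2 :=
  (Runs.pop _ 4).seq (Runs.push _ 7 x)

/-- Copy the description of a gate from stack `4` to stack `7`, adding the number on stack `6` to
the numbers of the qubits. -/
def gateProg : Prog :=
  .ifTop 4 true
    (.seq (bitProg true) (.ifTop 4 true
      (.seq (bitProg true) (.seq indexProg (.seq indexProg indexProg)))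
      (.seq (bitProg false) (.seq indexProg indexProg))))
    (.seq (bitProg false) (.ifTop 4 true
      (.seq (bitProg true) indexProg) (.seq (bitProg false) indexProg)))

theorem runs_gateProg {n : ℕ} (a b c d r O : List Bool) (o : ℕ) (g : Gate n) :
    Runs gateProg (inputStore [a, b, c, d, g.encode ++ r, [], unary o, O])
      (inputStore [a, b, c, d, r, [], unary o, (g.shiftEncode o).reverse ++ O])
      (27 * o + 12 * n + 40) := by
  cases g with
  | had i =>
    refine (Runs.ifTop_neg (by simp [inputStore]) ((runs_bitProg ..).seq
      (Runs.ifTop_neg (by simp [inputStore]) ((runs_bitProg ..).seq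
        (runs_indexProg a b c d r _ o i))))).congr ?_ (by omega)
    simp [Gate.shiftEncode]
  | phase i =>
    refine (Runs.ifTop_neg (by simp [inputStore]) ((runs_bitProg ..).seq
      (Runs.ifTop_pos (by simp [inputStore]) ((runs_bitProg ..).seq
        (runs_indexProg a b c d r _ o i))))).congr ?_ (by omega)
    simp [Gate.shiftEncode]
  | cnot i j h =>
    have e : (Gate.cnot i j h).encode ++ r
        = true :: false :: (encodeIndex i ++ (encodeIndex j ++ r)) := by simp [Gate.encode]
    rw [e]
    refine (Runs.ifTop_pos (by simp [inputStore]) ((runs_bitProg ..).seq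
      (Runs.ifTop_neg (by simp [inputStore]) ((runs_bitProg ..).seq
        ((runs_indexProg a b c d _ _ o i).seq (runs_indexProg a b c d r _ o j)))))).congr ?_
      (by omega)
    simp [Gate.shiftEncode]
  | toffoli i j k h1 h2 h3 =>
    have e : (Gate.toffoli i j k h1 h2 h3).encode ++ r
        = true :: true :: (encodeIndex i ++ (encodeIndex j ++ (encodeIndex k ++ r))) := by
      simp [Gate.encode]
    rw [e]
    refine (Runs.ifTop_pos (by simp [inputStore]) ((runs_bitProg ..).seq
      (Runs.ifTop_pos (by simp [inputStore]) ((runs_bitProg ..).seq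
        ((runs_indexProg a b c d _ _ o i).seq ((runs_indexProg a b c d _ _ o j).seq
          (runs_indexProg a b c d r _ o k))))))).congr ?_ (by omega)
    simp [Gate.shiftEncode]

theorem runs_gatesProg {n : ℕ} (a b c d O : List Bool) (o : ℕ) (gs : List (Gate n)) :
    Runs (.loop 4 gateProg)
      (inputStore [a, b, c, d, gs.flatMap Gate.encode, [], unary o, O])
      (inputStore [a, b, c, d, [], [], unary o, (gs.flatMap (Gate.shiftEncode o)).reverse ++ O])
      (gs.length * (27 * o + 12 * n + 41) + 1) := by
  have h := Runs.loop (i := 4) (p := gateProg) (T := 27 * o + 12 * n + 40)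
    (fun k => inputStore [a, b, c, d, (gs.drop k).flatMap Gate.encode, [], unary o,
      ((gs.take k).flatMap (Gate.shiftEncode o)).reverse ++ O]) gs.length
    (fun k hk => ?_) (by simp [inputStore]) (fun k hk => ?_)
  · simpa using h
  · change (gs.drop k).flatMap Gate.encode ≠ []
    rw [List.drop_eq_getElem_cons hk, List.flatMap_cons]
    cases gs[k] <;> simp [Gate.encode]
  · rw [List.drop_eq_getElem_cons hk, List.flatMap_cons, List.take_succ_eq_append_getElem hk,
      List.flatMap_append, List.reverse_append, List.append_assoc]
    simpa using runs_gateProg a b c d ((gs.drop (k + 1)).flatMap Gate.encode)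
      (((gs.take k).flatMap (Gate.shiftEncode o)).reverse ++ O) o gs[k]

/-- The body of the loop that writes the copies: append a copy of the gates on stack `2`. -/
def copyStepProg : Prog :=
  .seq (.pop 1) (.seq (copyProg 2 4 5) (.seq (.loop 4 gateProg) (copyProg 3 6 5)))

/-- The descriptions of the gates of `k` copies. -/
def copiesEncode {n : ℕ} (gs : List (Gate n)) (k : ℕ) : List Bool :=
  (List.range k).flatMap fun j => gs.flatMap (Gate.shiftEncode (j * n))

theorem copiesEncode_succ {n : ℕ} (gs : List (Gate n)) (k : ℕ) : copiesEncode gs (k + 1)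
    = copiesEncode gs k ++ gs.flatMap (Gate.shiftEncode (k * n)) := by
  simp [copiesEncode, List.range_succ]

theorem runs_copyStepProg {n : ℕ} (a : List Bool) (l k : ℕ) (gs : List (Gate n)) :
    Runs copyStepProg
      (inputStore [a, unary l, gs.flatMap Gate.encode, unary n, [], [], unary (k * n),
        (copiesEncode gs k).reverse])
      (inputStore [a, unary (l - 1), gs.flatMap Gate.encode, unary n, [], [],
        unary ((k + 1) * n), (copiesEncode gs (k + 1)).reverse])
      (1 + (9 * (gs.flatMap Gate.encode).length + 2
        + (gs.length * (27 * (k * n) + 12 * n + 41) + 1 + (9 * n + 2)))) := by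
  have h1 := Runs.pop [a, unary l, gs.flatMap Gate.encode, unary n, [], [], unary (k * n),
    (copiesEncode gs k).reverse] 1
  have h2 := runs_copyProg (a := 2) (b := 4) (c := 5) (by decide) (by decide) (by decide)
    [a, (unary l).tail, gs.flatMap Gate.encode, unary n, [], [], unary (k * n),
      (copiesEncode gs k).reverse] rfl
  have h3 := runs_gatesProg a (unary l).tail (gs.flatMap Gate.encode) (unary n)
    (copiesEncode gs k).reverse (k * n) gs
  have h4 := runs_copyProg (a := 3) (b := 6) (c := 5) (by decide) (by decide) (by decide)
    [a, (unary l).tail, gs.flatMap Gate.encode, unary n, [], [], unary (k * n),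
      (gs.flatMap (Gate.shiftEncode (k * n))).reverse ++ (copiesEncode gs k).reverse] rfl
  have e2 : setL [a, (unary l).tail, gs.flatMap Gate.encode, unary n, [], [], unary (k * n),
      (copiesEncode gs k).reverse] 4 (gs.flatMap Gate.encode ++ [])
      = [a, (unary l).tail, gs.flatMap Gate.encode, unary n, gs.flatMap Gate.encode, [],
        unary (k * n), (copiesEncode gs k).reverse] := by simp [setL]
  have h2' := h2.congr (congrArg inputStore e2) le_rfl
  refine (h1.seq (h2'.seq (h3.seq h4))).congr ?_ (by simp)
  rw [copiesEncode_succ]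
  simp [setL, tail_unary, unary_add, Nat.succ_mul, add_comm n]

/-- Write the description of several copies of a circuit: stack `0` is discarded, stack `1` holds
the number of copies and stack `2` the description of the circuit. -/
def copiesProg : Prog :=
  .seq (readProg 2 3 4) (.seq (.loop 1 copyStepProg) (.seq (clearProg 0) (.seq (moveProg 7 0)
    (.seq (.push 0 false) (moveProg 6 0)))))

/-- Stack `6` holds the qubit offset of the next copy. After the last copy it equals the total
number of qubits, so it is reused as the header of the description. Moving stack `7` to stack `0`
undoes the reversal. The remaining stacks `B` are irrelevant leftovers. -/
theorem polyRuns_copiesProg (C : ℕ → QCircuit) (M : Polynomial ℕ)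
    (hC : PolyBdd (fun lam => lam) fun lam => (C lam).encode.length) :
    ∃ B : ℕ → List (List Bool), PolyRuns (fun lam => lam) copiesProg
      (fun lam => [unary lam, unary (M.eval lam), (C lam).encode])
      fun lam => ((C lam).copies (M.eval lam)).encode :: B lam := by
  set sz : ℕ → ℕ := fun lam => lam
  have hm : PolyBdd sz fun lam => M.eval lam := .eval sz M
  have hn : PolyBdd sz fun lam => (C lam).qubits := hC.mono fun lam => by
    simp only [QCircuit.encode, encodeIndex, List.length_append, List.length_replicate]
    omega
  have hG : PolyBdd sz fun lam => ((C lam).gates.flatMap Gate.encode).length :=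
    hC.mono fun lam => by
      simp only [QCircuit.encode, List.length_append]
      omega
  have hg : PolyBdd sz fun lam => (C lam).gates.length :=
    hG.mono fun lam => length_le_flatMap_encode _
  have h1 : PolyRuns sz (readProg 2 3 4)
      (fun lam => [unary lam, unary (M.eval lam), (C lam).encode])
      fun lam => [unary lam, unary (M.eval lam), (C lam).gates.flatMap Gate.encode,
        unary (C lam).qubits ++ []] :=
    .read (by decide) (by decide) (by decide) _ (fun lam => (C lam).qubits) _
      (fun _ => rfl) (fun _ => rfl) hn
  have h2 : PolyRuns sz (.loop 1 copyStepProg)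
      (fun lam => [unary lam, unary (M.eval lam - 0), (C lam).gates.flatMap Gate.encode,
        unary (C lam).qubits, [], [], unary (0 * (C lam).qubits),
        (copiesEncode (C lam).gates 0).reverse])
      fun lam => [unary lam, unary (M.eval lam - M.eval lam),
        (C lam).gates.flatMap Gate.encode, unary (C lam).qubits, [], [],
        unary (M.eval lam * (C lam).qubits),
        (copiesEncode (C lam).gates (M.eval lam)).reverse] := by
    refine PolyRuns.loop (sz := sz) (fun lam => M.eval lam) hm
      (fun lam k => [unary lam, unary (M.eval lam - k), (C lam).gates.flatMap Gate.encode,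
        unary (C lam).qubits, [], [], unary (k * (C lam).qubits),
        (copiesEncode (C lam).gates k).reverse])
      (fun lam k hk => unary_ne_nil (Nat.sub_pos_of_lt hk)) (fun lam => by simp [unary]) ?_
    -- A bound independent of the iteration: the offset `k * (C lam).qubits` is replaced by its
    -- value at `k = M.eval lam`.
    have hT : PolyBdd sz fun lam => 1 + (9 * ((C lam).gates.flatMap Gate.encode).length + 2
        + ((C lam).gates.length * (27 * (M.eval lam * (C lam).qubits) + 12 * (C lam).qubits + 41)
          + 1 + (9 * (C lam).qubits + 2))) :=
      (PolyBdd.const sz 1).add ((((PolyBdd.const sz 9).mul hG).add (.const sz 2)).add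
        (((hg.mul ((((PolyBdd.const sz 27).mul (hm.mul hn)).add
          ((PolyBdd.const sz 12).mul hn)).add (.const sz 41))).add (.const sz 1)).add
          (((PolyBdd.const sz 9).mul hn).add (.const sz 2))))
    refine PolyRuns.of (hT.comp Sigma.fst) ?_
    rintro ⟨lam, k, hk⟩
    refine (runs_copyStepProg (unary lam) (M.eval lam - k) k (C lam).gates).mono ?_
    have := Nat.mul_le_mul_right (C lam).qubits hk.le
    gcongr
  have h3 : PolyRuns sz (clearProg 0)
      (fun lam => [unary lam, unary (M.eval lam - M.eval lam),
        (C lam).gates.flatMap Gate.encode, unary (C lam).qubits, [], [],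
        unary (M.eval lam * (C lam).qubits), (copiesEncode (C lam).gates (M.eval lam)).reverse])
      fun lam => [[], unary (M.eval lam - M.eval lam),
        (C lam).gates.flatMap Gate.encode, unary (C lam).qubits, [], [],
        unary (M.eval lam * (C lam).qubits),
        (copiesEncode (C lam).gates (M.eval lam)).reverse] :=
    .clear 0 _ ((PolyBdd.self sz).mono fun lam => by simp [sz])
  have hlen : PolyBdd sz fun lam => (copiesEncode (C lam).gates (M.eval lam)).reverse.length := by
    have hT : PolyBdd sz fun lam => M.eval lam * ((C lam).gates.length *
        (3 * (M.eval lam * (C lam).qubits + (C lam).qubits) + 5)) :=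
      hm.mul (hg.mul (((PolyBdd.const sz 3).mul ((hm.mul hn).add hn)).add (.const sz 5)))
    refine hT.mono fun lam => ?_
    rw [List.length_reverse, copiesEncode, List.length_flatMap]
    refine (List.sum_le_card_nsmul _ ((C lam).gates.length *
        (3 * (M.eval lam * (C lam).qubits + (C lam).qubits) + 5)) ?_).trans (by simp)
    simp only [List.mem_map, List.mem_range, forall_exists_index, and_imp]
    rintro _ j hj rfl
    rw [List.length_flatMap]
    refine (List.sum_le_card_nsmul _
        (3 * (M.eval lam * (C lam).qubits + (C lam).qubits) + 5) ?_).trans (by simp)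
    simp only [List.mem_map, forall_exists_index, and_imp]
    rintro _ g hg rfl
    have := Nat.mul_le_mul_right (C lam).qubits hj.le
    cases g <;> simp [Gate.shiftEncode, encodeIndex] <;> omega
  have h4 : PolyRuns sz (moveProg 7 0)
      (fun lam => [[], unary (M.eval lam - M.eval lam),
        (C lam).gates.flatMap Gate.encode, unary (C lam).qubits, [], [],
        unary (M.eval lam * (C lam).qubits), (copiesEncode (C lam).gates (M.eval lam)).reverse])
      fun lam => [(copiesEncode (C lam).gates (M.eval lam)).reverse.reverse ++ [],
        unary (M.eval lam - M.eval lam),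
        (C lam).gates.flatMap Gate.encode, unary (C lam).qubits, [], [],
        unary (M.eval lam * (C lam).qubits), []] :=
    .move (by decide) _ hlen
  have h5 : PolyRuns sz (moveProg 6 0)
      (fun lam => [false :: ((copiesEncode (C lam).gates (M.eval lam)).reverse.reverse ++ []),
        unary (M.eval lam - M.eval lam),
        (C lam).gates.flatMap Gate.encode, unary (C lam).qubits, [], [],
        unary (M.eval lam * (C lam).qubits), []])
      fun lam => [(unary (M.eval lam * (C lam).qubits)).reverse ++
          (false :: ((copiesEncode (C lam).gates (M.eval lam)).reverse.reverse ++ [])),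
        unary (M.eval lam - M.eval lam),
        (C lam).gates.flatMap Gate.encode, unary (C lam).qubits, [], [], [], []] :=
    .move (by decide) _ ((hm.mul hn).mono fun lam => by simp)
  refine ⟨fun lam => [unary (M.eval lam - M.eval lam), (C lam).gates.flatMap Gate.encode,
    unary (C lam).qubits, [], [], [], []], ?_⟩
  have h1' := h1.congr (B' := fun lam => [unary lam, unary (M.eval lam - 0),
    (C lam).gates.flatMap Gate.encode, unary (C lam).qubits, [], [],
    unary (0 * (C lam).qubits), (copiesEncode (C lam).gates 0).reverse]) (fun _ => rfl)
    fun lam => by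
      simpa [copiesEncode, unary] using (inputStore_pad [unary lam, unary (M.eval lam),
        (C lam).gates.flatMap Gate.encode, unary (C lam).qubits] 4).symm
  refine (h1'.seq (h2.seq (h3.seq (h4.seq ((PolyRuns.push _ 0 false).seq h5))))).congr
    (fun _ => rfl) fun lam => ?_
  rw [QCircuit.encode_copies]
  simp [copiesEncode, encodeIndex, unary]

theorem PolyRuns.outputs {p : Prog} {A B : ℕ → List (List Bool)}
    (h : PolyRuns (fun lam => lam) p A B) :
    ∃ T : Polynomial ℕ, ∀ lam, OutputsInTime p (A lam) ((B lam).getD 0 []) (T.eval lam) :=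
  let ⟨P, hP⟩ := h
  ⟨P, fun lam => let ⟨t, ht, he⟩ := hP lam; ⟨_, t, ht, he, rfl⟩⟩

theorem polyBdd_length_encode (A : QPTSampler) :
    PolyBdd (fun lam => lam) fun lam => (A.circuit lam).encode.length :=
  ((PolyBdd.self _).add (.eval _ A.genTime)).mono fun lam => by
    simpa using (A.gen_computes lam).length_le

theorem polyRuns_genProg (A : QPTSampler) : PolyRuns (fun lam => lam) (A.genProg.clean 1)
    (fun lam => [unary lam]) fun lam => [(A.circuit lam).encode] :=
  .clean (.eval _ A.genTime) A.gen_computes (.self _) (by simp) 1 (by simp)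

/-- Several copies of a polynomial-time uniform family of circuits are polynomial-time uniform. -/
theorem exists_copiesGen (A : QPTSampler) (M : Polynomial ℕ) :
    ∃ (p : Prog) (T : Polynomial ℕ), ∀ lam, OutputsInTime p [unary lam]
      ((A.circuit lam).copies (M.eval lam)).encode (T.eval lam) := by
  obtain ⟨q, hq⟩ := exists_polyProg M
  obtain ⟨B, hB⟩ := polyRuns_copiesProg A.circuit M (polyBdd_length_encode A)
  have h1 : PolyRuns (fun lam => lam) (copyProg 0 2 3)
      (fun lam => [unary lam, unary (M.eval lam)])
      fun lam => [unary lam, unary (M.eval lam), unary lam ++ []] :=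
    .copy (by decide) (by decide) (by decide) _ (fun _ => rfl)
      ((PolyBdd.self _).mono fun lam => by simp)
  simp only [List.append_nil] at h1
  have h2 := (polyRuns_genProg A).shift 2 (fun lam => [unary lam, unary (M.eval lam)])
    fun _ => rfl
  obtain ⟨T, hT⟩ := (hq.seq (h1.seq (h2.seq hB))).outputs
  exact ⟨_, T, hT⟩

end QAdv


namespace QAdv

/-! ### The sampler that runs several copies and outputs all measured bits -/

/-- Discard stack `0` and move stack `1` there. -/
def returnProg : Prog := .seq (clearProg 0) (.seq (moveProg 1 2) (moveProg 2 0))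

theorem runs_returnProg (a w : List Bool) : Runs returnProg (inputStore [a, w])
    (inputStore [w, [], []]) (2 * a.length + 8 * w.length + 3) := by
  have h1 := runs_clearProg 0 [a, w]
  have h2 := runs_moveProg (a := 1) (b := 2) (by decide) [[], w]
  have h3 := runs_moveProg (a := 2) (b := 0) (by decide) [[], [], w.reverse ++ []]
  refine (h1.seq (h2.seq h3)).congr ?_ (by simp; omega)
  simp [setL]

/-- The measured bits are sent without the post-processing of `A`: the path sums give their
probabilities directly, and product structure is needed for the blocks. The post-processing is left
to the classical extractor. -/
theorem exists_copiesSampler (A : QPTSampler) (M : Polynomial ℕ) : ∃ P : QPTSampler,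
    (∀ lam, P.circuit lam = (A.circuit lam).copies (M.eval lam)) ∧ ∀ lam w, P.post lam w = w := by
  obtain ⟨p, T, hT⟩ := exists_copiesGen A M
  have hq : PolyBdd (fun lam => lam) fun lam => (A.circuit lam).qubits :=
    (polyBdd_length_encode A).mono fun lam => by
      simp only [QCircuit.encode, encodeIndex, List.length_append, List.length_replicate]
      omega
  obtain ⟨Q, hQ⟩ := hq
  refine ⟨⟨fun lam => (A.circuit lam).copies (M.eval lam), p, T, hT, fun _ w => w, returnProg,
    2 * .X + 8 * (M * Q) + 3, fun lam w hw => ?_⟩, fun _ => rfl, fun _ _ => rfl⟩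
  obtain ⟨t, ht, he⟩ := runs_returnProg (unary lam) w
  refine ⟨_, t, ht.trans ?_, he, rfl⟩
  have : w.length = M.eval lam * (A.circuit lam).qubits := hw
  have := Nat.mul_le_mul_left (M.eval lam) (hQ lam)
  simp only at this
  simp
  omega

/-! ### The classical algorithm that extracts a random block -/

/-- Block number `j` of length `n` of a bit string, padded by zeros. -/
def selectBlock (n j : ℕ) (τ : List Bool) : List Bool :=
  (List.range n).map fun i => (τ.drop (n * j)).getD i false

theorem selectBlock_ofFn {m n : ℕ} (x : Fin (m * n) → Bool) (j : Fin m) :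
    selectBlock n j (List.ofFn x) = List.ofFn (blockOf x j) := by
  rw [← take_drop_ofFn x j, selectBlock, mul_comm n]
  have hj : (j : ℕ) * n + n ≤ m * n := by
    have := Nat.mul_le_mul_right n j.isLt
    rwa [Nat.succ_mul] at this
  refine List.ext_getElem (by simp; omega) fun k h1 h2 => ?_
  simp only [List.length_map, List.length_range] at h1
  rw [List.getElem_map, List.getElem_range, List.getElem_take, List.getD_eq_getElem?_getD,
    List.getElem?_eq_getElem (by simp; omega), Option.getD_some]

/-- Move the top bit of stack `a`, or the bit `false` if there is none, to stack `b`. -/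
def takeProg (a b : ℕ) : Prog :=
  .seq (.ifTop a true (.push b true) (.push b false)) (.pop a)

theorem runs_takeProg {a b : ℕ} (hab : a ≠ b) (L : List (List Bool)) :
    Runs (takeProg a b) (inputStore L)
      (inputStore (setL (setL L b ((L.getD a []).headD false :: L.getD b [])) a
        (L.getD a []).tail)) 3 := by
  have h2 : ∀ x, Runs (.pop a) (inputStore (setL L b (x :: L.getD b [])))
      (inputStore (setL (setL L b (x :: L.getD b [])) a (L.getD a []).tail)) 1 := by
    intro x
    have h := Exec.pop a (inputStore (setL L b (x :: L.getD b [])))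
    rw [update_inputStore, ← update_inputStore L b, Function.update_of_ne hab,
      update_inputStore] at h
    exact ⟨1, le_rfl, h⟩
  have hl : inputStore L a = L.getD a [] := rfl
  rcases hL : L.getD a [] with _ | ⟨x, l⟩
  · rw [hL] at h2
    exact (Runs.ifTop_neg (by rw [hl, hL]; simp) (Runs.push L b false)).seq (h2 false)
  · rw [hL] at h2
    cases x
    · exact (Runs.ifTop_neg (by rw [hl, hL]; simp) (Runs.push L b false)).seq (h2 false)
    · exact (Runs.ifTop_pos (by rw [hl, hL]; simp) (Runs.push L b true)).seq (h2 true)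

/-- Remove as many bits from stack `2` as stack `4` indicates if the top bit of stack `1` is set,
and remove that bit. -/
def skipBlockProg : Prog :=
  .seq (.ifTop 1 true (.seq (copyProg 4 3 5) (.loop 3 (.seq (.pop 3) (.pop 2)))) .skip) (.pop 1)

theorem runs_skipBlockProg (a r τ : List Bool) (n : ℕ) (x : Bool) :
    Runs skipBlockProg (inputStore [a, x :: r, τ, [], unary n])
      (inputStore [a, r, τ.drop (n * x.toNat), [], unary n]) (12 * n + 5) := by
  have h3 : ∀ t, Runs (.pop 1) (inputStore [a, x :: r, t, [], unary n])
    (inputStore [a, r, t, [], unary n]) 1 := fun t => Runs.pop _ 1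
  cases x
  · refine ((Runs.ifTop_neg (by simp [inputStore]) (Runs.skip _)).seq (h3 τ)).congr ?_ (by omega)
    simp
  · have h1 := runs_copyProg (a := 4) (b := 3) (c := 5) (by decide) (by decide) (by decide)
      [a, true :: r, τ, [], unary n] rfl
    have h1' := h1.congr (s'' := inputStore [a, true :: r, τ.drop 0, unary (n - 0), unary n])
      (by simp [setL]) le_rfl
    have h2 := Runs.loop (i := 3) (p := .seq (.pop 3) (.pop 2)) (T := 2)
      (fun k => inputStore [a, true :: r, τ.drop k, unary (n - k), unary n]) n
      (fun k hk => unary_ne_nil (Nat.sub_pos_of_lt hk)) (by simp [inputStore, unary])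
      (fun k hk => by
        refine ((Runs.pop _ 3).seq (Runs.pop _ 2)).congr ?_ le_rfl
        simp [setL, tail_unary, Nat.sub_sub])
    have h2' := h2.congr (s'' := inputStore [a, true :: r, τ.drop n, [], unary n])
      (by simp [unary]) le_rfl
    refine ((Runs.ifTop_pos (by simp [inputStore]) (h1'.seq h2')).seq (h3 _)).congr ?_
      (by simp; omega)
    simp

section

variable {ι : Type*} {sz : ι → ℕ}

/-- Split off the first bits of the random seed. -/
theorem polyRuns_split (a : ι → List Bool) (r : ι → List Bool) (c : ι → ℕ) (hc : PolyBdd sz c)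
    (hcr : ∀ i, c i ≤ (r i).length) :
    PolyRuns sz (.seq (.loop 3 (.seq (.pop 3) (takeProg 1 4))) (moveProg 4 3))
      (fun i => [a i, r i, a i, unary (c i)])
      fun i => [a i, (r i).drop (c i), a i, (r i).take (c i)] := by
  have h1 : PolyRuns sz (.loop 3 (.seq (.pop 3) (takeProg 1 4)))
      (fun i => [a i, (r i).drop 0, a i, unary (c i - 0), ((r i).take 0).reverse])
      fun i => [a i, (r i).drop (c i), a i, unary (c i - c i), ((r i).take (c i)).reverse] := by
    refine .loop c hc (fun i k => [a i, (r i).drop k, a i, unary (c i - k),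
      ((r i).take k).reverse]) (fun i k hk => unary_ne_nil (Nat.sub_pos_of_lt hk))
      (fun i => by simp [unary]) (.of (.const _ 4) ?_)
    rintro ⟨i, k, hk⟩
    have hk' : k < (r i).length := hk.trans_le (hcr i)
    simp only
    rw [List.drop_eq_getElem_cons hk', List.take_succ_eq_append_getElem hk']
    refine ((Runs.pop _ 3).seq (runs_takeProg (by decide) _)).congr ?_ le_rfl
    rw [List.reverse_append]
    simp only [setL, List.getD_cons_succ, List.getD_cons_zero, tail_unary, Nat.sub_sub]
    rfl
  have h2 : PolyRuns sz (moveProg 4 3)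
      (fun i => [a i, (r i).drop (c i), a i, unary (c i - c i), ((r i).take (c i)).reverse])
      fun i => [a i, (r i).drop (c i), a i, ((r i).take (c i)).reverse.reverse ++
        unary (c i - c i), []] :=
    .move (by decide) _ (hc.mono fun i => by simp)
  refine (h1.seq h2).congr (fun i => ?_) fun i => ?_
  · simpa [unary] using inputStore_pad [a i, r i, a i, unary (c i)] 1
  · simpa [unary] using inputStore_pad [a i, (r i).drop (c i), a i, (r i).take (c i)] 1

/-- Extract the block whose number is the number of ones on stack `1`. -/
theorem polyRuns_select (a r τ : ι → List Bool) (n : ι → ℕ) (hn : PolyBdd sz n)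
    (hr : PolyBdd sz fun i => (r i).length) (hτ : PolyBdd sz fun i => (τ i).length) :
    PolyRuns sz (.seq (.loop 1 skipBlockProg) (.seq (.loop 4 (.seq (.pop 4) (takeProg 2 3)))
      (.seq (clearProg 2) (moveProg 3 1))))
      (fun i => [a i, r i, τ i, [], unary (n i)])
      fun i => [a i, selectBlock (n i) ((r i).count true) (τ i)] := by
  have h1 : PolyRuns sz (.loop 1 skipBlockProg)
      (fun i => [a i, (r i).drop 0, (τ i).drop (n i * ((r i).take 0).count true), [],
        unary (n i)])
      fun i => [a i, (r i).drop (r i).length,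
        (τ i).drop (n i * ((r i).take (r i).length).count true), [], unary (n i)] := by
    refine .loop (fun i => (r i).length) hr (fun i k => [a i, (r i).drop k,
      (τ i).drop (n i * ((r i).take k).count true), [], unary (n i)]) (fun i k hk => ?_)
      (fun i => by simp) (.of ((((PolyBdd.const sz 12).mul hn).add (.const sz 5)).comp
        Sigma.fst) ?_)
    · change (r i).drop k ≠ []
      simpa using hk
    · rintro ⟨i, k, hk⟩
      simp only
      rw [List.drop_eq_getElem_cons hk, List.take_succ_eq_append_getElem hk]
      refine (runs_skipBlockProg _ _ _ _ _).congr ?_ le_rfl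
      rw [List.drop_drop, ← mul_add, List.count_append]
      cases (r i)[k] <;> simp
  have h2 : PolyRuns sz (.loop 4 (.seq (.pop 4) (takeProg 2 3)))
      (fun i => [a i, (r i).drop (r i).length, ((τ i).drop (n i * (r i).count true)).drop 0,
        ((List.range 0).map fun k => ((τ i).drop (n i * (r i).count true)).getD k false).reverse,
        unary (n i - 0)])
      fun i => [a i, (r i).drop (r i).length,
        ((τ i).drop (n i * (r i).count true)).drop (n i),
        ((List.range (n i)).map fun k =>
          ((τ i).drop (n i * (r i).count true)).getD k false).reverse, unary (n i - n i)] := by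
    refine .loop n hn (fun i k => [a i, (r i).drop (r i).length,
      ((τ i).drop (n i * (r i).count true)).drop k, ((List.range k).map fun k =>
          ((τ i).drop (n i * (r i).count true)).getD k false).reverse, unary (n i - k)])
      (fun i k hk => unary_ne_nil (Nat.sub_pos_of_lt hk)) (fun i => by simp [unary])
      (.of (.const _ 4) ?_)
    rintro ⟨i, k, hk⟩
    refine ((Runs.pop _ 4).seq (runs_takeProg (by decide) _)).congr ?_ le_rfl
    generalize (τ i).drop (n i * (r i).count true) = u
    have hh : (u.drop k).headD false = u.getD k false := by
      rw [List.headD_eq_head?_getD, List.head?_drop, List.getD_eq_getElem?_getD]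
    have e : setL (setL (setL [a i, (r i).drop (r i).length, u.drop k, ((List.range k).map fun k =>
          u.getD k false).reverse, unary (n i - k)] 4 (unary (n i - k)).tail) 3
          ((u.drop k).headD false :: ((List.range k).map fun k => u.getD k false).reverse)) 2
          (u.drop k).tail
        = [a i, (r i).drop (r i).length, (u.drop k).tail, (u.drop k).headD false ::
          ((List.range k).map fun k => u.getD k false).reverse, (unary (n i - k)).tail] := rfl
    refine (congrArg inputStore e).trans ?_
    rw [hh, List.tail_drop, tail_unary, Nat.sub_sub, List.range_succ, List.map_append,
      List.reverse_append]
    rfl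
  have h3 : PolyRuns sz (clearProg 2)
      (fun i => [a i, (r i).drop (r i).length,
        ((τ i).drop (n i * (r i).count true)).drop (n i),
        (selectBlock (n i) ((r i).count true) (τ i)).reverse, unary (n i - n i)])
      fun i => [a i, (r i).drop (r i).length, [],
        (selectBlock (n i) ((r i).count true) (τ i)).reverse, unary (n i - n i)] :=
    .clear 2 _ (hτ.mono fun i => by
      change (((τ i).drop (n i * (r i).count true)).drop (n i)).length ≤ _
      simp only [List.length_drop]
      omega)
  have h4 : PolyRuns sz (moveProg 3 1)
      (fun i => [a i, (r i).drop (r i).length, [],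
        (selectBlock (n i) ((r i).count true) (τ i)).reverse, unary (n i - n i)])
      fun i => [a i, (selectBlock (n i) ((r i).count true) (τ i)).reverse.reverse
        ++ (r i).drop (r i).length, [], [], unary (n i - n i)] :=
    .move (by decide) _ (hn.mono fun i => by simp [selectBlock])
  have h1' := h1.congr (A' := fun i => [a i, r i, τ i, [], unary (n i)])
    (B' := fun i => [a i, (r i).drop (r i).length, ((τ i).drop (n i * (r i).count true)).drop 0,
        ((List.range 0).map fun k => ((τ i).drop (n i * (r i).count true)).getD k false).reverse,
        unary (n i - 0)]) (fun i => by simp) (fun i => by simp)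
  refine (h1'.seq (h2.seq (h3.seq h4))).congr (fun _ => rfl) fun i => ?_
  simpa [unary] using inputStore_pad [a i, selectBlock (n i) ((r i).count true) (τ i)] 3

end

/-- The extractor used in the soundness argument: the first coins run `B`, and the number of ones
among the last `N` coins selects one of `N + 1` blocks, to which the post-processing of `A` is
applied. -/
theorem exists_blockSampler (A : QPTSampler) (B : PPTSampler) (N : Polynomial ℕ) :
    ∃ B' : PPTSampler, B'.coins = B.coins + N ∧ ∀ lam r, B'.out lam r
      = A.post lam (selectBlock (A.circuit lam).qubits ((r.drop (B.coins.eval lam)).count true)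
          (B.out lam (r.take (B.coins.eval lam)))) := by
  -- Only seeds of the prescribed length are indexed, since `B` promises nothing for other seeds.
  let ι : Type := {x : ℕ × List Bool // x.2.length = (B.coins + N).eval x.1}
  let sz : ι → ℕ := fun i => i.1.1
  let c : ι → ℕ := fun i => B.coins.eval i.1.1
  let n : ι → ℕ := fun i => (A.circuit i.1.1).qubits
  let τ : ι → List Bool := fun i => B.out i.1.1 (i.1.2.take (c i))
  let G : ι → List Bool := fun i => (A.circuit i.1.1).gates.flatMap Gate.encode
  have hcoin : ∀ i : ι, i.1.2.length = c i + N.eval i.1.1 := fun i => by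
    have := i.2
    simpa using this
  have hcr : ∀ i : ι, c i ≤ i.1.2.length := fun i => by have := hcoin i; omega
  have hr1 : ∀ i : ι, (i.1.2.take (c i)).length = B.coins.eval i.1.1 := fun i => by
    rw [List.length_take, min_eq_left (hcr i)]
  have hout : ∀ i : ι, OutputsInTime B.prog [unary i.1.1, i.1.2.take (c i)] (τ i)
      (B.time.eval i.1.1) := fun i => B.computes _ _ (hr1 i)
  have hc : PolyBdd sz c := .eval sz B.coins
  have hE : PolyBdd sz fun i => (A.circuit i.1.1).encode.length :=
    (polyBdd_length_encode A).comp sz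
  have hn : PolyBdd sz n := hE.mono fun i => by
    simp only [QCircuit.encode, encodeIndex, List.length_append, List.length_replicate, n]
    omega
  have hG : PolyBdd sz fun i => (G i).length := hE.mono fun i => by
    simp only [QCircuit.encode, List.length_append, G]
    omega
  have hτ : PolyBdd sz fun i => (τ i).length :=
    ((PolyBdd.self sz).add (.eval sz B.time)).mono fun i => by
      have := (hout i).length_le
      simpa using this
  have hl : PolyBdd sz fun i => (unary i.1.1).length :=
    (PolyBdd.self sz).mono fun i => by simp [sz]
  obtain ⟨q, hq⟩ := exists_polyProg B.coins
  have h1 : PolyRuns sz (copyProg 0 2 3) (fun i => [unary i.1.1, i.1.2])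
      fun i => [unary i.1.1, i.1.2, unary i.1.1 ++ []] :=
    .copy (by decide) (by decide) (by decide) _ (fun _ => rfl) hl
  simp only [List.append_nil] at h1
  have h2 : PolyRuns sz (q.shift 2) (fun i => [unary i.1.1, i.1.2, unary i.1.1])
      fun i => [unary i.1.1, i.1.2, unary i.1.1, unary (c i)] :=
    (hq.comp sz).shift 2 (fun i => [unary i.1.1, i.1.2]) fun _ => rfl
  have h3 := polyRuns_split (fun i : ι => unary i.1.1) (fun i : ι => i.1.2) c hc hcr
  have h4 : PolyRuns sz (B.prog.clean 2) (fun i => [unary i.1.1, i.1.2.take (c i)])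
      fun i => [τ i] :=
    .clean (.eval sz B.time) hout (M := fun i => i.1.1 + c i) ((PolyBdd.self sz).add hc)
      (fun i a ha => by
        simp only [List.mem_cons, List.not_mem_nil, or_false] at ha
        rcases ha with rfl | rfl
        · simp
        · rw [hr1]; exact Nat.le_add_left _ _) 2 (by simp)
  have h4' := h4.shift 2 (fun i => [unary i.1.1, i.1.2.drop (c i)]) fun _ => rfl
  have h5 : PolyRuns sz (copyProg 0 3 4) (fun i => [unary i.1.1, i.1.2.drop (c i), τ i])
      fun i => [unary i.1.1, i.1.2.drop (c i), τ i, unary i.1.1 ++ []] :=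
    .copy (by decide) (by decide) (by decide) _ (fun _ => rfl) hl
  simp only [List.append_nil] at h5
  have h6 : PolyRuns sz ((A.genProg.clean 1).shift 3)
      (fun i => [unary i.1.1, i.1.2.drop (c i), τ i, unary i.1.1])
      fun i => [unary i.1.1, i.1.2.drop (c i), τ i, (A.circuit i.1.1).encode] :=
    ((polyRuns_genProg A).comp sz).shift 3
      (fun i => [unary i.1.1, i.1.2.drop (c i), τ i]) fun _ => rfl
  have h7 : PolyRuns sz (readProg 3 4 5)
      (fun i => [unary i.1.1, i.1.2.drop (c i), τ i, (A.circuit i.1.1).encode])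
      fun i => [unary i.1.1, i.1.2.drop (c i), τ i, G i, unary (n i) ++ []] :=
    .read (by decide) (by decide) (by decide) _ n G (fun _ => rfl) (fun _ => rfl) hn
  simp only [List.append_nil] at h7
  have h8 : PolyRuns sz (clearProg 3)
      (fun i => [unary i.1.1, i.1.2.drop (c i), τ i, G i, unary (n i)])
      fun i => [unary i.1.1, i.1.2.drop (c i), τ i, [], unary (n i)] := .clear 3 _ hG
  have h9 := polyRuns_select (sz := sz) (fun i => unary i.1.1) (fun i => i.1.2.drop (c i)) τ n hn
    ((PolyBdd.eval sz N).mono fun i => by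
      have := hcoin i
      simp only [List.length_drop, sz]
      omega) hτ
  obtain ⟨p, T, hT⟩ : ∃ p, PolyRuns sz p (fun i => [unary i.1.1, i.1.2]) fun i =>
      [unary i.1.1, selectBlock (n i) ((i.1.2.drop (c i)).count true) (τ i)] :=
    ⟨_, h1.seq (h2.seq (h3.seq (h4'.seq (h5.seq (h6.seq (h7.seq (h8.seq h9)))))))⟩
  refine ⟨⟨.seq p A.postProg, B.coins + N, T + A.postTime, fun lam r => A.post lam
    (selectBlock (A.circuit lam).qubits ((r.drop (B.coins.eval lam)).count true)
      (B.out lam (r.take (B.coins.eval lam)))), fun lam r hr => ?_⟩, rfl, fun _ _ => rfl⟩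
  obtain ⟨t, ht, he⟩ := hT ⟨(lam, r), hr⟩
  -- `B` may output a string of any length; the zero padding in `selectBlock` ensures the exact
  -- length for which the post-processing is guaranteed to halt in time.
  obtain ⟨s, t', ht', he', h0⟩ := A.post_computes lam (selectBlock (A.circuit lam).qubits
    ((r.drop (B.coins.eval lam)).count true) (B.out lam (r.take (B.coins.eval lam))))
    (by simp [selectBlock])
  exact ⟨s, t + t', by simpa using Nat.add_le_add ht ht', .seq he he', h0⟩

end QAdv


namespace QAdv

/-! ### From quantum advantage samplers to proofs of quantumness -/

theorem sum_bool_append (a b : ℕ) (g : List Bool → ℝ) :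
    ∑ r : Fin (a + b) → Bool, g (List.ofFn r)
      = ∑ u : Fin a → Bool, ∑ v : Fin b → Bool, g (List.ofFn u ++ List.ofFn v) := by
  rw [← (Fin.appendEquiv a b).sum_comp, Fintype.sum_prod_type]
  simp [Fin.appendEquiv, List.ofFn_fin_append]

theorem sum_count_true (N : ℕ) (g : ℕ → ℝ) :
    ∑ v : Fin N → Bool, g ((List.ofFn v).count true)
      = ∑ j : Fin (N + 1), (N.choose j : ℝ) * g j := by
  rw [Fin.sum_univ_eq_sum_range (fun j => (N.choose j : ℝ) * g j)]
  have h : ∀ v : Fin N → Bool, g ((List.ofFn v).count true)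
      = ∑ j ∈ Finset.range (N + 1), (if (List.ofFn v).count true = j then 1 else 0) * g j := by
    intro v
    have hv : (List.ofFn v).count true ∈ Finset.range (N + 1) := by
      have := List.count_le_length (a := true) (l := List.ofFn v)
      simp at this ⊢
      omega
    simp only [ite_mul, one_mul, zero_mul]
    rw [Finset.sum_ite_eq, if_pos hv]
  simp only [h]
  rw [Finset.sum_comm]
  refine Finset.sum_congr rfl fun j _ => ?_
  rw [← Finset.sum_mul, ← card_count_true]
  push_cast
  rfl

theorem prob_indicator_le_one {α : Type*} (p : PMF α) {β : Type*} [Fintype β] (f : β → α)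
    (hf : Function.Injective f) : ∑ b, (p (f b)).toReal ≤ 1 := by
  classical
  rw [← Finset.sum_image (s := Finset.univ) (f := fun a => (p a).toReal) (fun x _ y _ h => hf h),
    ← tsum_pmf p]
  exact (summable_pmf p).sum_le_tsum _ fun _ _ => ENNReal.toReal_nonneg

theorem PPTSampler.dist_apply (B : PPTSampler) (lam : ℕ) (τ : List Bool) :
    (B.dist lam τ).toReal = (∑ u : Fin (B.coins.eval lam) → Bool,
      if B.out lam (List.ofFn u) = τ then (1 : ℝ) else 0) / 2 ^ B.coins.eval lam := by
  rw [← prob_singleton, PPTSampler.dist, coinFlips_apply]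
  simp only [Set.mem_singleton_iff]

/-- An algorithm whose outputs are accepted with high probability yields, by selecting a random
block, an approximate sampler. -/
theorem statDist_blockSampler_le (A : QPTSampler) (B B' : PPTSampler) (lam k t R : ℕ)
    (hcoins : B'.coins.eval lam = B.coins.eval lam + 2 * k)
    (hout : ∀ r, B'.out lam r = A.post lam (selectBlock (A.circuit lam).qubits
      ((r.drop (B.coins.eval lam)).count true) (B.out lam (r.take (B.coins.eval lam)))))
    (ht : 1 ≤ t) (htk : t ^ 4 ≤ 2 * k + 1) (hR : 1 ≤ R)
    (hB : ∀ τ, (B.dist lam τ).toReal ≤ mixNum lam τ / 2 ^ mixExp lam) :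
    statDist (A.dist lam) (B'.dist lam)
      ≤ (2 + (lam + 1) * R) / t + (1 - prob (B.dist lam)
        {τ | ratioTest ((A.circuit lam).copies (2 * k + 1)).encode lam R τ = true}) := by
  classical
  set C := A.circuit lam with hC
  set acc : Set (List Bool) := {τ | ratioTest (C.copies (2 * k + 1)).encode lam R τ = true}
    with hacc
  obtain ⟨T, hT⟩ := exists_statDist_eq (B'.dist lam) (A.dist lam)
  rw [statDist_comm, hT]
  set c := B.coins.eval lam with hc
  set f : (Fin C.qubits → Bool) → ℝ := fun y => if A.post lam (List.ofFn y) ∈ T then 1 else 0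
    with hf
  -- The probability, over the block-selecting coins alone, that the extractor lands in `T` when `B`
  -- has output `τ`.
  set W : List Bool → ℝ := fun τ => (∑ v : Fin (2 * k) → Bool,
    if A.post lam (selectBlock C.qubits ((List.ofFn v).count true) τ) ∈ T then (1 : ℝ) else 0)
      / 2 ^ (2 * k) with hW
  have hf0 : ∀ y, 0 ≤ f y := fun y => by simp only [hf]; split_ifs <;> simp
  have hf1 : ∀ y, f y ≤ 1 := fun y => by simp only [hf]; split_ifs <;> simp
  have hW0 : ∀ τ, 0 ≤ W τ := fun τ =>
    div_nonneg (Finset.sum_nonneg fun v _ => by split_ifs <;> simp) (by positivity)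
  have hW1 : ∀ τ, W τ ≤ 1 := fun τ => by
    refine div_le_one_of_le₀ ?_ (by positivity)
    refine (Finset.sum_le_sum (g := fun _ => (1 : ℝ)) fun v _ => ?_).trans (by simp)
    split_ifs <;> simp
  have hA : prob (A.dist lam) T = ∑ y, (C.measure y).toReal * f y := by
    rw [QPTSampler.dist, prob_map]
    exact Finset.sum_congr rfl fun y _ => by simp only [hf, mul_ite, mul_one, mul_zero]; rfl
  have hB' : prob (B'.dist lam) T = (∑ u : Fin c → Bool, W (B.out lam (List.ofFn u))) / 2 ^ c := by
    rw [PPTSampler.dist, coinFlips_apply, hcoins,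
      sum_bool_append _ _ fun r => if B'.out lam r ∈ T then (1 : ℝ) else 0, pow_add,
      mul_comm ((2 : ℝ) ^ _), ← div_div, Finset.sum_div]
    refine congrArg (· / _) (Finset.sum_congr rfl fun u _ => ?_)
    have hd : ∀ v : Fin (2 * k) → Bool, (List.ofFn u ++ List.ofFn v).drop c = List.ofFn v :=
      fun v => List.drop_left' (by simp)
    have htk : ∀ v : Fin (2 * k) → Bool, (List.ofFn u ++ List.ofFn v).take c = List.ofFn u :=
      fun v => List.take_left' (by simp)
    simp only [hout, hd, htk, hW]
  -- The distribution of `B` restricted to accepted strings. It is left unnormalized, so its mass is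
  -- only at most one.
  set D : (Fin ((2 * k + 1) * C.qubits) → Bool) → ℝ := fun x =>
    if List.ofFn x ∈ acc then (B.dist lam (List.ofFn x)).toReal else 0 with hD
  have hD0 : ∀ x, 0 ≤ D x := fun x => by
    simp only [hD]; split_ifs
    · exact ENNReal.toReal_nonneg
    · exact le_rfl
  have hacc_sum : (∑ u : Fin c → Bool, if B.out lam (List.ofFn u) ∈ acc then
      W (B.out lam (List.ofFn u)) else 0) / 2 ^ c = ∑ x, D x * W (List.ofFn x) := by
    have hfib : ∀ u : Fin c → Bool, (if B.out lam (List.ofFn u) ∈ acc then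
        W (B.out lam (List.ofFn u)) else 0)
        = ∑ x : Fin ((2 * k + 1) * C.qubits) → Bool, (if B.out lam (List.ofFn u) = List.ofFn x
          then 1 else 0) * (if List.ofFn x ∈ acc then W (List.ofFn x) else 0) := by
      intro u
      by_cases hu : ∃ x : Fin ((2 * k + 1) * C.qubits) → Bool, B.out lam (List.ofFn u) = List.ofFn x
      · obtain ⟨x, hx⟩ := hu
        rw [Finset.sum_eq_single x]
        · simp [hx]
        · intro y _ hy
          rw [hx, if_neg fun h => hy (List.ofFn_injective h).symm, zero_mul]
        · simp
      · rw [Finset.sum_eq_zero fun x _ => by rw [if_neg fun h => hu ⟨x, h⟩, zero_mul]]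
        -- An accepted string that is no measurement outcome has classical weight zero, yet the seed
        -- `u` makes `B` output it with positive probability.
        refine if_neg fun hmem => ?_
        have h0 := mixNum_eq_zero_of_ratioTest (C.copies (2 * k + 1)) lam R _
          (fun x hx => hu ⟨x, hx⟩) hmem
        have h1 := hB (B.out lam (List.ofFn u))
        rw [h0, Nat.cast_zero, zero_div, PPTSampler.dist_apply, div_le_iff₀ (by positivity),
          zero_mul] at h1
        have h2 := Finset.single_le_sum (f := fun u' : Fin c → Bool =>
          if B.out lam (List.ofFn u') = B.out lam (List.ofFn u) then (1 : ℝ) else 0)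
          (fun _ _ => by split_ifs <;> simp) (Finset.mem_univ u)
        simp only [if_true] at h2
        linarith
    simp only [hfib]
    rw [Finset.sum_comm, Finset.sum_div]
    refine Finset.sum_congr rfl fun x _ => ?_
    rw [← Finset.sum_mul]
    simp only [hD, PPTSampler.dist_apply]
    split_ifs
    · ring
    · simp
  have hα : prob (B.dist lam) acc
      = (∑ u : Fin c → Bool, if B.out lam (List.ofFn u) ∈ acc then (1 : ℝ) else 0) / 2 ^ c := by
    rw [PPTSampler.dist, coinFlips_apply]
  -- Rejected outputs contribute at most their total mass, because `W ≤ 1`.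
  have hsplit : prob (B'.dist lam) T ≤ ∑ x, D x * W (List.ofFn x)
      + (1 - prob (B.dist lam) acc) := by
    rw [hB', ← hacc_sum, hα]
    have e1 : (1 : ℝ) = (∑ u : Fin c → Bool, (1 : ℝ)) / 2 ^ c := by simp
    rw [e1, ← sub_div, ← add_div, ← e1, ← Finset.sum_sub_distrib, ← Finset.sum_add_distrib]
    refine div_le_div_of_nonneg_right (Finset.sum_le_sum fun u _ => ?_) (by positivity)
    have := hW1 (B.out lam (List.ofFn u))
    split_ifs <;> linarith
  set q : Fin (2 * k + 1) → ℝ := fun j => ((2 * k).choose j : ℝ) / 2 ^ (2 * k) with hq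
  have hWx : ∀ x : Fin ((2 * k + 1) * C.qubits) → Bool,
      W (List.ofFn x) = ∑ j, q j * f (blockOf x j) := by
    intro x
    simp only [hW]
    rw [sum_count_true (2 * k) fun j =>
      if A.post lam (selectBlock C.qubits j (List.ofFn x)) ∈ T then (1 : ℝ) else 0, Finset.sum_div]
    refine Finset.sum_congr rfl fun j _ => ?_
    simp only [selectBlock_ofFn x j, hq, hf]
    ring
  have ht' : (1 : ℝ) ≤ t := by exact_mod_cast ht
  have hR' : (1 : ℝ) ≤ R := by exact_mod_cast hR
  have hq1 : ∑ j, q j = 1 := by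
    rw [← Finset.sum_div, Fin.sum_univ_eq_sum_range fun j => ((2 * k).choose j : ℝ)]
    have := Nat.sum_range_choose (2 * k)
    rw [div_eq_one_iff_eq (by positivity)]
    exact_mod_cast this
  -- The domination constant `(lam + 1) * R` is that of the acceptance condition: for an accepted
  -- outcome, `B` is bounded by the mixture and the mixture by this multiple of the product measure.
  have hmain := sum_weighted_mean_le (ι := Fin (2 * k + 1)) (fun y => (C.measure y).toReal) f
    (fun y => ENNReal.toReal_nonneg) (sum_measure C) hf0 hf1 q
    (fun j => div_nonneg (Nat.cast_nonneg _) (by positivity)) hq1 (t := t) (δ := 1 / t ^ 2)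
    (C := (lam + 1) * R) ht' (fun j => choose_div_le htk (by omega))
    (by rw [mul_one_div_cancel (by positivity)])
    (by
      have : (1 : ℝ) ≤ lam + 1 := by simp
      nlinarith) (fun z => D (blocksEquiv.symm z)) (fun z => hD0 _)
    (by
      rw [Equiv.sum_comp blocksEquiv.symm D]
      refine (Finset.sum_le_sum fun x _ => ?_).trans
        (prob_indicator_le_one (B.dist lam)
          (fun x : Fin ((2 * k + 1) * C.qubits) → Bool => List.ofFn x) List.ofFn_injective)
      simp only [hD]
      split_ifs
      · exact le_rfl
      · exact ENNReal.toReal_nonneg)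
    (by
      intro z
      obtain ⟨x, rfl⟩ := blocksEquiv.surjective z
      rw [Equiv.symm_apply_apply]
      simp only [blocksEquiv_apply]
      rw [← QCircuit.measure_copies]
      simp only [hD]
      split_ifs with hx
      · exact (hB _).trans ((ratioTest_iff (C.copies (2 * k + 1)) lam R x).1 hx)
      · exact mul_nonneg (by positivity) ENNReal.toReal_nonneg)
  have hsum : ∑ z : Fin (2 * k + 1) → Fin C.qubits → Bool,
      D (blocksEquiv.symm z) * ∑ j, q j * f (z j) = ∑ x, D x * W (List.ofFn x) := by
    rw [← Equiv.sum_comp blocksEquiv]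
    refine Finset.sum_congr rfl fun x _ => ?_
    rw [Equiv.symm_apply_apply, hWx, blocksEquiv_apply]
  rw [hsum, ← hA] at hmain
  linarith

/-! ### Choice of parameters and the equivalence -/

/-- Programs and the verifier work with natural coefficients; rounding each coefficient up suffices
because the arguments are nonnegative. -/
theorem exists_nat_polynomial_ge (p : Polynomial ℝ) : ∃ Q : Polynomial ℕ,
    ∀ n : ℕ, p.eval (n : ℝ) ≤ ((Q.eval n : ℕ) : ℝ) := by
  induction p using Polynomial.induction_on' with
  | add p q hp hq =>
    obtain ⟨P, hP⟩ := hp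
    obtain ⟨Q, hQ⟩ := hq
    exact ⟨P + Q, fun n => by simpa using add_le_add (hP n) (hQ n)⟩
  | monomial k a =>
    refine ⟨Polynomial.monomial k ⌈a⌉₊, fun n => ?_⟩
    rw [Polynomial.eval_monomial, Polynomial.eval_monomial]
    push_cast
    exact mul_le_mul_of_nonneg_right (Nat.le_ceil a) (by positivity)

theorem IsQASOn.exists_isNonInteractiveIVPoQOn {S : Set ℕ} {A : QPTSampler} (h : IsQASOn S A) :
    ∃ (P : QPTSampler) (V : UnboundedVerifier), IsNonInteractiveIVPoQOn S P V := by
  obtain ⟨p, hp, hA⟩ := h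
  obtain ⟨Q₀, hQ₀⟩ := exists_nat_polynomial_ge p
  obtain ⟨Q, hQ, hQ1⟩ : ∃ Q : Polynomial ℕ, (∀ n : ℕ, p.eval (n : ℝ) ≤ ((Q.eval n : ℕ) : ℝ)) ∧
      ∀ n, 1 ≤ Q.eval n :=
    ⟨Q₀ + 1, fun n => by have := hQ₀ n; simp; linarith, fun n => by simp⟩
  -- With these choices both errors equal `1 / (4 * Q)`: the soundness slack `2 / R`, and the
  -- extraction error `(2 + (lam + 1) * R) / t`. Their sum stays below `1 / Q ≤ 1 / p`.
  set R : Polynomial ℕ := 8 * Q with hR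
  set t : Polynomial ℕ := 4 * Q * (2 + (Polynomial.X + 1) * R) with ht
  have hRe : ∀ n, R.eval n = 8 * Q.eval n := fun n => by simp [hR]
  have hte : ∀ n, t.eval n = 4 * Q.eval n * (2 + (n + 1) * R.eval n) := fun n => by simp [ht]
  -- The number of copies is `2 * k + 1` with `k = t ^ 4`, so `t ^ 4 ≤ 2 * k + 1` as the flatness
  -- bound requires.
  obtain ⟨P, hPc, hPp⟩ := exists_copiesSampler A (2 * t ^ 4 + 1)
  refine ⟨P, ratioVerifier P R, fun lam => 1 - 1 / ((R.eval lam : ℕ) : ℝ),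
    fun lam => 1 - 2 / ((R.eval lam : ℕ) : ℝ), R.map (Nat.castRingHom ℝ), fun n => ?_,
    fun lam => ?_, ⟨0, fun lam _ => ratioVerifier_complete P hPp R lam ?_⟩, fun B => ?_⟩
  · rw [Polynomial.eval_natCast_map]
    have : 0 < R.eval n := by have := hQ1 n; rw [hRe]; omega
    simpa using this
  · rw [Polynomial.eval_natCast_map]
    simp only [Nat.coe_castRingHom, Nat.cast_id, ge_iff_le]
    apply le_of_eq
    ring
  · have := hQ1 lam
    rw [hRe]
    omega
  · obtain ⟨B', hB'c, hB'o⟩ := exists_blockSampler A B (2 * t ^ 4)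
    obtain ⟨l0, h0⟩ := hA B'
    obtain ⟨i, hi⟩ := B.exists_le_mixNum
    refine ⟨max l0 i, fun lam hlam hle => ?_⟩
    -- If `B` beats the soundness bound, the extractor `B'` is closer to `A` than `1 / p`.
    by_contra! hcon
    have hsd := h0 lam hlam ((le_max_left _ _).trans hle)
    have hq1 := hQ1 lam
    have hq1' : (1 : ℝ) ≤ ((Q.eval lam : ℕ) : ℝ) := by exact_mod_cast hq1
    have hR1 : 1 ≤ R.eval lam := by rw [hRe]; omega
    have ht1 : 1 ≤ t.eval lam := by
      rw [hte]
      exact Nat.one_le_iff_ne_zero.2 (by positivity)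
    have hbound := statDist_blockSampler_le A B B' lam (t.eval lam ^ 4) (t.eval lam) (R.eval lam)
      (by rw [hB'c]; simp) (hB'o lam) ht1 (by omega) hR1
      (hi lam ((le_max_right _ _).trans hle))
    rw [acceptProb_ratioVerifier, hPc] at hcon
    have hM : (2 * t ^ 4 + 1).eval lam = 2 * t.eval lam ^ 4 + 1 := by simp
    rw [hM] at hcon
    have e1 : (2 + ((lam : ℝ) + 1) * ((R.eval lam : ℕ) : ℝ)) / ((t.eval lam : ℕ) : ℝ)
        = 1 / (4 * ((Q.eval lam : ℕ) : ℝ)) := by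
      rw [hte]
      push_cast
      rw [div_eq_div_iff (by positivity) (by positivity)]
      ring
    have e2 : 2 / ((R.eval lam : ℕ) : ℝ) = 1 / (4 * ((Q.eval lam : ℕ) : ℝ)) := by
      rw [hRe]
      push_cast
      rw [div_eq_div_iff (by positivity) (by positivity)]
      ring
    rw [e1] at hbound
    rw [e2] at hcon
    have e3 : 1 / (4 * ((Q.eval lam : ℕ) : ℝ)) + 1 / (4 * ((Q.eval lam : ℕ) : ℝ))
        ≤ 1 / ((Q.eval lam : ℕ) : ℝ) := by
      rw [← add_div, div_le_div_iff₀ (by positivity) (by positivity)]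
      linarith
    have e4 : 1 / ((Q.eval lam : ℕ) : ℝ) ≤ 1 / p.eval (lam : ℝ) :=
      one_div_le_one_div_of_le (hp lam) (hQ lam)
    linarith

theorem exists_isQASOn_iff (S : Set ℕ) : (∃ A : QPTSampler, IsQASOn S A) ↔
    ∃ (P : QPTSampler) (V : UnboundedVerifier), IsNonInteractiveIVPoQOn S P V :=
  ⟨fun ⟨_, h⟩ => h.exists_isNonInteractiveIVPoQOn, fun ⟨P, _, h⟩ => ⟨P, h.isQASOn⟩⟩

end QAdv

theorem mainTheorem5 :
    ((∃ A : QAdv.QPTSampler, QAdv.IsQAS A) ↔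
      ∃ (P : QAdv.QPTSampler) (V : QAdv.UnboundedVerifier), QAdv.IsNonInteractiveIVPoQ P V) ∧
    (∀ S : Set ℕ, S.Infinite →
      ((∃ A : QAdv.QPTSampler, QAdv.IsQASOn S A) ↔
        ∃ (P : QAdv.QPTSampler) (V : QAdv.UnboundedVerifier),
          QAdv.IsNonInteractiveIVPoQOn S P V)) :=
  ⟨QAdv.exists_isQASOn_iff Set.univ, fun S _ => QAdv.exists_isQASOn_iff S⟩
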